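/- For $|z|<1$ let $\mathrm{Li}_n(z)=\sum_{k>0}z^k/k^n$; let $\zeta(n)=\sum_{k>0}k^{-n}$, $\beta(n)=\sum_{k\ge0}(-1)^k(2k+1)^{-n}$, and let $L_n=(-\log2)^n/n!$ for $n\ge0$, $L_n=0$ for $n<0$. Define $$A_n=\mathrm{Li}_n(\tfrac12),\qquad B_n+iF_n=2^{n-1}\,\mathrm{Li}_n(\tfrac{1+i}2),$$ $$C_n=\Re\{(2/3)^{n-1}\,\mathrm{Li}_n(\tfrac{i}{\sqrt8})-2^n\,\mathrm{Li}_n(\tfrac{-i}{\sqrt2})\},$$ $$D_n+iG_n=(2/3)^{n-1}\,\mathrm{Li}_n(\tfrac{1+i}4)-\mathrm{Li}_n(\tfrac{-i}2),\qquad E_n+iH_n=(2/5)^{n-1}\,\mathrm{Li}_n(\tfrac{1-i}8)-2\,\mathrm{Li}_n(\tfrac{-i}2),$$ where $B_n,D_n,E_n,F_n,G_n,H_n$ are real, and put $\overline A_n=A_n+L_n-\tfrac12\zeta(2)L_{n-2}$; $\overline X_n=X_n+\tfrac12L_n-c_X\,\zeta(2)L_{n-2}$ for $X=B,C,D,E$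 with $c_B=\tfrac58$, $c_C=\tfrac13$, $c_D=\tfrac5{24}$, $c_E=\tfrac7{40}$; and $\overline X_n=X_n-\tfrac{\pi}{4}L_{n-1}$ for $X=F,G,H$. For integers $a_1,\dots,a_8$, extended to a sequence $(a_k)_{k\ge1}$ of period 8, let $$S_{n,p}(a_1,\dots,a_8)=\sum_{k>0}\frac{a_k}{2^{\lfloor(pk+p)/2\rfloor}\,k^n}.$$ A real number $x\ge0$ is said to be in $\mathrm{SC}^*$ if its $d$th hexadecimal digit can be computed simultaneously in time $O(d\log^{O(1)}d)$ and space $O(\log^{O(1)}d)$, where either of the digit strings $a\,\mathrm{FF}\ldots\mathrm F$ and $(a{+}1)\,00\ldots0$ is acceptable when they cannot be told apart within a prescribed power of $\log d$ digits. Precisely: for every $c\in\mathbb N$ there are a register machine (finitely many registers holding natural numbers; assignment of constants, $+$, truncated $-$, $\times$, integer division and remainder, tests for zero; an arithmetic instruction is charged the product of the incremented bit lengths of its operands, and space is the largest total bit length of the registers during the run) and constants $K,k$ such that, for every $d\ge1$, the machine on input $d$ halts in time at most $K\,d\,\lfloor\log_2(d+1)\rfloor^k$ and space at most $K\lfloor\log_2(d+1)\rfloor^k$,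 and its output is the $d$th hexadecimal digit $\lfloor16^dy\rfloor\bmod16$ of some real $y\ge0$ with $|y-x|<16^{-(d+m)}$, where $m=\lfloor\log_2(d+1)\rfloor^c$. (The output can thus differ from the $d$th digit of $x$ only if the next $m$ digits of $x$ are all $0$ or all $\mathrm F$.) Then the following hold. (1) Ladder relations of order 4: $$\overline B_4-\tfrac52\overline A_4=\tfrac{343}{128}\zeta(4),\qquad \overline C_4-\tfrac79\overline A_4=\tfrac5{54}\zeta(4),$$ $$\overline D_4-\tfrac13\overline A_4=-\tfrac{313}{3456}\zeta(4),\qquad \overline E_4-\tfrac6{25}\overline A_4=-\tfrac{1547}{16000}\zeta(4),$$ $$\overline G_4-\tfrac23\overline F_4-\beta(3)\log2=-\tfrac{80}{27}\beta(4),\qquad \overline H_4-\tfrac45\overline F_4-\tfrac{23}{25}\beta(3)\log2=-\tfrac{384}{125}\beta(4).$$ (2) BBP-type formulas: $$\tfrac{615}{256}\log^42=3\,S_{4,1}(73,-2617,-73,-5066,-73,-2617,73,-27564)+S_{4,3}(1258,-761,-1258,-497,-1258,-761,1258,2019),$$ $$\tfrac{41}{9216}\pi^4=3\,S_{4,1}(1,-19,-1,-2,-1,-19,1,-108)+2\,S_{4,3}(3,-1,-3,-2,-3,-1,3,4).$$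 (3) $\pi^4$, $\pi^2\log^22$ and $\log^42$ are in $\mathrm{SC}^*$. -/

import Mathlib

namespace Ladder

noncomputable section

/-! ### Polylogarithms and the constants -/

/-- `Li_n(z) = ∑_{k>0} z^k / k^n`. -/
def Li (n : ℕ) (z : ℂ) : ℂ := ∑' k : ℕ, z ^ (k + 1) / ((k + 1 : ℕ) : ℂ) ^ n

/-- `ζ(n) = ∑_{k>0} k^{-n}` (used for `n = 2, 4`). -/
def zeta (n : ℕ) : ℝ := ∑' k : ℕ, 1 / ((k + 1 : ℕ) : ℝ) ^ n

/-- `β(n) = ∑_{k≥0} (-1)^k (2k+1)^{-n}`. Used for `n = 3, 4` only; the series for `β(1)` is merely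
conditionally convergent, so that `β(1)` is written as `π / 4` below. -/
def beta (n : ℕ) : ℝ := ∑' k : ℕ, (-1 : ℝ) ^ k / ((2 * k + 1 : ℕ) : ℝ) ^ n

/-- `L_n = (-log 2)^n / n!`, with `L_n = 0` for `n < 0`. -/
def L (n : ℤ) : ℝ := if n < 0 then 0 else (-Real.log 2) ^ n.toNat / (n.toNat.factorial : ℝ)

/-- `S_{n,p}(a_1, …, a_8) = ∑_{k>0} a_k / (2^⌊(pk+p)/2⌋ k^n)`, where `a` has period 8. The entry
`a_k` is `a (k - 1)` in the zero-based indexing of `Fin 8`; the summation index is `k - 1`. -/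
def S (n p : ℕ) (a : Fin 8 → ℤ) : ℝ :=
  ∑' j : ℕ, (a (Fin.ofNat 8 j) : ℝ) / ((2 : ℝ) ^ ((p * (j + 1) + p) / 2) * ((j + 1 : ℕ) : ℝ) ^ n)

/-- The series for `Li_n(z)` converges for `|z| < 1`. -/
theorem summable_Li (n : ℕ) {z : ℂ} (hz : ‖z‖ < 1) :
    Summable fun k : ℕ => z ^ (k + 1) / ((k + 1 : ℕ) : ℂ) ^ n := by
  refine Summable.of_norm_bounded (summable_geometric_of_lt_one (norm_nonneg z) hz) fun k => ?_
  rw [norm_div, norm_pow, norm_pow, Complex.norm_natCast]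
  have h1 : (1 : ℝ) ≤ ((k + 1 : ℕ) : ℝ) ^ n := one_le_pow₀ (by push_cast; linarith [k.cast_nonneg (α := ℝ)])
  calc ‖z‖ ^ (k + 1) / ((k + 1 : ℕ) : ℝ) ^ n ≤ ‖z‖ ^ (k + 1) := div_le_self (by positivity) h1
    _ ≤ ‖z‖ ^ k := pow_le_pow_of_le_one (norm_nonneg z) hz.le (Nat.le_succ k)

/-- The series `S_{n,p}` converges for `n ≥ 2`. -/
theorem summable_S (n p : ℕ) (hn : 2 ≤ n) (a : Fin 8 → ℤ) :
    Summable fun j : ℕ => (a (Fin.ofNat 8 j) : ℝ) /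
      ((2 : ℝ) ^ ((p * (j + 1) + p) / 2) * ((j + 1 : ℕ) : ℝ) ^ n) := by
  have h0 : Summable fun j : ℕ => 1 / ((j + 1 : ℕ) : ℝ) ^ n :=
    (summable_nat_add_iff 1).2 (Real.summable_one_div_nat_pow.2 hn)
  refine Summable.of_norm_bounded (h0.mul_left (∑ i, |(a i : ℝ)|)) fun j => ?_
  have hk : (0 : ℝ) < ((j + 1 : ℕ) : ℝ) ^ n := by positivity
  have h2 : (1 : ℝ) ≤ (2 : ℝ) ^ ((p * (j + 1) + p) / 2) := one_le_pow₀ (by norm_num)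
  rw [Real.norm_eq_abs, abs_div,
    abs_of_pos (a := (2 : ℝ) ^ ((p * (j + 1) + p) / 2) * ((j + 1 : ℕ) : ℝ) ^ n) (by positivity),
    mul_one_div]
  exact div_le_div₀ (Finset.sum_nonneg fun i _ => abs_nonneg _)
    (Finset.single_le_sum (f := fun i => |(a i : ℝ)|) (fun i _ => abs_nonneg _) (Finset.mem_univ _))
    hk (le_mul_of_one_le_left hk.le h2)

/-! ### The eight ladders -/

def A (n : ℕ) : ℝ := (Li n (1 / 2)).re

def B (n : ℕ) : ℝ := ((2 : ℂ) ^ ((n : ℤ) - 1) * Li n ((1 + Complex.I) / 2)).re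

def C (n : ℕ) : ℝ :=
  ((2 / 3 : ℂ) ^ ((n : ℤ) - 1) * Li n (Complex.I / (√8 : ℝ))
    - (2 : ℂ) ^ n * Li n (-Complex.I / (√2 : ℝ))).re

def D (n : ℕ) : ℝ :=
  ((2 / 3 : ℂ) ^ ((n : ℤ) - 1) * Li n ((1 + Complex.I) / 4) - Li n (-Complex.I / 2)).re

def E (n : ℕ) : ℝ :=
  ((2 / 5 : ℂ) ^ ((n : ℤ) - 1) * Li n ((1 - Complex.I) / 8) - 2 * Li n (-Complex.I / 2)).re

def F (n : ℕ) : ℝ := ((2 : ℂ) ^ ((n : ℤ) - 1) * Li n ((1 + Complex.I) / 2)).im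

def G (n : ℕ) : ℝ :=
  ((2 / 3 : ℂ) ^ ((n : ℤ) - 1) * Li n ((1 + Complex.I) / 4) - Li n (-Complex.I / 2)).im

def H (n : ℕ) : ℝ :=
  ((2 / 5 : ℂ) ^ ((n : ℤ) - 1) * Li n ((1 - Complex.I) / 8) - 2 * Li n (-Complex.I / 2)).im

def Abar (n : ℕ) : ℝ := A n + L n - 1 / 2 * zeta 2 * L ((n : ℤ) - 2)
def Bbar (n : ℕ) : ℝ := B n + 1 / 2 * L n - 5 / 8 * zeta 2 * L ((n : ℤ) - 2)
def Cbar (n : ℕ) : ℝ := C n + 1 / 2 * L n - 1 / 3 * zeta 2 * L ((n : ℤ) - 2)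
def Dbar (n : ℕ) : ℝ := D n + 1 / 2 * L n - 5 / 24 * zeta 2 * L ((n : ℤ) - 2)
def Ebar (n : ℕ) : ℝ := E n + 1 / 2 * L n - 7 / 40 * zeta 2 * L ((n : ℤ) - 2)
def Fbar (n : ℕ) : ℝ := F n - Real.pi / 4 * L ((n : ℤ) - 1)
def Gbar (n : ℕ) : ℝ := G n - Real.pi / 4 * L ((n : ℤ) - 1)
def Hbar (n : ℕ) : ℝ := H n - Real.pi / 4 * L ((n : ℤ) - 1)

end

/-! ### The machine model

A register machine with finitely many registers, each holding a natural number, under a logarithmic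
(bit) cost measure. Every arithmetic instruction is charged the product of the (incremented) bit
lengths of its operands, which bounds the schoolbook cost of that instruction on a multitape Turing
machine; space is the total bit length of all registers, at its largest during the run. Time and
space bounded by this measure are therefore, up to constant factors, time and space bounds for a
multitape Turing machine. -/

/-- Arithmetic instructions. -/
inductive Op
  | add | sub | mul | div | mod

/-- Truncated subtraction; division with remainder (with `y / 0 = 0` and `y mod 0 = y`). -/
def Op.eval : Op → ℕ → ℕ → ℕ
  | .add, y, z => y + z
  | .sub, y, z => y - z
  | .mul, y, z => y * z
  | .div, y, z => y / z
  | .mod, y, z => y % z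

/-- Programs with `r` registers. -/
inductive Prog (r : ℕ)
  /-- `x := n` -/
  | const (x : Fin r) (n : ℕ)
  /-- `x := y o z` -/
  | arith (o : Op) (x y z : Fin r)
  /-- `p; q` -/
  | seq (p q : Prog r)
  /-- `if x = 0 then p else q` -/
  | ifZero (x : Fin r) (p q : Prog r)
  /-- `while x ≠ 0 do p` -/
  | while (x : Fin r) (p : Prog r)

/-- The total bit length of the registers. -/
def bits {r : ℕ} (σ : Fin r → ℕ) : ℕ := ∑ i, (σ i).size

/-- `Runs p σ τ t s`: started with register contents `σ`, the program `p` halts with register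
contents `τ`, after time `t`, using space `s`. -/
inductive Runs {r : ℕ} : Prog r → (Fin r → ℕ) → (Fin r → ℕ) → ℕ → ℕ → Prop
  | const (x : Fin r) (n : ℕ) (σ : Fin r → ℕ) :
      Runs (.const x n) σ (Function.update σ x n) (1 + n.size)
        (max (bits σ) (bits (Function.update σ x n)))
  | arith (o : Op) (x y z : Fin r) (σ : Fin r → ℕ) :
      Runs (.arith o x y z) σ (Function.update σ x (o.eval (σ y) (σ z)))
        ((1 + (σ y).size) * (1 + (σ z).size))
        (max (bits σ) (bits (Function.update σ x (o.eval (σ y) (σ z)))))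
  | seq {p q : Prog r} {σ τ ρ : Fin r → ℕ} {t t' s s' : ℕ} :
      Runs p σ τ t s → Runs q τ ρ t' s' → Runs (.seq p q) σ ρ (t + t') (max s s')
  | ifZero_zero {x : Fin r} {p q : Prog r} {σ τ : Fin r → ℕ} {t s : ℕ} :
      σ x = 0 → Runs p σ τ t s → Runs (.ifZero x p q) σ τ (1 + t) s
  | ifZero_ne {x : Fin r} {p q : Prog r} {σ τ : Fin r → ℕ} {t s : ℕ} :
      σ x ≠ 0 → Runs q σ τ t s → Runs (.ifZero x p q) σ τ (1 + t) s
  | while_zero {x : Fin r} {p : Prog r} {σ : Fin r → ℕ} :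
      σ x = 0 → Runs (.while x p) σ σ 1 (bits σ)
  | while_ne {x : Fin r} {p : Prog r} {σ τ ρ : Fin r → ℕ} {t t' s s' : ℕ} :
      σ x ≠ 0 → Runs p σ τ t s → Runs (.while x p) τ ρ t' s' →
      Runs (.while x p) σ ρ (1 + t + t') (max s s')

/-! ### The class SC* -/

/-- `a` is an acceptable value for the `d`-th base-`b` digit `⌊b^d x⌋ mod b` of `x ≥ 0` (`d ≥ 1`),
up to ambiguities of length `m`: it is the `d`-th digit of a number `y ≥ 0` at distance less than
`b^{-(d+m)}` from `x`. It can differ from the true digit only if the `m` digits of `x` that follow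
the `d`-th one are all `0` or all `b - 1`, that is, if the computation would have to tell
`a (b-1) (b-1) … (b-1)` from `(a+1) 0 0 … 0`; then both `a` and `a + 1` are acceptable. -/
def AcceptableDigit (b : ℕ) [NeZero b] (x : ℝ) (d m a : ℕ) : Prop :=
  ∃ y : ℝ, 0 ≤ y ∧ |y - x| < 1 / (b : ℝ) ^ (d + m) ∧ a = (Real.digits y b (d - 1) : ℕ)

/-- `x ≥ 0` is in SC* for the base `b`: its `d`-th base-`b` digit can be computed in simultaneous
time `O(d log^{O(1)} d)` and space `O(log^{O(1)} d)`. The number `d` is the content of register `0`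
at the start, where all other registers are `0`, and the digit is the content of register `0` at the
end. Ambiguities between digit strings `a (b-1) (b-1) …` and `(a+1) 0 0 …` are resolved up to an
arbitrarily high power of `log d`. -/
def SCStar (b : ℕ) [NeZero b] (x : ℝ) : Prop :=
  ∀ c : ℕ, ∃ (r : ℕ) (p : Prog (r + 1)) (K k : ℕ), ∀ d : ℕ, 1 ≤ d →
    ∃ (τ : Fin (r + 1) → ℕ) (t s : ℕ),
      Runs p (Function.update 0 0 d) τ t s ∧
      t ≤ K * (d * Nat.log 2 (d + 1) ^ k) ∧
      s ≤ K * Nat.log 2 (d + 1) ^ k ∧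
      AcceptableDigit b x d (Nat.log 2 (d + 1) ^ c) (τ 0)

end Ladder

open Ladder

/-!
The ladder relations come from Kummer's functional equation in weight four: a fixed integer
combination of `Li₄ z` over twenty rational functions `z` of `x` and `y`, for each of which `1 - z`
is a product of powers of `1 - x y`, `1 - x - y`, `1 - x + x y`, `1 - y + x y`, `1 - x` and `1 - y`,
equals `3/2 log² (1 - x) log² (1 - y)`. On the ray `(t x, t y)` every argument has the form
`a tⁿ (1 - t x) ^ ξ (1 - t y) ^ η`. Hence differentiation by `t` turns the combination of `Li_m`,
weighted by a monomial in the exponents `n`, `ξ`, `η`, into combinations of `Li_{m-1}` whose weights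
have one degree more. As `Li₁ z = -log (1 - z)`, the combinations with weights of degree three are
governed by integer identities between the exponents, and three integrations lead back to `Li₄`. At
suitable Gaussian integers `x` and `y` the twenty terms reduce, by inversion, duplication and
conjugation, to the polylogarithms of the ladders.

The ladder arguments lie on rays at multiples of the angle `π / 4`, with absolute values powers of
`√2`, so the real parts of their polylogarithms are series with numerators of period eight over
powers of two. Eliminating between the ladder relations expresses each of the three constants by
such series.

To find the `d`-th digit, the series are multiplied by `16 ^ E`, where `E - d` is a polynomial in
`log d`, and the floors `⌊16 ^ e / q⌋` of their terms are summed modulo a number `V` of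
polylogarithmic length. Modulo `V` the floor is the quotient by `q` of `16 ^ e mod q V`, which
repeated squaring computes without larger numbers than squares of `q V`. The roundings and the
truncation of the series spoil only `O(log d)` digits of the sum.
-/

namespace Ladder

section Analysis

open scoped ComplexConjugate
open Complex Set Filter Topology MeasureTheory

/-! ### The polylogarithm on the cut plane -/

-- A convex subset of `U` that contains `c` and is a neighbourhood of `z` is the join of `c` with a
-- small ball about `z`, so that the Poincaré lemma for convex sets applies.
theorem hasDerivAt_integral_lineMap_of_starConvex {E : Type*} [NormedAddCommGroup E]
    [NormedSpace ℂ E] [CompleteSpace E] {U : Set ℂ} {c z : ℂ} {g : ℂ → E} (hU : IsOpen U)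
    (hstar : StarConvex ℝ c U) (hg : DifferentiableOn ℂ g U) (hz : z ∈ U) :
    HasDerivAt (fun w : ℂ => ∫ t in (0 : ℝ)..1, (w - c) • g (AffineMap.lineMap c w t)) (g z) z := by
  let _ : NormedSpace ℝ E := .restrictScalars ℝ ℂ E
  obtain ⟨ε, hε, hball⟩ := Metric.isOpen_iff.1 hU z hz
  set s : Set ℂ := convexJoin ℝ {c} (Metric.ball z ε) with hs
  have hsU : s ⊆ U := by
    rw [hs, convexJoin_singleton_left]
    exact iUnion₂_subset fun y hy => starConvex_iff_segment_subset.1 hstar (hball hy)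
  have hconv : Convex ℝ s := (convex_singleton c).convexJoin (convex_ball z ε)
  have hcs : c ∈ s := subset_convexJoin_left ⟨z, Metric.mem_ball_self hε⟩ (mem_singleton c)
  have hsz : s ∈ 𝓝 z := mem_of_superset (Metric.ball_mem_nhds z hε)
    (subset_convexJoin_right (singleton_nonempty c))
  have hclosed : ∀ x ∈ s, HasFDerivWithinAt (ContinuousLinearMap.smulRightL ℂ ℂ E 1 ∘ g) _ s x :=
    fun x hx => (ContinuousLinearMap.smulRightL ℂ ℂ E 1).hasFDerivAt.comp_hasDerivWithinAt x
      ((hg x (hsU hx)).mono hsU).hasDerivWithinAt |>.restrictScalars ℝ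
  have h := hconv.hasFDerivWithinAt_curveIntegral_segment_of_hasFDerivWithinAt_symmetric hclosed
    (fun a _ x _ y _ => by simpa using smul_comm ..) hcs (mem_of_mem_nhds hsz)
  simp only [curveIntegral_segment] at h
  refine (h.hasFDerivAt hsz).hasDerivAt.congr_deriv ?_
  simp

/-- The plane cut along `[1, ∞)`, on which the polylogarithms are holomorphic. -/
def cutPlane : Set ℂ := {z | 1 - z ∈ slitPlane}

theorem isOpen_cutPlane : IsOpen cutPlane :=
  isOpen_slitPlane.preimage (continuous_const.sub continuous_id)

theorem mem_cutPlane_iff {z : ℂ} : z ∈ cutPlane ↔ z.re < 1 ∨ z.im ≠ 0 := by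
  simp [cutPlane, mem_slitPlane_iff]

theorem mem_cutPlane_of_norm_lt_one {z : ℂ} (hz : ‖z‖ < 1) : z ∈ cutPlane :=
  mem_cutPlane_iff.2 (Or.inl ((re_le_norm z).trans_lt hz))

theorem zero_mem_cutPlane : (0 : ℂ) ∈ cutPlane := mem_cutPlane_of_norm_lt_one (by simp)

theorem starConvex_zero_cutPlane : StarConvex ℝ 0 cutPlane := by
  intro z hz a b ha hb hab
  have h := starConvex_one_slitPlane hz ha hb hab
  rw [smul_sub, ← add_sub_assoc, ← add_smul, hab, one_smul] at h
  rwa [smul_zero, zero_add]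

/-- The polylogarithm `Li_{n+1}`, continued to the plane cut along `[1, ∞)`. The order is shifted by
one so that the recursion starts with a logarithm; `dslope` removes the singularity of
`Li_{n+1}(z) / z` at the origin. -/
noncomputable def polylog : ℕ → ℂ → ℂ
  | 0, z => -log (1 - z)
  | n + 1, z => ∫ t in (0 : ℝ)..1, z * dslope (polylog n) 0 (t * z)

theorem polylog_apply_zero (n : ℕ) : polylog n 0 = 0 := by
  cases n <;> simp [polylog]

theorem hasDerivAt_polylog_succ_of_differentiableOn {n : ℕ}
    (h : DifferentiableOn ℂ (polylog n) cutPlane) {z : ℂ} (hz : z ∈ cutPlane) :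
    HasDerivAt (polylog (n + 1)) (dslope (polylog n) 0 z) z := by
  have hslope : DifferentiableOn ℂ (dslope (polylog n) 0) cutPlane :=
    (differentiableOn_dslope (isOpen_cutPlane.mem_nhds zero_mem_cutPlane)).2 h
  have h := hasDerivAt_integral_lineMap_of_starConvex isOpen_cutPlane starConvex_zero_cutPlane
    hslope hz
  simp only [AffineMap.lineMap_apply, vsub_eq_sub, vadd_eq_add, sub_zero, add_zero, smul_eq_mul,
    real_smul] at h
  exact h

theorem differentiableOn_polylog (n : ℕ) : DifferentiableOn ℂ (polylog n) cutPlane := by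
  induction n with
  | zero =>
    exact fun z hz =>
      ((differentiableAt_id.const_sub 1).clog hz).neg.differentiableWithinAt
  | succ n ih =>
    exact fun z hz =>
      (hasDerivAt_polylog_succ_of_differentiableOn ih hz).differentiableAt.differentiableWithinAt

theorem hasDerivAt_polylog_succ (n : ℕ) {z : ℂ} (hz : z ∈ cutPlane) (h0 : z ≠ 0) :
    HasDerivAt (polylog (n + 1)) (polylog n z / z) z := by
  have h := hasDerivAt_polylog_succ_of_differentiableOn (differentiableOn_polylog n) hz
  rwa [dslope_of_ne _ h0, slope_def_field, polylog_apply_zero, sub_zero, sub_zero] at h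

theorem continuousAt_polylog (n : ℕ) {z : ℂ} (hz : z ∈ cutPlane) : ContinuousAt (polylog n) z :=
  ((differentiableOn_polylog n).differentiableAt (isOpen_cutPlane.mem_nhds hz)).continuousAt

theorem norm_ofReal_mul_lt_one {t : ℝ} (ht : t ∈ Icc (0 : ℝ) 1) {z : ℂ} (hz : ‖z‖ < 1) :
    ‖(t : ℂ) * z‖ < 1 := by
  rw [norm_mul, norm_real, Real.norm_of_nonneg ht.1]
  exact (mul_le_of_le_one_left (norm_nonneg z) ht.2).trans_lt hz

theorem hasSum_Li {n : ℕ} {z : ℂ} (hz : ‖z‖ < 1) :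
    HasSum (fun k : ℕ => z ^ (k + 1) / ((k + 1 : ℕ) : ℂ) ^ n) (Li n z) :=
  (summable_Li n hz).hasSum

open scoped Interval in
theorem integral_Li_mul_div (n : ℕ) {z : ℂ} (hz : ‖z‖ < 1) :
    ∫ t in (0 : ℝ)..1, Li n (t * z) / t = Li (n + 1) z := by
  have hterm : ∀ k : ℕ, ∫ t in (0 : ℝ)..1, z ^ (k + 1) / ((k + 1 : ℕ) : ℂ) ^ n * (t : ℂ) ^ k =
      z ^ (k + 1) / ((k + 1 : ℕ) : ℂ) ^ (n + 1) := by
    intro k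
    have hpow : ∫ t in (0 : ℝ)..1, (t : ℂ) ^ k = 1 / ((k + 1 : ℕ) : ℂ) := by
      simpa [integral_pow] using
        intervalIntegral.integral_ofReal (a := 0) (b := 1) (μ := volume) (f := fun t => t ^ k)
    rw [intervalIntegral.integral_const_mul, hpow, pow_succ _ n, mul_one_div, div_div]
  have hbound : ∀ (k : ℕ), ∀ t ∈ Ι (0 : ℝ) 1,
      ‖z ^ (k + 1) / ((k + 1 : ℕ) : ℂ) ^ n * (t : ℂ) ^ k‖ ≤ ‖z‖ ^ (k + 1) := by
    intro k t ht
    rw [uIoc_of_le zero_le_one] at ht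
    rw [norm_mul, norm_div, norm_pow, norm_pow, norm_pow, norm_natCast, norm_real,
      Real.norm_of_nonneg ht.1.le]
    exact (mul_le_of_le_one_right (by positivity) (pow_le_one₀ ht.1.le ht.2)).trans
      (div_le_self (by positivity) (one_le_pow₀ (by exact_mod_cast k.succ_pos)))
  have hseries : ∀ t ∈ Ι (0 : ℝ) 1, HasSum
      (fun k : ℕ => z ^ (k + 1) / ((k + 1 : ℕ) : ℂ) ^ n * (t : ℂ) ^ k) (Li n (t * z) / t) := by
    intro t ht
    rw [uIoc_of_le zero_le_one] at ht
    have hlt : ‖(t : ℂ) * z‖ < 1 := norm_ofReal_mul_lt_one (Ioc_subset_Icc_self ht) hz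
    have ht0 : (t : ℂ) ≠ 0 := ofReal_ne_zero.2 ht.1.ne'
    refine ((hasSum_Li hlt).div_const (t : ℂ)).congr_fun fun k => ?_
    rw [mul_pow, pow_succ (t : ℂ)]
    field_simp
  have h := intervalIntegral.hasSum_integral_of_dominated_convergence
    (μ := volume) (fun k _ => ‖z‖ ^ (k + 1))
    (fun k => (by fun_prop : Continuous fun t : ℝ =>
      z ^ (k + 1) / ((k + 1 : ℕ) : ℂ) ^ n * (t : ℂ) ^ k).aestronglyMeasurable)
    (fun k => Eventually.of_forall (hbound k))
    (Eventually.of_forall fun _ _ =>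
      (summable_nat_add_iff 1).2 (summable_geometric_of_lt_one (norm_nonneg z) hz))
    intervalIntegrable_const (Eventually.of_forall hseries)
  simp only [hterm] at h
  exact h.unique (hasSum_Li hz)

theorem polylog_eq_Li (n : ℕ) {z : ℂ} (hz : ‖z‖ < 1) : polylog n z = Li (n + 1) z := by
  induction n generalizing z with
  | zero =>
    have h := hasSum_taylorSeries_neg_log hz
    rw [← hasSum_nat_add_iff' 1] at h
    simpa [polylog, Li] using h.tsum_eq.symm
  | succ n ih =>
    rw [← integral_Li_mul_div (n + 1) hz, polylog]
    refine intervalIntegral.integral_congr_Ioo_of_le zero_le_one fun t ht => ?_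
    have hlt : ‖(t : ℂ) * z‖ < 1 := norm_ofReal_mul_lt_one (Ioo_subset_Icc_self ht) hz
    have ht0 : (t : ℂ) ≠ 0 := ofReal_ne_zero.2 ht.1.ne'
    rcases eq_or_ne z 0 with rfl | hz0
    · simp [Li]
    · simp only [dslope_of_ne _ (mul_ne_zero ht0 hz0), slope_def_field, polylog_apply_zero,
        sub_zero, ih hlt]
      field_simp

theorem norm_term_Li_le (n k : ℕ) {z : ℂ} (hz : ‖z‖ ≤ 1) :
    ‖z ^ (k + 1) / ((k + 1 : ℕ) : ℂ) ^ n‖ ≤ 1 / ((k + 1 : ℕ) : ℝ) ^ n := by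
  rw [norm_div, norm_pow, norm_pow, norm_natCast]
  gcongr
  exact pow_le_one₀ (norm_nonneg z) hz

theorem summable_one_div_succ_pow {n : ℕ} (hn : 2 ≤ n) :
    Summable fun k : ℕ => 1 / ((k + 1 : ℕ) : ℝ) ^ n :=
  (summable_nat_add_iff 1).2 (Real.summable_one_div_nat_pow.2 hn)

theorem summable_Li_of_norm_le_one {n : ℕ} (hn : 2 ≤ n) {z : ℂ} (hz : ‖z‖ ≤ 1) :
    Summable fun k : ℕ => z ^ (k + 1) / ((k + 1 : ℕ) : ℂ) ^ n :=
  .of_norm_bounded (summable_one_div_succ_pow hn) fun k => norm_term_Li_le n k hz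

theorem continuousOn_Li {n : ℕ} (hn : 2 ≤ n) : ContinuousOn (Li n) (Metric.closedBall 0 1) :=
  continuousOn_tsum (fun k => by fun_prop) (summable_one_div_succ_pow hn)
    fun k _ hz => norm_term_Li_le n k (mem_closedBall_zero_iff.1 hz)

-- Abel's argument: both sides are continuous along the radius through `z`.
theorem polylog_eq_Li_of_norm_le_one {n : ℕ} (hn : 1 ≤ n) {z : ℂ} (hz : ‖z‖ ≤ 1)
    (hcut : z ∈ cutPlane) : polylog n z = Li (n + 1) z := by
  have hray : Tendsto (fun t : ℝ => (t : ℂ) * z) (𝓝[<] 1) (𝓝 z) := by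
    have h : Continuous fun t : ℝ => (t : ℂ) * z := by fun_prop
    simpa using (h.tendsto 1).mono_left nhdsWithin_le_nhds
  have hlt : ∀ᶠ t : ℝ in 𝓝[<] 1, ‖(t : ℂ) * z‖ < 1 := by
    filter_upwards [Ioo_mem_nhdsLT (zero_lt_one' ℝ)] with t ht
    rw [norm_mul, norm_real, Real.norm_of_nonneg ht.1.le]
    exact (mul_le_of_le_one_right ht.1.le hz).trans_lt ht.2
  have hLi : Tendsto (fun t : ℝ => Li (n + 1) (t * z)) (𝓝[<] 1) (𝓝 (Li (n + 1) z)) :=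
    (continuousOn_Li (by lia) z (mem_closedBall_zero_iff.2 hz)).tendsto.comp
      (tendsto_nhdsWithin_iff.2 ⟨hray, hlt.mono fun _ ht => mem_closedBall_zero_iff.2 ht.le⟩)
  refine tendsto_nhds_unique (((continuousAt_polylog n hcut).tendsto.comp hray).congr' ?_) hLi
  exact hlt.mono fun _ ht => polylog_eq_Li n ht

/-! ### Kummer's functional equation -/

theorem eqOn_Icc_of_hasDerivAt_eq {E : Type*} [NormedAddCommGroup E] [NormedSpace ℝ E]
    [CompleteSpace E] {a b : ℝ} {f g f' : ℝ → E} (hf : ContinuousOn f (Icc a b))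
    (hg : ContinuousOn g (Icc a b)) (hf' : ∀ t ∈ Ioo a b, HasDerivAt f (f' t) t)
    (hg' : ∀ t ∈ Ioo a b, HasDerivAt g (f' t) t) (ha : f a = g a) : EqOn f g (Icc a b) := by
  intro t ht
  have hsub : Icc a t ⊆ Icc a b := Icc_subset_Icc_right ht.2
  have h := intervalIntegral.integral_eq_sub_of_hasDeriv_right_of_le (f' := fun _ => (0 : E))
    ht.1 ((hf.sub hg).mono hsub) (fun s hs => by
      have hs' : s ∈ Ioo a b := ⟨hs.1, hs.2.trans_le ht.2⟩
      simpa using ((hf' s hs').sub (hg' s hs')).hasDerivWithinAt (s := Ioi s))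
    intervalIntegrable_const
  simp only [intervalIntegral.integral_zero, Pi.sub_apply, ha, sub_self, sub_zero] at h
  exact sub_eq_zero.1 h.symm

theorem isLocallyInjective_exp : IsLocallyInjective exp := by
  rw [isLocallyInjective_iff_nhds]
  intro z
  have h := (hasStrictDerivAt_exp z).hasStrictFDerivAt_equiv (exp_ne_zero z)
  let e := h.toOpenPartialHomeomorph exp
  exact ⟨e.source, e.open_source.mem_nhds h.mem_toOpenPartialHomeomorph_source, e.injOn⟩

theorem eqOn_of_exp_eq {X : Type*} [TopologicalSpace X] {s : Set X} (hs : IsPreconnected s)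
    {f g : X → ℂ} (hf : ContinuousOn f s) (hg : ContinuousOn g s)
    (hexp : ∀ x ∈ s, exp (f x) = exp (g x)) {a : X} (ha : a ∈ s) (hfg : f a = g a) :
    EqOn f g s :=
  (T2Space.isSeparatedMap exp).eqOn_of_comp_eqOn isLocallyInjective_exp hs hf hg hexp ha hfg

/-- The induction behind Kummer's equation: all moments of order `M - m` of the polylogarithms of
order `m + 1` are monomials in `u` and `v`, since the logarithmic derivatives of the arguments turn
a moment for `m + 1` into moments for `m`. -/
theorem sum_moment_mul_polylog_eqOn {ι : Type*} [Fintype ι] {f : ι → ℝ → ℂ} {w n ξ η : ι → ℂ}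
    {u v u' v' : ℝ → ℂ} {M p q : ℕ} {c : ℂ} (hpq : p + q = M + 1)
    (hfc : ∀ i, ContinuousOn (f i) (Icc 0 1)) (hf0 : ∀ i, f i 0 = 0)
    (hfm : ∀ i, ∀ t ∈ Icc (0 : ℝ) 1, f i t ∈ cutPlane)
    (hfn : ∀ i, ∀ t ∈ Ioo (0 : ℝ) 1, f i t ≠ 0)
    (hf' : ∀ i, ∀ t ∈ Ioo (0 : ℝ) 1,
      HasDerivAt (f i) (f i t * (n i / t + ξ i * u' t + η i * v' t)) t)
    (huc : ContinuousOn u (Icc 0 1)) (hu0 : u 0 = 0)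
    (hu' : ∀ t ∈ Ioo (0 : ℝ) 1, HasDerivAt u (u' t) t)
    (hvc : ContinuousOn v (Icc 0 1)) (hv0 : v 0 = 0)
    (hv' : ∀ t ∈ Ioo (0 : ℝ) 1, HasDerivAt v (v' t) t)
    (hbase : ∀ α β γ, α + β + γ = M → EqOn
      (fun t => ∑ i, w i * n i ^ α * ξ i ^ β * η i ^ γ * polylog 0 (f i t))
      (fun t => 0 ^ α * c * p.descFactorial β * q.descFactorial γ * u t ^ (p - β) * v t ^ (q - γ))
      (Icc 0 1))
    (m α β γ : ℕ) (h : α + β + γ + m = M) : EqOn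
      (fun t => ∑ i, w i * n i ^ α * ξ i ^ β * η i ^ γ * polylog m (f i t))
      (fun t => 0 ^ α * c * p.descFactorial β * q.descFactorial γ * u t ^ (p - β) * v t ^ (q - γ))
      (Icc 0 1) := by
  induction m generalizing α β γ with
  | zero => exact hbase α β γ h
  | succ m ih =>
    refine eqOn_Icc_of_hasDerivAt_eq (f' := fun t => ∑ i, w i * n i ^ α * ξ i ^ β * η i ^ γ *
        (polylog m (f i t) / f i t * (f i t * (n i / t + ξ i * u' t + η i * v' t))))
      (continuousOn_finsetSum _ fun i _ => continuousOn_const.mul <|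
        (differentiableOn_polylog (m + 1)).continuousOn.comp (hfc i) (hfm i))
      (by fun_prop) (fun t ht => ?_) (fun t ht => ?_) ?_
    · exact HasDerivAt.fun_sum fun i _ => ((hasDerivAt_polylog_succ m
        (hfm i t (Ioo_subset_Icc_self ht)) (hfn i t ht)).comp t (hf' i t ht)).const_mul _
    · have hmoment := fun α β γ h => ih α β γ h (Ioo_subset_Icc_self ht)
      have hn := hmoment (α + 1) β γ (by lia)
      have hξ := hmoment α (β + 1) γ (by lia)
      have hη := hmoment α β (γ + 1) (by lia)
      simp only [pow_succ, mul_zero, zero_mul, Nat.descFactorial_succ, Nat.cast_mul,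
        ← Nat.sub_sub] at hn hξ hη
      refine ((((hu' t ht).fun_pow (p - β)).const_mul _).mul ((hv' t ht).fun_pow (q - γ))
        ).congr_deriv ?_
      calc _ = (∑ i, w i * (n i ^ α * n i) * ξ i ^ β * η i ^ γ * polylog m (f i t)) * (t : ℂ)⁻¹
            + (∑ i, w i * n i ^ α * (ξ i ^ β * ξ i) * η i ^ γ * polylog m (f i t)) * u' t
            + (∑ i, w i * n i ^ α * ξ i ^ β * (η i ^ γ * η i) * polylog m (f i t)) * v' t := by
              rw [hn, hξ, hη]
              ring
        _ = _ := by
          simp only [Finset.sum_mul, ← Finset.sum_add_distrib]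
          refine Finset.sum_congr rfl fun i _ => ?_
          have := hfn i t ht
          field_simp
    · simp only [hf0, polylog_apply_zero, hu0, hv0, mul_zero, Finset.sum_const_zero]
      rcases lt_or_ge β p with hβ | hβ
      · simp [Nat.sub_ne_zero_of_lt hβ]
      · simp [Nat.sub_ne_zero_of_lt (show γ < q by lia)]

/-- The arguments in Kummer's functional equation. -/
noncomputable def kummerArg (x y : ℂ) : Fin 20 → ℂ :=
  ![-(x ^ 2 * y * (1 - y) / (1 - x)), -(y ^ 2 * x * (1 - x) / (1 - y)),
    x ^ 2 * y / ((1 - y) ^ 2 * (1 - x)), y ^ 2 * x / ((1 - x) ^ 2 * (1 - y)),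
    x * y, x * y / ((1 - x) * (1 - y)), -(x * y / (1 - y)), -(x * y / (1 - x)),
    x * (1 - y), y * (1 - x), x / (1 - y), y / (1 - x),
    -(x * (1 - y) / (1 - x)), -(y * (1 - x) / (1 - y)),
    -(x / ((1 - x) * (1 - y))), -(y / ((1 - x) * (1 - y))),
    x, y, -(x / (1 - x)), -(y / (1 - y))]

/-- The coefficients in Kummer's functional equation. -/
def kummerCoeff : Fin 20 → ℤ :=
  ![1, 1, 1, 1, -6, -6, -6, -6, -3, -3, -3, -3, -3, -3, -3, -3, 6, 6, 6, 6]

/-- The total degrees in `x` and `y` of the arguments, apart from their factors `1 - x`, `1 - y`. -/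
def kummerDeg : Fin 20 → ℕ :=
  ![3, 3, 3, 3, 2, 2, 2, 2, 1, 1, 1, 1, 1, 1, 1, 1, 1, 1, 1, 1]

/-- The exponents of `1 - x` in the arguments. -/
def kummerXi : Fin 20 → ℤ :=
  ![-1, 1, -1, -2, 0, -1, 0, -1, 0, 1, 0, -1, -1, 1, -1, -1, 0, 0, -1, 0]

/-- The exponents of `1 - y` in the arguments. -/
def kummerEta : Fin 20 → ℤ :=
  ![1, -1, -2, -1, 0, -1, -1, 0, 1, 0, -1, 0, 1, -1, -1, -1, 0, 0, 0, -1]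

/-- The signed monomials in `x` and `y` occurring as factors of the arguments. -/
def kummerLead (x y : ℂ) : Fin 20 → ℂ :=
  ![-(x ^ 2 * y), -(y ^ 2 * x), x ^ 2 * y, y ^ 2 * x, x * y, x * y, -(x * y), -(x * y),
    x, y, x, y, -x, -y, -x, -y, x, y, -x, -y]

/-- The exponents of `1 - x y`, `1 - x - y`, `1 - x + x y`, `1 - y + x y`, `1 - x`, `1 - y` in the
factorizations of `1 - z`, where `z` runs through the arguments. -/
def kummerFactor : Fin 20 → Fin 6 → ℤ :=
  ![![1, 0, 1, 0, -1, 0], ![1, 0, 0, 1, 0, -1], ![0, 1, 0, 1, -1, -2], ![0, 1, 1, 0, -2, -1],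
    ![1, 0, 0, 0, 0, 0], ![0, 1, 0, 0, -1, -1], ![0, 0, 0, 1, 0, -1], ![0, 0, 1, 0, -1, 0],
    ![0, 0, 1, 0, 0, 0], ![0, 0, 0, 1, 0, 0], ![0, 1, 0, 0, 0, -1], ![0, 1, 0, 0, -1, 0],
    ![1, 0, 0, 0, -1, 0], ![1, 0, 0, 0, 0, -1], ![0, 0, 0, 1, -1, -1], ![0, 0, 1, 0, -1, -1],
    ![0, 0, 0, 0, 1, 0], ![0, 0, 0, 0, 0, 1], ![0, 0, 0, 0, -1, 0], ![0, 0, 0, 0, 0, -1]]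

/-- The ray from the origin to `(x, y)` is admissible if on it none of the arguments of Kummer's
functional equation meets the cut `[1, ∞)`. -/
def KummerAdmissible (x y : ℂ) : Prop :=
  ∀ t ∈ Icc (0 : ℝ) 1, ∀ i, kummerArg (t * x) (t * y) i ∈ cutPlane

theorem kummerArg_zero_zero (i : Fin 20) : kummerArg 0 0 i = 0 := by
  fin_cases i <;> simp [kummerArg]

theorem kummerLead_ne_zero {x y : ℂ} (hx : x ≠ 0) (hy : y ≠ 0) (i : Fin 20) :
    kummerLead x y i ≠ 0 := by
  fin_cases i <;> simp [kummerLead, hx, hy]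

theorem kummerArg_ofReal_mul (x y : ℂ) (t : ℝ) (i : Fin 20) :
    kummerArg (t * x) (t * y) i = kummerLead x y i * (t : ℂ) ^ kummerDeg i *
      (1 - t * x) ^ kummerXi i * (1 - t * y) ^ kummerEta i := by
  fin_cases i <;> simp [kummerArg, kummerLead, kummerDeg, kummerXi, kummerEta, zpow_neg,
    div_eq_mul_inv, -mul_eq_mul_right_iff, -mul_eq_mul_left_iff] <;> ring

theorem one_sub_kummerArg {x y : ℂ} (hx : 1 - x ≠ 0) (hy : 1 - y ≠ 0) (i : Fin 20) :
    1 - kummerArg x y i = ∏ j, ![1 - x * y, 1 - x - y, 1 - x + x * y, 1 - y + x * y, 1 - x,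
      1 - y] j ^ kummerFactor i j := by
  fin_cases i <;> simp [Fin.prod_univ_six, kummerArg, kummerFactor, zpow_neg] <;> field_simp <;>
    ring

theorem sum_kummerCoeff_mul_kummerFactor {α β γ : ℕ} (h : α + β + γ = 3) (j : Fin 6) :
    ∑ i, kummerCoeff i * kummerDeg i ^ α * kummerXi i ^ β * kummerEta i ^ γ * kummerFactor i j =
      if α = 0 ∧ (β = 1 ∧ j = 4 ∨ γ = 1 ∧ j = 5) then -6 else 0 := by
  have hfin : ∀ α ≤ 3, ∀ β ≤ 3, ∀ γ ≤ 3, α + β + γ = 3 → ∀ j,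
      ∑ i, kummerCoeff i * kummerDeg i ^ α * kummerXi i ^ β * kummerEta i ^ γ *
        kummerFactor i j = if α = 0 ∧ (β = 1 ∧ j = 4 ∨ γ = 1 ∧ j = 5) then -6 else 0 := by
    decide +kernel
  exact hfin α (by lia) β (by lia) γ (by lia) h j

theorem hasDerivAt_mul_pow_mul_zpow_mul_zpow {a x y : ℂ} {t : ℝ} (n : ℕ) (ξ η : ℤ) (ht : t ≠ 0)
    (hx : 1 - t * x ≠ 0) (hy : 1 - t * y ≠ 0) :
    HasDerivAt (fun s : ℝ => a * (s : ℂ) ^ n * (1 - s * x) ^ ξ * (1 - s * y) ^ η)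
      (a * (t : ℂ) ^ n * (1 - t * x) ^ ξ * (1 - t * y) ^ η *
        (n / t + ξ * (-x / (1 - t * x)) + η * (-y / (1 - t * y)))) t := by
  have ht0 : (t : ℂ) ≠ 0 := mod_cast ht
  have hlin (z : ℂ) : HasDerivAt (fun s : ℝ => 1 - (s : ℂ) * z) (-z) t := by
    simpa using (((hasDerivAt_id t).ofReal_comp).mul_const z).const_sub 1
  have hpow : HasDerivAt (fun s : ℝ => (s : ℂ) ^ n) ((t : ℂ) ^ n * (n / t)) t := by
    have h := (hasDerivAt_zpow n (t : ℂ) (Or.inl ht0)).comp_ofReal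
    simp only [zpow_natCast, zpow_sub_one₀ ht0, Int.cast_natCast] at h
    exact h.congr_deriv (by ring)
  refine (((hpow.const_mul a).mul ((hasDerivAt_zpow ξ _ (Or.inl hx)).comp t (hlin x))).mul
    ((hasDerivAt_zpow η _ (Or.inl hy)).comp t (hlin y))).congr_deriv ?_
  simp only [Function.comp_apply, Pi.mul_apply, zpow_sub_one₀ hx, zpow_sub_one₀ hy]
  ring

section KummerRay

variable {x y : ℂ}

theorem KummerAdmissible.one_sub_left_mem_slitPlane (h : KummerAdmissible x y) {t : ℝ}
    (ht : t ∈ Icc (0 : ℝ) 1) : 1 - t * x ∈ slitPlane := h t ht 16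

theorem KummerAdmissible.one_sub_right_mem_slitPlane (h : KummerAdmissible x y) {t : ℝ}
    (ht : t ∈ Icc (0 : ℝ) 1) : 1 - t * y ∈ slitPlane := h t ht 17

theorem KummerAdmissible.continuousOn_kummerArg (h : KummerAdmissible x y) (i : Fin 20) :
    ContinuousOn (fun t : ℝ => kummerArg (t * x) (t * y) i) (Icc 0 1) := by
  simp only [kummerArg_ofReal_mul]
  refine ((by fun_prop : ContinuousOn _ _).mul ?_).mul ?_
  · exact ContinuousOn.zpow₀ (by fun_prop) _ fun t ht =>
      Or.inl (slitPlane_ne_zero (h.one_sub_left_mem_slitPlane ht))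
  · exact ContinuousOn.zpow₀ (by fun_prop) _ fun t ht =>
      Or.inl (slitPlane_ne_zero (h.one_sub_right_mem_slitPlane ht))

/-- Continuous logarithms along the ray of `1 - x y`, `1 - x - y`, `1 - x + x y`, `1 - y + x y`,
`1 - x`, `1 - y`. The second one is not a principal value: `1 - x - y` may cross the negative
axis. -/
noncomputable def kummerLog (x y : ℂ) (j : Fin 6) (t : ℝ) : ℂ :=
  ![log (1 - kummerArg (t * x) (t * y) 4),
    log (1 - kummerArg (t * x) (t * y) 10) + log (1 - t * y),
    log (1 - kummerArg (t * x) (t * y) 8), log (1 - kummerArg (t * x) (t * y) 9),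
    log (1 - t * x), log (1 - t * y)] j

theorem kummerLog_zero (x y : ℂ) (j : Fin 6) : kummerLog x y j 0 = 0 := by
  fin_cases j <;> simp [kummerLog, kummerArg_zero_zero]

theorem KummerAdmissible.continuousOn_kummerLog (h : KummerAdmissible x y) (j : Fin 6) :
    ContinuousOn (kummerLog x y j) (Icc 0 1) := by
  have harg (i) : ContinuousOn (fun t : ℝ => log (1 - kummerArg (t * x) (t * y) i)) (Icc 0 1) :=
    (continuousOn_const.sub (h.continuousOn_kummerArg i)).clog fun t ht => h t ht i
  fin_cases j
  exacts [harg 4, (harg 10).add (harg 17), harg 8, harg 9, harg 16, harg 17]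

theorem KummerAdmissible.exp_kummerLog (h : KummerAdmissible x y) {t : ℝ}
    (ht : t ∈ Icc (0 : ℝ) 1) (j : Fin 6) :
    exp (kummerLog x y j t) = ![1 - t * x * (t * y), 1 - t * x - t * y, 1 - t * x + t * x * (t * y),
      1 - t * y + t * x * (t * y), 1 - t * x, 1 - t * y] j := by
  have harg (i) : exp (log (1 - kummerArg (t * x) (t * y) i)) = 1 - kummerArg (t * x) (t * y) i :=
    exp_log (slitPlane_ne_zero (h t ht i))
  have hx : exp (log (1 - t * x)) = 1 - t * x := harg 16
  have hy : exp (log (1 - t * y)) = 1 - t * y := harg 17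
  have hy0 : 1 - t * y ≠ 0 := slitPlane_ne_zero (h.one_sub_right_mem_slitPlane ht)
  fin_cases j <;> simp [kummerLog, exp_add, harg, hx, hy] <;>
    simp [kummerArg] <;> field_simp <;> ring

theorem KummerAdmissible.log_one_sub_kummerArg (h : KummerAdmissible x y) (i : Fin 20) {t : ℝ}
    (ht : t ∈ Icc (0 : ℝ) 1) : log (1 - kummerArg (t * x) (t * y) i) =
      ∑ j, kummerFactor i j * kummerLog x y j t := by
  refine eqOn_of_exp_eq (f := fun t : ℝ => log (1 - kummerArg (t * x) (t * y) i))
    (g := fun t => ∑ j, kummerFactor i j * kummerLog x y j t) isPreconnected_Icc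
    ((continuousOn_const.sub (h.continuousOn_kummerArg i)).clog fun t ht => h t ht i)
    (continuousOn_finsetSum _ fun j _ => continuousOn_const.mul (h.continuousOn_kummerLog j))
    (fun t ht => ?_) (left_mem_Icc.2 zero_le_one)
    (by simp [kummerArg_zero_zero, kummerLog_zero]) ht
  simp only [exp_log (slitPlane_ne_zero (h t ht i)), exp_sum, exp_int_mul, h.exp_kummerLog ht]
  exact one_sub_kummerArg (slitPlane_ne_zero (h.one_sub_left_mem_slitPlane ht))
    (slitPlane_ne_zero (h.one_sub_right_mem_slitPlane ht)) i

theorem KummerAdmissible.sum_moment_mul_polylog_zero (h : KummerAdmissible x y) {α β γ : ℕ}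
    (hsum : α + β + γ = 3) {t : ℝ} (ht : t ∈ Icc (0 : ℝ) 1) :
    ∑ i, (kummerCoeff i : ℂ) * kummerDeg i ^ α * kummerXi i ^ β * kummerEta i ^ γ *
      polylog 0 (kummerArg (t * x) (t * y) i) =
    0 ^ α * (3 / 2) * Nat.descFactorial 2 β * Nat.descFactorial 2 γ *
      log (1 - t * x) ^ (2 - β) * log (1 - t * y) ^ (2 - γ) := by
  have hmoment (j : Fin 6) : ∑ i, (kummerCoeff i : ℂ) * kummerDeg i ^ α * kummerXi i ^ β *
      kummerEta i ^ γ * kummerFactor i j =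
      if α = 0 ∧ (β = 1 ∧ j = 4 ∨ γ = 1 ∧ j = 5) then -6 else 0 :=
    mod_cast congrArg (Int.cast (R := ℂ)) (sum_kummerCoeff_mul_kummerFactor hsum j)
  calc _ = -∑ j, (∑ i, (kummerCoeff i : ℂ) * kummerDeg i ^ α * kummerXi i ^ β *
        kummerEta i ^ γ * kummerFactor i j) * kummerLog x y j t := by
        simp only [polylog, h.log_one_sub_kummerArg _ ht, Finset.sum_mul]
        rw [Finset.sum_comm, ← Finset.sum_neg_distrib]
        simp only [Finset.mul_sum, mul_neg, mul_assoc]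
    _ = _ := by
      simp only [hmoment]
      obtain ⟨rfl, hβ⟩ | hα : α = 0 ∧ γ = 3 - β ∨ α ≠ 0 := by lia
      · have : β ≤ 3 := by lia
        subst hβ
        interval_cases β <;>
          simp [kummerLog, Nat.descFactorial_succ, -mul_eq_mul_left_iff, -mul_eq_mul_right_iff] <;>
          ring
      · simp [hα]

theorem kummer_tetralog (h : KummerAdmissible x y) (hx : x ≠ 0) (hy : y ≠ 0) :
    ∑ i, (kummerCoeff i : ℂ) * polylog 3 (kummerArg x y i) =
      3 / 2 * log (1 - x) ^ 2 * log (1 - y) ^ 2 := by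
  have hxs {t : ℝ} (ht : t ∈ Icc (0 : ℝ) 1) := h.one_sub_left_mem_slitPlane ht
  have hys {t : ℝ} (ht : t ∈ Icc (0 : ℝ) 1) := h.one_sub_right_mem_slitPlane ht
  have hlog {z : ℂ} {t : ℝ} (ht : 1 - t * z ∈ slitPlane) :
      HasDerivAt (fun s : ℝ => log (1 - s * z)) (-z / (1 - t * z)) t := by
    refine HasDerivAt.clog_real ?_ ht
    simpa using (((hasDerivAt_id t).ofReal_comp).mul_const z).const_sub 1
  have hpos {t : ℝ} (ht : t ∈ Ioo (0 : ℝ) 1) : (t : ℂ) ≠ 0 := mod_cast ht.1.ne'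
  have hmoments := sum_moment_mul_polylog_eqOn (M := 3) (p := 2) (q := 2) (c := 3 / 2)
    (f := fun i t => kummerArg (t * x) (t * y) i) (w := fun i => kummerCoeff i)
    (n := fun i => kummerDeg i) (ξ := fun i => kummerXi i) (η := fun i => kummerEta i)
    (u := fun t => log (1 - t * x)) (v := fun t => log (1 - t * y)) rfl
    h.continuousOn_kummerArg (fun i => by simp [kummerArg_zero_zero]) (fun i t ht => h t ht i)
    (fun i t ht => ?_) (fun i t ht => ?_)
    (ContinuousOn.clog (by fun_prop) fun t ht => hxs ht) (by simp)
    (fun t ht => hlog (hxs (Ioo_subset_Icc_self ht)))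
    (ContinuousOn.clog (by fun_prop) fun t ht => hys ht) (by simp)
    (fun t ht => hlog (hys (Ioo_subset_Icc_self ht)))
    (fun α β γ hsum t ht => h.sum_moment_mul_polylog_zero hsum ht) 3 0 0 0 rfl
  · simpa using hmoments (right_mem_Icc.2 zero_le_one)
  all_goals
    have hx0 := slitPlane_ne_zero (hxs (Ioo_subset_Icc_self ht))
    have hy0 := slitPlane_ne_zero (hys (Ioo_subset_Icc_self ht))
    simp only [kummerArg_ofReal_mul]
  · exact mul_ne_zero (mul_ne_zero (mul_ne_zero (kummerLead_ne_zero hx hy i)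
      (pow_ne_zero _ (hpos ht))) (zpow_ne_zero _ hx0)) (zpow_ne_zero _ hy0)
  · exact hasDerivAt_mul_pow_mul_zpow_mul_zpow _ _ _ ht.1.ne' hx0 hy0

end KummerRay

/-! ### Special values and inversion -/

theorem zeta_two : zeta 2 = Real.pi ^ 2 / 6 := by
  have h := hasSum_zeta_two
  rw [← hasSum_nat_add_iff' 1] at h
  simpa [zeta] using h.tsum_eq

theorem zeta_four : zeta 4 = Real.pi ^ 4 / 90 := by
  have h := hasSum_zeta_four
  rw [← hasSum_nat_add_iff' 1] at h
  simpa [zeta] using h.tsum_eq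

theorem beta_three : beta 3 = Real.pi ^ 3 / 32 := by
  have hinj : Function.Injective fun k : ℕ => 2 * k + 1 := fun _ _ => by simp
  have heven : ∀ n ∉ range fun k : ℕ => 2 * k + 1,
      1 / (n : ℝ) ^ 3 * Real.sin (Real.pi * n / 2) = 0 := by
    intro n hn
    obtain ⟨k, rfl⟩ : Even n := by
      rw [← Nat.not_odd_iff_even]
      exact fun ⟨k, hk⟩ => hn ⟨k, hk.symm⟩
    rw [show Real.pi * (k + k : ℕ) / 2 = k * Real.pi by push_cast; ring, Real.sin_nat_mul_pi,
      mul_zero]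
  rw [beta, ← ((hinj.hasSum_iff heven).2 hasSum_L_function_mod_four_eval_three).tsum_eq]
  refine tsum_congr fun k => ?_
  have hangle : Real.pi * (2 * k + 1 : ℕ) / 2 = Real.pi / 2 + k * Real.pi := by push_cast; ring
  rw [Function.comp_apply, hangle, Real.sin_add_nat_mul_pi, Real.sin_pi_div_two]
  ring

theorem Li_one (n : ℕ) : Li n 1 = zeta n := by
  simp [Li, zeta, ofReal_tsum]

theorem Li_conj (n : ℕ) (z : ℂ) : Li n (conj z) = conj (Li n z) := by
  simp only [Li, conj_tsum]
  exact tsum_congr fun k => by simp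

theorem Li_eq_tsum_odd_add_Li_sq {n : ℕ} (hn : 2 ≤ n) {z : ℂ} (hz : ‖z‖ ≤ 1) :
    Li n z = ∑' k : ℕ, z ^ (2 * k + 1) / ((2 * k + 1 : ℕ) : ℂ) ^ n + Li n (z ^ 2) / 2 ^ n := by
  let g : ℕ → ℂ := fun k => z ^ (k + 1) / ((k + 1 : ℕ) : ℂ) ^ n
  have hg : Summable g := summable_Li_of_norm_le_one hn hz
  have hsplit : Li n z = ∑' k, g (2 * k) + ∑' k, g (2 * k + 1) := (tsum_even_add_odd
    (hg.comp_injective (mul_right_injective₀ two_ne_zero))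
    (hg.comp_injective ((add_left_injective 1).comp (mul_right_injective₀ two_ne_zero)))).symm
  rw [hsplit, Li, ← tsum_div_const]
  congr 1
  refine tsum_congr fun k => ?_
  rw [show g (2 * k + 1) = z ^ (2 * (k + 1)) / ((2 * (k + 1) : ℕ) : ℂ) ^ n from rfl, pow_mul,
    Nat.cast_mul, mul_pow, div_div, mul_comm (_ ^ n), Nat.cast_ofNat]

theorem Li_add_Li_neg {n : ℕ} (hn : 2 ≤ n) {z : ℂ} (hz : ‖z‖ ≤ 1) :
    Li n z + Li n (-z) = 2 * (Li n (z ^ 2) / 2 ^ n) := by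
  have hodd : ∑' k : ℕ, (-z) ^ (2 * k + 1) / ((2 * k + 1 : ℕ) : ℂ) ^ n =
      -∑' k : ℕ, z ^ (2 * k + 1) / ((2 * k + 1 : ℕ) : ℂ) ^ n := by
    rw [← tsum_neg]
    refine tsum_congr fun k => ?_
    rw [Odd.neg_pow ⟨k, rfl⟩, neg_div]
  rw [Li_eq_tsum_odd_add_Li_sq hn hz,
    Li_eq_tsum_odd_add_Li_sq hn (z := -z) (by rwa [norm_neg]), neg_sq, hodd]
  ring

theorem Li_neg_one {n : ℕ} (hn : 2 ≤ n) : Li n (-1) = (2 / 2 ^ n - 1) * zeta n := by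
  have h := Li_add_Li_neg hn (z := 1) (by simp)
  rw [one_pow, Li_one] at h
  linear_combination h

theorem Li_I {n : ℕ} (hn : 2 ≤ n) :
    Li n I = (2 / 2 ^ n - 1) * zeta n / 2 ^ n + beta n * I := by
  have hodd : ∑' k : ℕ, I ^ (2 * k + 1) / ((2 * k + 1 : ℕ) : ℂ) ^ n = beta n * I := by
    rw [beta, ofReal_tsum, ← tsum_mul_right]
    refine tsum_congr fun k => ?_
    rw [pow_succ, pow_mul, I_sq]
    push_cast
    ring
  rw [Li_eq_tsum_odd_add_Li_sq hn (by simp), I_sq, Li_neg_one hn, hodd]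
  ring

theorem Li_two_neg_one : Li 2 (-1) = -(Real.pi : ℂ) ^ 2 / 12 := by
  rw [Li_neg_one le_rfl, zeta_two]
  push_cast
  ring

theorem Li_four_neg_one : Li 4 (-1) = -7 * (Real.pi : ℂ) ^ 4 / 720 := by
  rw [Li_neg_one (by norm_num), zeta_four]
  push_cast
  ring

theorem Li_four_I : Li 4 I = -7 * (Real.pi : ℂ) ^ 4 / 11520 + beta 4 * I := by
  rw [Li_I (by norm_num), zeta_four]
  push_cast
  ring

theorem Li_four_neg_I : Li 4 (-I) = -7 * (Real.pi : ℂ) ^ 4 / 11520 - beta 4 * I := by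
  rw [← conj_I, Li_conj, Li_four_I]
  simp only [map_add, map_mul, map_div₀, map_neg, map_pow, map_ofNat, conj_ofReal, conj_I]
  ring

theorem isPreconnected_abs_im_lt (c : ℝ) : IsPreconnected {w : ℂ | |w.im| < c} := by
  simp only [abs_lt]
  exact ((convex_Ioo (-c) c).linear_preimage imLm).isPreconnected

theorem neg_exp_mem_cutPlane {w : ℂ} (hw : |w.im| < Real.pi) : -exp w ∈ cutPlane := by
  rw [mem_cutPlane_iff]
  by_contra! h
  obtain ⟨hre, him⟩ := h
  simp only [neg_re, neg_im, exp_re, exp_im, neg_eq_zero, mul_eq_zero, Real.exp_ne_zero,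
    false_or] at hre him
  have h0 := (Real.sin_eq_zero_iff_of_lt_of_lt (abs_lt.1 hw).1 (abs_lt.1 hw).2).1 him
  rw [h0, Real.cos_zero, mul_one] at hre
  linarith [Real.exp_pos w.re]

theorem hasDerivAt_polylog_succ_neg_exp (m : ℕ) {w : ℂ} (hw : |w.im| < Real.pi) :
    HasDerivAt (fun w => polylog (m + 1) (-exp w)) (polylog m (-exp w)) w := by
  refine ((hasDerivAt_polylog_succ m (neg_exp_mem_cutPlane hw)
    (neg_ne_zero.2 (exp_ne_zero w))).comp w (hasDerivAt_exp w).fun_neg).congr_deriv ?_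
  have := exp_ne_zero w
  field_simp

theorem polylog_zero_neg_exp_sub {w : ℂ} (hw : |w.im| < Real.pi) :
    polylog 0 (-exp w) - polylog 0 (-exp (-w)) = -w := by
  have hcont : ContinuousOn (fun w => log (1 - -exp w)) {w : ℂ | |w.im| < Real.pi} :=
    ContinuousOn.clog (by fun_prop) fun w hw => neg_exp_mem_cutPlane hw
  have hlog : log (1 - -exp w) = w + log (1 - -exp (-w)) := by
    refine eqOn_of_exp_eq (g := fun w => w + log (1 - -exp (-w)))
      (isPreconnected_abs_im_lt Real.pi) hcont
      (continuousOn_id.add (hcont.comp continuousOn_neg fun w hw => by simpa using hw))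
      (fun w hw => ?_) (a := 0) (by simp [Real.pi_pos]) (by simp) hw
    rw [exp_add, exp_log (slitPlane_ne_zero (neg_exp_mem_cutPlane hw)),
      exp_log (slitPlane_ne_zero (neg_exp_mem_cutPlane (by simpa using hw))), exp_neg]
    have := exp_ne_zero w
    field_simp
    ring
  simp only [polylog, hlog]
  ring

theorem polylog_succ_inversion_of_hasDerivAt {m : ℕ} {s : ℂ} {P Q : ℂ → ℂ}
    (hP : ∀ w : ℂ, |w.im| < Real.pi → polylog m (-exp w) + s * polylog m (-exp (-w)) = P w)
    (hQ : ∀ w, HasDerivAt Q (P w) w) (h0 : (1 - s) * polylog (m + 1) (-1) = Q 0)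
    {w : ℂ} (hw : |w.im| < Real.pi) :
    polylog (m + 1) (-exp w) - s * polylog (m + 1) (-exp (-w)) = Q w := by
  have hderiv {w : ℂ} (hw : |w.im| < Real.pi) :
      HasDerivAt (fun w => polylog (m + 1) (-exp w) - s * polylog (m + 1) (-exp (-w))) (P w) w := by
    have hneg := (hasDerivAt_polylog_succ_neg_exp m (w := -w) (by simpa using hw)).comp w
      (hasDerivAt_neg w)
    refine ((hasDerivAt_polylog_succ_neg_exp m hw).sub (hneg.const_mul s)).congr_deriv ?_
    rw [← hP w hw]
    ring
  have hopen : IsOpen {w : ℂ | |w.im| < Real.pi} :=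
    isOpen_lt (by fun_prop) continuous_const
  refine hopen.eqOn_of_deriv_eq (isPreconnected_abs_im_lt Real.pi)
    (fun w hw => (hderiv hw).differentiableAt.differentiableWithinAt)
    (fun w _ => (hQ w).differentiableAt.differentiableWithinAt)
    (fun w hw => (hderiv hw).deriv.trans (hQ w).deriv.symm) (x := 0) (by simp [Real.pi_pos]) ?_ hw
  rw [neg_zero, exp_zero, ← h0]
  ring

theorem polylog_one_inversion {w : ℂ} (hw : |w.im| < Real.pi) :
    polylog 1 (-exp w) + polylog 1 (-exp (-w)) = -w ^ 2 / 2 - (Real.pi : ℂ) ^ 2 / 6 := by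
  have hderiv (w : ℂ) : HasDerivAt (fun w : ℂ => -w ^ 2 / 2 - (Real.pi : ℂ) ^ 2 / 6) (-w) w :=
    (((hasDerivAt_pow 2 w).fun_neg.div_const 2).sub_const _).congr_deriv (by simp; ring)
  have h := polylog_succ_inversion_of_hasDerivAt (m := 0) (s := -1)
    (fun w hw => by linear_combination polylog_zero_neg_exp_sub hw) hderiv ?_ hw
  · linear_combination h
  · rw [polylog_eq_Li_of_norm_le_one le_rfl (by simp) (mem_cutPlane_iff.2 (by norm_num)),
      Li_two_neg_one]
    ring

theorem polylog_two_inversion {w : ℂ} (hw : |w.im| < Real.pi) :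
    polylog 2 (-exp w) - polylog 2 (-exp (-w)) = -w ^ 3 / 6 - (Real.pi : ℂ) ^ 2 / 6 * w := by
  have hderiv (w : ℂ) : HasDerivAt (fun w : ℂ => -w ^ 3 / 6 - (Real.pi : ℂ) ^ 2 / 6 * w)
      (-w ^ 2 / 2 - (Real.pi : ℂ) ^ 2 / 6) w :=
    (((hasDerivAt_pow 3 w).fun_neg.div_const 6).sub
      ((hasDerivAt_id w).const_mul _)).congr_deriv (by push_cast; ring)
  have h := polylog_succ_inversion_of_hasDerivAt (m := 1) (s := 1)
    (fun w hw => by linear_combination polylog_one_inversion hw) hderiv (by ring) hw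
  linear_combination h

theorem polylog_three_inversion {w : ℂ} (hw : |w.im| < Real.pi) :
    polylog 3 (-exp w) + polylog 3 (-exp (-w)) =
      -w ^ 4 / 24 - Real.pi ^ 2 / 12 * w ^ 2 - 7 * Real.pi ^ 4 / 360 := by
  have hderiv (w : ℂ) : HasDerivAt
      (fun w : ℂ => -w ^ 4 / 24 - Real.pi ^ 2 / 12 * w ^ 2 - 7 * Real.pi ^ 4 / 360)
      (-w ^ 3 / 6 - (Real.pi : ℂ) ^ 2 / 6 * w) w :=
    ((((hasDerivAt_pow 4 w).fun_neg.div_const 24).sub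
      ((hasDerivAt_pow 2 w).const_mul _)).sub_const _).congr_deriv (by push_cast; ring)
  have h := polylog_succ_inversion_of_hasDerivAt (m := 2) (s := -1)
    (fun w hw => by linear_combination polylog_two_inversion hw) hderiv ?_ hw
  · linear_combination h
  · rw [polylog_eq_Li_of_norm_le_one (by norm_num) (by simp) (mem_cutPlane_iff.2 (by norm_num)),
      Li_four_neg_one]
    ring

/-! ### The ladder relations -/

theorem div_mem_cutPlane {z w : ℂ}
    (h : (z * conj w).im = 0 → (z * conj w).re < normSq w) : z / w ∈ cutPlane := by
  rcases eq_or_ne w 0 with rfl | hw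
  · simpa using zero_mem_cutPlane
  have hw : 0 < normSq w := normSq_pos.2 hw
  have hz : z / w = ((normSq w)⁻¹ : ℝ) * (z * conj w) := by
    rw [div_eq_mul_inv, inv_def]; push_cast; ring
  rw [mem_cutPlane_iff, hz, re_ofReal_mul, im_ofReal_mul, inv_mul_lt_iff₀ hw, mul_one,
    or_iff_not_imp_right, not_not]
  exact fun him => h ((mul_eq_zero.1 him).resolve_left (inv_ne_zero hw.ne'))

theorem kummerArg_eq_div (x y : ℂ) (i : Fin 20) : kummerArg x y i =
    kummerLead x y i * (1 - x) ^ (kummerXi i).toNat * (1 - y) ^ (kummerEta i).toNat /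
      ((1 - x) ^ (-kummerXi i).toNat * (1 - y) ^ (-kummerEta i).toNat) := by
  fin_cases i <;> simp [kummerArg, kummerLead, kummerXi, kummerEta, neg_div, mul_comm]

theorem kummerAdmissible_of_pos {x y : ℂ}
    (h : ∀ t ∈ Ioc (0 : ℝ) 1, ∀ i, kummerArg (t * x) (t * y) i ∈ cutPlane) :
    KummerAdmissible x y := by
  intro t ht i
  rcases ht.1.eq_or_lt with rfl | h0
  · simpa [kummerArg_zero_zero] using zero_mem_cutPlane
  · exact h t ⟨h0, ht.2⟩ i

theorem kummerAdmissible_I_I : KummerAdmissible I I := by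
  refine kummerAdmissible_of_pos fun t ⟨h0, _⟩ i => ?_
  rw [kummerArg_eq_div]
  refine div_mem_cutPlane fun him => ?_
  fin_cases i <;>
    simp [kummerLead, kummerXi, kummerEta, normSq_apply, pow_succ, h0.ne'] at him ⊢ <;>
    linarith [pow_pos h0 2, pow_pos h0 3, pow_pos h0 4, pow_pos h0 6]

theorem kummerAdmissible_I_neg_one : KummerAdmissible I (-1) := by
  refine kummerAdmissible_of_pos fun t ⟨h0, _⟩ i => ?_
  rw [kummerArg_eq_div]
  refine div_mem_cutPlane fun him => ?_
  have ht : 1 + t ≠ 0 := by positivity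
  fin_cases i <;>
    simp [kummerLead, kummerXi, kummerEta, normSq_apply, pow_succ, h0.ne', ht] at him ⊢ <;>
    linarith [pow_pos h0 2, pow_pos h0 3, pow_pos h0 4, pow_pos h0 5, pow_pos h0 6]

theorem kummerAdmissible_neg_one_one_add_I : KummerAdmissible (-1) (1 + I) := by
  refine kummerAdmissible_of_pos fun t ⟨h0, h1⟩ i => ?_
  rw [kummerArg_eq_div]
  refine div_mem_cutPlane fun him => ?_
  have ht : 1 + t ≠ 0 := by positivity
  fin_cases i <;>
    simp [kummerLead, kummerXi, kummerEta, normSq_apply, pow_succ, h0.ne', ht] at him ⊢ <;>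
    linarith [pow_pos h0 2, pow_pos h0 3, pow_pos h0 4, pow_pos h0 5, pow_pos h0 6,
      sq_nonneg (1 - t), sq_nonneg (1 - t ^ 2), mul_nonneg (pow_pos h0 3).le (sub_nonneg.2 h1)]

theorem kummerArg_I_I : kummerArg I I = ![I, I, (1 + I) / 4, (1 + I) / 4, -1, -I / 2,
    (1 + I) / 2, (1 + I) / 2, 1 + I, 1 + I, -((1 - I) / 2), -((1 - I) / 2), -I, -I, 1 / 2, 1 / 2,
    I, I, (1 - I) / 2, (1 - I) / 2] := by
  funext i
  fin_cases i <;> apply Complex.ext <;>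
    simp [kummerArg, div_re, div_im, normSq_apply, pow_succ] <;> norm_num

theorem kummerArg_I_neg_one : kummerArg I (-1) = ![-(1 + I), -((1 + I) / 2), (1 + I) / 8,
    -1 / 4, -I, (1 - I) / 4, I / 2, -((1 - I) / 2), 2 * I, -(1 - I), I / 2, -((1 + I) / 2), 1 - I,
    (1 - I) / 2, (1 - I) / 4, (1 + I) / 4, I, -1, (1 - I) / 2, 1 / 2] := by
  funext i
  fin_cases i <;> apply Complex.ext <;>
    simp [kummerArg, div_re, div_im, normSq_apply, pow_succ] <;> norm_num

theorem kummerArg_neg_one_one_add_I : kummerArg (-1) (1 + I) = ![-((1 - I) / 2), -4,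
    -((1 + I) / 2), 1 / 2, -(1 + I), (1 - I) / 2, -(1 - I), (1 + I) / 2, I, 2 * (1 + I), -I,
    (1 + I) / 2, -I / 2, 2 * (1 - I), I / 2, (1 - I) / 2, -1, 1 + I, 1 / 2, 1 - I] := by
  funext i
  fin_cases i <;> apply Complex.ext <;>
    simp [kummerArg, div_re, div_im, normSq_apply, pow_succ] <;> norm_num

theorem tetralog_I_I : 14 * polylog 3 I + 2 * polylog 3 ((1 + I) / 4) - 6 * polylog 3 (-1)
    - 6 * polylog 3 (-I / 2) - 12 * polylog 3 ((1 + I) / 2) - 6 * polylog 3 (1 + I)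
    - 6 * polylog 3 (-((1 - I) / 2)) - 6 * polylog 3 (-I) - 6 * polylog 3 2⁻¹
    + 12 * polylog 3 ((1 - I) / 2) = 3 / 2 * log (1 - I) ^ 4 := by
  have h := kummer_tetralog kummerAdmissible_I_I I_ne_zero I_ne_zero
  rw [kummerArg_I_I] at h
  simp only [Fin.sum_univ_succ, kummerCoeff] at h
  simp at h
  linear_combination h

theorem tetralog_I_neg_one : polylog 3 (-(1 + I)) - 2 * polylog 3 (-((1 + I) / 2))
    + polylog 3 ((1 + I) / 8) + polylog 3 (-1 / 4) - 6 * polylog 3 (-I)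
    - 9 * polylog 3 ((1 - I) / 4) - 9 * polylog 3 (I / 2) - 6 * polylog 3 (-((1 - I) / 2))
    - 3 * polylog 3 (2 * I) - 3 * polylog 3 (-(1 - I)) - 3 * polylog 3 (1 - I)
    + 3 * polylog 3 ((1 - I) / 2) - 3 * polylog 3 ((1 + I) / 4) + 6 * polylog 3 I
    + 6 * polylog 3 (-1) + 6 * polylog 3 2⁻¹ = 3 / 2 * log (1 - I) ^ 2 * log 2 ^ 2 := by
  have h := kummer_tetralog kummerAdmissible_I_neg_one I_ne_zero (neg_ne_zero.2 one_ne_zero)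
  rw [kummerArg_I_neg_one, show (1 - -1 : ℂ) = 2 by norm_num] at h
  simp only [Fin.sum_univ_succ, kummerCoeff] at h
  simp [-neg_add_rev, -neg_sub] at h
  linear_combination h

theorem tetralog_neg_one_one_add_I : polylog 3 (-((1 - I) / 2)) + polylog 3 (-4)
    + polylog 3 (-((1 + I) / 2)) + 7 * polylog 3 2⁻¹ - 6 * polylog 3 (-(1 + I))
    - 9 * polylog 3 ((1 - I) / 2) - 6 * polylog 3 (-(1 - I)) - 9 * polylog 3 ((1 + I) / 2)
    - 3 * polylog 3 I - 3 * polylog 3 (2 * (1 + I)) - 3 * polylog 3 (-I)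
    - 3 * polylog 3 (-I / 2) - 3 * polylog 3 (2 * (1 - I)) - 3 * polylog 3 (I / 2)
    + 6 * polylog 3 (-1) + 6 * polylog 3 (1 + I) + 6 * polylog 3 (1 - I)
    = 3 / 2 * log 2 ^ 2 * log (-I) ^ 2 := by
  have h := kummer_tetralog kummerAdmissible_neg_one_one_add_I (neg_ne_zero.2 one_ne_zero)
    (by simp [Complex.ext_iff])
  rw [kummerArg_neg_one_one_add_I, show (1 - -1 : ℂ) = 2 by norm_num,
    show (1 - (1 + I) : ℂ) = -I by ring] at h
  simp only [Fin.sum_univ_succ, kummerCoeff] at h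
  simp [-neg_add_rev, -neg_sub] at h
  linear_combination h

theorem tendsto_polylog_ofReal {α : Type*} {l : Filter α} [l.NeBot] {g : α → ℝ} {a : ℝ} {n : ℕ}
    (hn : 1 ≤ n) (hg : Tendsto g l (𝓝 a)) (hlt : ∀ᶠ s in l, g s < 1) :
    Tendsto (fun s => polylog n (g s)) l (𝓝 (if a = 1 then zeta (n + 1) else polylog n a)) := by
  have hgc : Tendsto (fun s => (g s : ℂ)) l (𝓝 a) := (continuous_ofReal.tendsto a).comp hg
  split_ifs with ha
  · subst ha
    have hball : ∀ᶠ s in l, |g s| < 1 := by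
      filter_upwards [hlt, hg.eventually_const_lt (by norm_num : (-1 : ℝ) < 1)] with s h h'
      exact abs_lt.2 ⟨h', h⟩
    rw [← Li_one]
    refine (((continuousOn_Li (Nat.succ_le_succ hn)) 1 (by simp)).tendsto.comp
      (tendsto_nhdsWithin_iff.2 ⟨by simpa using hgc, ?_⟩)).congr' ?_
    · filter_upwards [hball] with s hs
      simpa using hs.le
    · filter_upwards [hball] with s hs
      exact (polylog_eq_Li n (by simpa using hs)).symm
  · have ha1 : a < 1 := lt_of_le_of_ne (le_of_tendsto hg (hlt.mono fun _ h => h.le)) ha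
    exact (continuousAt_polylog n
      (mem_cutPlane_iff.2 (Or.inl (by simpa using ha1)))).tendsto.comp hgc

/-- The arguments of Kummer's functional equation at `(-r, -r)`. -/
noncomputable def kummerDiag (r : ℝ) : Fin 20 → ℝ :=
  ![r ^ 3, r ^ 3, -(r / (1 + r)) ^ 3, -(r / (1 + r)) ^ 3, r ^ 2, (r / (1 + r)) ^ 2,
    -(r ^ 2 / (1 + r)), -(r ^ 2 / (1 + r)), -(r * (1 + r)), -(r * (1 + r)), -(r / (1 + r)),
    -(r / (1 + r)), r, r, r / (1 + r) ^ 2, r / (1 + r) ^ 2, -r, -r, r / (1 + r), r / (1 + r)]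

theorem kummerArg_neg_ofReal {r : ℝ} (hr : 0 ≤ r) (i : Fin 20) :
    kummerArg (-r) (-r) i = kummerDiag r i := by
  have h : (1 + r : ℂ) ≠ 0 := by
    have : (1 + r : ℝ) ≠ 0 := by positivity
    exact_mod_cast this
  fin_cases i <;> simp [kummerArg, kummerDiag] <;> field_simp

theorem kummerDiag_lt_one {r : ℝ} (hr : 0 ≤ r) (hr1 : r < 1) (i : Fin 20) :
    kummerDiag r i < 1 := by
  have hq0 : 0 ≤ r / (1 + r) := by positivity
  have hq1 : r / (1 + r) < 1 := by rw [div_lt_one (by positivity)]; linarith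
  have hs : r / (1 + r) ^ 2 < 1 := by rw [div_lt_one (by positivity)]; nlinarith
  have n1 : 0 ≤ r ^ 2 / (1 + r) := by positivity
  have n2 : 0 ≤ r * (1 + r) := by positivity
  have n3 : 0 ≤ (r / (1 + r)) ^ 3 := by positivity
  have p2 := pow_lt_one₀ hr hr1 two_ne_zero
  have p3 := pow_lt_one₀ hr hr1 three_ne_zero
  have q2 := pow_lt_one₀ hq0 hq1 two_ne_zero
  fin_cases i <;> simp only [kummerDiag, Fin.reduceFinMk, Matrix.cons_val] <;> linarith

theorem kummerDiag_one : kummerDiag 1 = ![1, 1, -8⁻¹, -8⁻¹, 1, 4⁻¹, -2⁻¹, -2⁻¹, -2, -2, -2⁻¹,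
    -2⁻¹, 1, 1, 4⁻¹, 4⁻¹, -1, -1, 2⁻¹, 2⁻¹] := by
  funext i
  fin_cases i <;> norm_num [kummerDiag]

theorem continuousAt_kummerDiag {r : ℝ} (hr : 1 + r ≠ 0) (i : Fin 20) :
    ContinuousAt (fun s => kummerDiag s i) r := by
  fin_cases i <;> simp only [kummerDiag, Fin.reduceFinMk, Matrix.cons_val] <;>
    fun_prop (disch := simp [hr])

theorem sum_kummerCoeff_mul_polylog_kummerDiag {s : ℝ} (hs : s ∈ Ioo (0 : ℝ) 1) :
    ∑ i, (kummerCoeff i : ℂ) * polylog 3 (kummerDiag s i) = 3 / 2 * Real.log (1 + s) ^ 4 := by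
  have hs0 : (-s : ℂ) ≠ 0 := neg_ne_zero.2 (by exact_mod_cast hs.1.ne')
  have hadm : KummerAdmissible (-s) (-s) := fun t ht i => by
    have h0 : 0 ≤ t * s := mul_nonneg ht.1 hs.1.le
    have h1 : t * s < 1 := (mul_le_of_le_one_left hs.1.le ht.2).trans_lt hs.2
    rw [show (t : ℂ) * -s = -((t * s : ℝ) : ℂ) by push_cast; ring, kummerArg_neg_ofReal h0,
      mem_cutPlane_iff, ofReal_re]
    exact Or.inl (kummerDiag_lt_one h0 h1 i)
  have h := kummer_tetralog hadm hs0 hs0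
  simp only [kummerArg_neg_ofReal hs.1.le] at h
  rw [h, ofReal_log (by linarith [hs.1]), ofReal_add, ofReal_one, sub_neg_eq_add]
  ring

theorem tetralog_neg_one_neg_one : -10 * (zeta 4 : ℂ) + 2 * polylog 3 (-8⁻¹)
    - 12 * polylog 3 4⁻¹ - 18 * polylog 3 (-2⁻¹) - 6 * polylog 3 (-2) + 12 * polylog 3 (-1)
    + 12 * polylog 3 2⁻¹ = 3 / 2 * (Real.log 2 : ℂ) ^ 4 := by
  -- `(-1, -1)` is not admissible, some arguments being `1`, but it is a limit of such points.
  have hmem : ∀ᶠ s : ℝ in 𝓝[<] 1, s ∈ Ioo (0 : ℝ) 1 := Ioo_mem_nhdsLT zero_lt_one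
  have hterm (i : Fin 20) : Tendsto (fun s : ℝ => polylog 3 (kummerDiag s i)) (𝓝[<] 1)
      (𝓝 (if kummerDiag 1 i = 1 then zeta 4 else polylog 3 (kummerDiag 1 i))) :=
    tendsto_polylog_ofReal (by norm_num)
      ((continuousAt_kummerDiag (by norm_num) i).mono_left nhdsWithin_le_nhds)
      (hmem.mono fun s hs => kummerDiag_lt_one hs.1.le hs.2 i)
  have hlog : ContinuousAt (fun s : ℝ => 3 / 2 * (Real.log (1 + s) : ℂ) ^ 4) 1 := by
    have : ContinuousAt (fun s : ℝ => Real.log (1 + s)) 1 :=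
      ContinuousAt.log (by fun_prop) (by norm_num)
    fun_prop
  have h := tendsto_nhds_unique
    ((tendsto_finsetSum _ fun i _ => (hterm i).const_mul (kummerCoeff i : ℂ)).congr'
      (hmem.mono fun s hs => sum_kummerCoeff_mul_polylog_kummerDiag hs))
    (hlog.mono_left nhdsWithin_le_nhds)
  beta_reduce at h
  rw [one_add_one_eq_two] at h
  simp only [kummerDiag_one, Fin.sum_univ_succ, kummerCoeff] at h
  generalize (Real.log 2 : ℂ) = l at h ⊢
  simp [show (-8⁻¹ : ℝ) ≠ 1 by norm_num, show (-2⁻¹ : ℝ) ≠ 1 by norm_num,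
    show (-2 : ℝ) ≠ 1 by norm_num, show (-1 : ℝ) ≠ 1 by norm_num] at h
  linear_combination h

end Analysis

section Relations

open scoped ComplexConjugate
open Complex

theorem add_mul_I_pow_two (p q : ℂ) : (p + q * I) ^ 2 = p ^ 2 - q ^ 2 + 2 * p * q * I := by
  linear_combination q ^ 2 * I_sq

theorem add_mul_I_pow_four (p q : ℂ) : (p + q * I) ^ 4 =
    p ^ 4 - 6 * p ^ 2 * q ^ 2 + q ^ 4 + (4 * p ^ 3 * q - 4 * p * q ^ 3) * I := by
  rw [show (p + q * I) ^ 4 = ((p + q * I) ^ 2) ^ 2 by ring, add_mul_I_pow_two]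
  linear_combination 4 * p ^ 2 * q ^ 2 * I_sq

theorem log_two : log 2 = Real.log 2 := by
  rw [ofReal_log zero_le_two, ofReal_ofNat]

theorem log_two_mul {z : ℂ} (hz : z ≠ 0) : log (2 * z) = Real.log 2 + log z := by
  rw [← log_ofReal_mul two_pos hz, ofReal_ofNat]

theorem log_neg_of_im_pos {z : ℂ} (hz : 0 < z.im) : log (-z) = log z - Real.pi * I := by
  rw [log, log, arg_neg_eq_arg_sub_pi_of_im_pos hz, norm_neg]
  push_cast
  ring

theorem log_one_add_I : log (1 + I) = Real.log 2 / 2 + Real.pi / 4 * I := by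
  have h : exp ((Real.log 2 / 2 : ℝ) + (Real.pi / 4 : ℝ) * I) = 1 + I := by
    rw [exp_add_mul_I, ← ofReal_cos, ← ofReal_sin, ← ofReal_exp, Real.exp_half,
      Real.exp_log two_pos, Real.cos_pi_div_four, Real.sin_pi_div_four]
    apply Complex.ext <;> simp <;> linarith [Real.mul_self_sqrt zero_le_two]
  rw [← h, log_exp]
  · push_cast
    rfl
  all_goals
    rw [add_im, ofReal_im, im_ofReal_mul, I_im]
    linarith [Real.pi_pos]

theorem log_one_sub_I : log (1 - I) = Real.log 2 / 2 + -(Real.pi / 4) * I := by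
  rw [show 1 - I = conj (1 + I) by simp [sub_eq_add_neg], log_conj _ (by simp [arg_eq_pi_iff]),
    log_one_add_I]
  simp [-ofNat_log, map_ofNat]

theorem log_neg_one_add_I : log (-(1 + I)) = Real.log 2 / 2 + -(3 * Real.pi / 4) * I := by
  rw [log_neg_of_im_pos (by simp), log_one_add_I]
  ring

theorem log_neg_one_sub_I : log (-(1 - I)) = Real.log 2 / 2 + 3 * Real.pi / 4 * I := by
  rw [show -(1 - I) = conj (-(1 + I)) by simp [sub_eq_add_neg],
    log_conj _ (by simp [arg_eq_pi_iff]), log_neg_one_add_I]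
  simp [-ofNat_log, map_ofNat]

theorem one_add_I_ne_zero : 1 + I ≠ 0 := by simp [Complex.ext_iff]

theorem one_sub_I_ne_zero : 1 - I ≠ 0 := by simp [Complex.ext_iff]

theorem inv_one_add_I : (1 + I)⁻¹ = (1 - I) / 2 := by
  field_simp [one_add_I_ne_zero]
  linear_combination I_sq

theorem inv_one_sub_I : (1 - I)⁻¹ = (1 + I) / 2 := by
  field_simp [one_sub_I_ne_zero]
  linear_combination I_sq

theorem polylog_three_add_polylog_three_inv {z : ℂ} (hz : -z ∈ slitPlane) :
    polylog 3 z + polylog 3 z⁻¹ =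
      -log (-z) ^ 4 / 24 - Real.pi ^ 2 / 12 * log (-z) ^ 2 - 7 * Real.pi ^ 4 / 360 := by
  have him : |(log (-z)).im| < Real.pi := by
    rw [log_im]
    exact abs_lt.2 ⟨neg_pi_lt_arg _, (arg_le_pi _).lt_of_ne (mem_slitPlane_iff_arg.1 hz).1⟩
  rw [← polylog_three_inversion him, exp_neg, exp_log (slitPlane_ne_zero hz), neg_neg, inv_neg,
    neg_neg]

theorem polylog_three_one_add_I : polylog 3 (1 + I) =
    -Real.log 2 ^ 4 / 384 + 11 / 768 * Real.pi ^ 2 * Real.log 2 ^ 2 + 1313 / 92160 * Real.pi ^ 4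
      + (Real.pi * Real.log 2 ^ 3 / 64 + 7 / 256 * Real.pi ^ 3 * Real.log 2) * I
      - polylog 3 ((1 - I) / 2) := by
  have h := polylog_three_add_polylog_three_inv (z := 1 + I) (by simp [slitPlane])
  rw [inv_one_add_I, log_neg_one_add_I, add_mul_I_pow_two, add_mul_I_pow_four] at h
  linear_combination h

theorem polylog_three_one_sub_I : polylog 3 (1 - I) =
    -Real.log 2 ^ 4 / 384 + 11 / 768 * Real.pi ^ 2 * Real.log 2 ^ 2 + 1313 / 92160 * Real.pi ^ 4
      + (-(Real.pi * Real.log 2 ^ 3) / 64 - 7 / 256 * Real.pi ^ 3 * Real.log 2) * I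
      - polylog 3 ((1 + I) / 2) := by
  have h := polylog_three_add_polylog_three_inv (z := 1 - I) (by simp [slitPlane])
  rw [inv_one_sub_I, log_neg_one_sub_I, add_mul_I_pow_two, add_mul_I_pow_four] at h
  linear_combination h

theorem polylog_three_neg_one_add_I : polylog 3 (-(1 + I)) =
    -Real.log 2 ^ 4 / 384 - 13 / 768 * Real.pi ^ 2 * Real.log 2 ^ 2 - 1327 / 92160 * Real.pi ^ 4
      + (-(Real.pi * Real.log 2 ^ 3) / 192 - 5 / 256 * Real.pi ^ 3 * Real.log 2) * I
      - polylog 3 (-((1 - I) / 2)) := by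
  have h := polylog_three_add_polylog_three_inv (z := -(1 + I)) (by simp [slitPlane])
  rw [inv_neg, inv_one_add_I, neg_neg, log_one_add_I, add_mul_I_pow_two, add_mul_I_pow_four] at h
  linear_combination h

theorem polylog_three_neg_one_sub_I : polylog 3 (-(1 - I)) =
    -Real.log 2 ^ 4 / 384 - 13 / 768 * Real.pi ^ 2 * Real.log 2 ^ 2 - 1327 / 92160 * Real.pi ^ 4
      + (Real.pi * Real.log 2 ^ 3 / 192 + 5 / 256 * Real.pi ^ 3 * Real.log 2) * I
      - polylog 3 (-((1 + I) / 2)) := by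
  have h := polylog_three_add_polylog_three_inv (z := -(1 - I)) (by simp [slitPlane])
  rw [inv_neg, inv_one_sub_I, neg_neg, log_one_sub_I, add_mul_I_pow_two, add_mul_I_pow_four] at h
  linear_combination h

theorem log_neg_two_mul_I : log (-(2 * I)) = Real.log 2 + -(Real.pi / 2) * I := by
  rw [← mul_neg, log_two_mul (neg_ne_zero.2 I_ne_zero), log_neg_I]

theorem log_neg_two_mul_one_add_I :
    log (-(2 * (1 + I))) = 3 * Real.log 2 / 2 + -(3 * Real.pi / 4) * I := by
  rw [← mul_neg, log_two_mul (neg_ne_zero.2 one_add_I_ne_zero), log_neg_one_add_I]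
  ring

theorem log_neg_two_mul_one_sub_I :
    log (-(2 * (1 - I))) = 3 * Real.log 2 / 2 + 3 * Real.pi / 4 * I := by
  rw [← mul_neg, log_two_mul (neg_ne_zero.2 one_sub_I_ne_zero), log_neg_one_sub_I]
  ring

theorem log_four : log 4 = 2 * Real.log 2 := by
  rw [show (4 : ℂ) = 2 * 2 by norm_num, log_two_mul two_ne_zero, log_two, two_mul]

theorem polylog_three_two_mul_I : polylog 3 (2 * I) =
    -Real.log 2 ^ 4 / 24 - Real.pi ^ 2 * Real.log 2 ^ 2 / 48 - 7 / 5760 * Real.pi ^ 4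
      + (Real.pi * Real.log 2 ^ 3 / 12 + Real.pi ^ 3 * Real.log 2 / 16) * I
      - polylog 3 (-I / 2) := by
  have h := polylog_three_add_polylog_three_inv (z := 2 * I) (by simp [slitPlane])
  rw [mul_inv, inv_I, show 2⁻¹ * -I = -I / 2 by ring,
    log_neg_two_mul_I, add_mul_I_pow_two, add_mul_I_pow_four] at h
  linear_combination h

theorem polylog_three_two_mul_one_add_I : polylog 3 (2 * (1 + I)) =
    -27 / 128 * Real.log 2 ^ 4 + 33 / 256 * Real.pi ^ 2 * Real.log 2 ^ 2
      + 1313 / 92160 * Real.pi ^ 4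
      + (27 / 64 * Real.pi * Real.log 2 ^ 3 + 21 / 256 * Real.pi ^ 3 * Real.log 2) * I
      - polylog 3 ((1 - I) / 4) := by
  have h := polylog_three_add_polylog_three_inv (z := 2 * (1 + I)) (by simp [slitPlane])
  rw [mul_inv, inv_one_add_I, show 2⁻¹ * ((1 - I) / 2) = (1 - I) / 4 by ring,
    log_neg_two_mul_one_add_I, add_mul_I_pow_two, add_mul_I_pow_four] at h
  linear_combination h

theorem polylog_three_two_mul_one_sub_I : polylog 3 (2 * (1 - I)) =
    -27 / 128 * Real.log 2 ^ 4 + 33 / 256 * Real.pi ^ 2 * Real.log 2 ^ 2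
      + 1313 / 92160 * Real.pi ^ 4
      + (-27 / 64 * Real.pi * Real.log 2 ^ 3 - 21 / 256 * Real.pi ^ 3 * Real.log 2) * I
      - polylog 3 ((1 + I) / 4) := by
  have h := polylog_three_add_polylog_three_inv (z := 2 * (1 - I)) (by simp [slitPlane])
  rw [mul_inv, inv_one_sub_I, show 2⁻¹ * ((1 + I) / 2) = (1 + I) / 4 by ring,
    log_neg_two_mul_one_sub_I, add_mul_I_pow_two, add_mul_I_pow_four] at h
  linear_combination h

theorem polylog_three_neg_four : polylog 3 (-4) =
    -2 / 3 * Real.log 2 ^ 4 - Real.pi ^ 2 * Real.log 2 ^ 2 / 3 - 7 / 360 * Real.pi ^ 4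
      - polylog 3 (-1 / 4) := by
  have h := polylog_three_add_polylog_three_inv (z := -4) (by simp [slitPlane])
  rw [neg_neg, log_four, show (-4 : ℂ)⁻¹ = -1 / 4 by norm_num] at h
  linear_combination h

theorem polylog_three_neg_two : polylog 3 (-2) =
    -Real.log 2 ^ 4 / 24 - Real.pi ^ 2 * Real.log 2 ^ 2 / 12 - 7 / 360 * Real.pi ^ 4
      - polylog 3 (-2⁻¹) := by
  have h := polylog_three_add_polylog_three_inv (z := -2) (by simp [slitPlane])
  rw [neg_neg, log_two, inv_neg] at h
  linear_combination h

theorem polylog_three_eq_Li {z : ℂ} (h : normSq z < 1) : polylog 3 z = Li 4 z :=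
  polylog_eq_Li 3 (by rwa [normSq_eq_norm_sq, sq_lt_one_iff₀ (norm_nonneg z)] at h)

theorem Li_four_of_sq_eq {z w : ℂ} (hz : normSq z < 1) (h : z ^ 2 = w) :
    Li 4 w = 8 * (Li 4 z + Li 4 (-z)) := by
  rw [normSq_eq_norm_sq, sq_lt_one_iff₀ (norm_nonneg z)] at hz
  rw [Li_add_Li_neg (by norm_num) hz.le, h]
  ring

theorem polylog_three_I : polylog 3 I = -7 * Real.pi ^ 4 / 11520 + beta 4 * I := by
  rw [← Li_four_I]
  exact polylog_eq_Li_of_norm_le_one (by norm_num) (by simp) (mem_cutPlane_iff.2 (by simp))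

theorem polylog_three_neg_I : polylog 3 (-I) = -7 * Real.pi ^ 4 / 11520 - beta 4 * I := by
  rw [← Li_four_neg_I]
  exact polylog_eq_Li_of_norm_le_one (by norm_num) (by simp) (mem_cutPlane_iff.2 (by simp))

theorem polylog_three_neg_one : polylog 3 (-1) = -7 * Real.pi ^ 4 / 720 := by
  rw [← Li_four_neg_one]
  exact polylog_eq_Li_of_norm_le_one (by norm_num) (by simp) (mem_cutPlane_iff.2 (by norm_num))

theorem polylog_three_one_add_I_div_two : polylog 3 ((1 + I) / 2) = Li 4 ((1 + I) / 2) :=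
  polylog_three_eq_Li (by simp [normSq_apply]; norm_num)

theorem polylog_three_one_sub_I_div_two : polylog 3 ((1 - I) / 2) = conj (Li 4 ((1 + I) / 2)) := by
  rw [← Li_conj, polylog_three_eq_Li (by simp [normSq_apply]; norm_num)]
  simp [sub_eq_add_neg, map_ofNat]

theorem polylog_three_neg_I_div_two : polylog 3 (-I / 2) = Li 4 (-I / 2) :=
  polylog_three_eq_Li (by simp; norm_num)

theorem polylog_three_I_div_two : polylog 3 (I / 2) = conj (Li 4 (-I / 2)) := by
  rw [← Li_conj, polylog_three_eq_Li (by simp; norm_num)]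
  simp [map_ofNat]

theorem polylog_three_one_add_I_div_four : polylog 3 ((1 + I) / 4) = Li 4 ((1 + I) / 4) :=
  polylog_three_eq_Li (by simp [normSq_apply]; norm_num)

theorem polylog_three_one_sub_I_div_four :
    polylog 3 ((1 - I) / 4) = conj (Li 4 ((1 + I) / 4)) := by
  rw [← Li_conj, polylog_three_eq_Li (by simp [normSq_apply]; norm_num)]
  simp [sub_eq_add_neg, map_ofNat]

theorem polylog_three_one_add_I_div_eight :
    polylog 3 ((1 + I) / 8) = conj (Li 4 ((1 - I) / 8)) := by
  rw [← Li_conj, polylog_three_eq_Li (by simp [normSq_apply]; norm_num)]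
  simp [map_ofNat]

theorem polylog_three_inv_two : polylog 3 2⁻¹ = Li 4 2⁻¹ := polylog_three_eq_Li (by norm_num)

theorem polylog_three_neg_inv_two : polylog 3 (-2⁻¹) = Li 4 (-2⁻¹) :=
  polylog_three_eq_Li (by norm_num)

theorem polylog_three_neg_inv_eight : polylog 3 (-8⁻¹) = Li 4 (-8⁻¹) :=
  polylog_three_eq_Li (by norm_num)

theorem polylog_three_inv_four : polylog 3 4⁻¹ = 8 * (Li 4 2⁻¹ + Li 4 (-2⁻¹)) := by
  rw [polylog_three_eq_Li (by norm_num)]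
  exact Li_four_of_sq_eq (by norm_num) (by norm_num)

theorem polylog_three_neg_one_sub_I_div_two :
    polylog 3 (-((1 - I) / 2)) = Li 4 (-I / 2) / 8 - conj (Li 4 ((1 + I) / 2)) := by
  have h := Li_four_of_sq_eq (z := (1 - I) / 2) (w := -I / 2) (by simp [normSq_apply]; norm_num)
    (by linear_combination I_sq / 4)
  rw [← polylog_three_one_sub_I_div_two, h, polylog_three_eq_Li, polylog_three_eq_Li]
  · ring
  all_goals simp [normSq_apply]; norm_num

theorem polylog_three_neg_one_add_I_div_two :
    polylog 3 (-((1 + I) / 2)) = conj (Li 4 (-I / 2)) / 8 - Li 4 ((1 + I) / 2) := by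
  have h := Li_four_of_sq_eq (z := (1 + I) / 2) (w := I / 2) (by simp [normSq_apply]; norm_num)
    (by linear_combination I_sq / 4)
  rw [← polylog_three_I_div_two, polylog_three_eq_Li, polylog_three_eq_Li, h]
  · ring
  all_goals simp [normSq_apply]; norm_num

theorem polylog_three_neg_one_div_four :
    polylog 3 (-1 / 4) = 8 * (Li 4 (-I / 2) + conj (Li 4 (-I / 2))) := by
  rw [polylog_three_eq_Li (by norm_num), ← polylog_three_I_div_two,
    polylog_three_eq_Li (by simp; norm_num), Li_four_of_sq_eq (z := -I / 2) (by simp; norm_num)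
      (by linear_combination I_sq / 4), neg_div, neg_neg]

theorem Li_four_relation_I_I :
    2 * Li 4 ((1 + I) / 4) - 27 / 4 * Li 4 (-I / 2) - 12 * Li 4 ((1 + I) / 2)
      + 24 * conj (Li 4 ((1 + I) / 2)) - 6 * Li 4 2⁻¹ =
    (5 / 64 * Real.log 2 ^ 4 - 7 / 128 * Real.pi ^ 2 * Real.log 2 ^ 2
        + 349 / 9216 * Real.pi ^ 4 : ℝ)
      + (-3 / 32 * Real.pi * Real.log 2 ^ 3 + 27 / 128 * Real.pi ^ 3 * Real.log 2
        - 20 * beta 4 : ℝ) * I := by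
  have h := tetralog_I_I
  rw [polylog_three_I, polylog_three_one_add_I_div_four, polylog_three_neg_one,
    polylog_three_neg_I_div_two, polylog_three_one_add_I_div_two, polylog_three_one_add_I,
    polylog_three_neg_one_sub_I_div_two, polylog_three_neg_I, polylog_three_inv_two,
    polylog_three_one_sub_I_div_two, log_one_sub_I, add_mul_I_pow_four] at h
  push_cast at h ⊢
  linear_combination h

theorem Li_four_relation_I_neg_one :
    conj (Li 4 ((1 - I) / 8)) - 9 * conj (Li 4 ((1 + I) / 4)) - 3 * Li 4 ((1 + I) / 4)
      + 81 / 8 * Li 4 (-I / 2) - 7 / 8 * conj (Li 4 (-I / 2)) + 2 * Li 4 ((1 + I) / 2)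
      + 10 * conj (Li 4 ((1 + I) / 2)) + 6 * Li 4 2⁻¹ =
    (91 / 384 * Real.log 2 ^ 4 - 113 / 768 * Real.pi ^ 2 * Real.log 2 ^ 2
        + 1265 / 18432 * Real.pi ^ 4 : ℝ)
      + (-29 / 192 * Real.pi * Real.log 2 ^ 3 + 47 / 256 * Real.pi ^ 3 * Real.log 2
        - 12 * beta 4 : ℝ) * I := by
  have h := tetralog_I_neg_one
  rw [polylog_three_neg_one_add_I, polylog_three_neg_one_add_I_div_two,
    polylog_three_one_add_I_div_eight, polylog_three_neg_one_div_four, polylog_three_neg_I,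
    polylog_three_one_sub_I_div_four, polylog_three_I_div_two,
    polylog_three_neg_one_sub_I_div_two, polylog_three_two_mul_I, polylog_three_neg_one_sub_I,
    polylog_three_one_sub_I, polylog_three_one_sub_I_div_two, polylog_three_one_add_I_div_four,
    polylog_three_I, polylog_three_neg_one, polylog_three_inv_two, log_one_sub_I, log_two,
    polylog_three_neg_I_div_two, polylog_three_one_add_I_div_two,
    polylog_three_neg_one_add_I_div_two, add_mul_I_pow_two] at h
  push_cast at h ⊢
  linear_combination h

theorem Li_four_relation_neg_one_one_add_I :
    3 * (Li 4 ((1 + I) / 4) + conj (Li 4 ((1 + I) / 4)))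
      - 81 / 8 * (Li 4 (-I / 2) + conj (Li 4 (-I / 2)))
      - 22 * (Li 4 ((1 + I) / 2) + conj (Li 4 ((1 + I) / 2))) + 7 * Li 4 2⁻¹ =
    (-115 / 192 * Real.log 2 ^ 4 + 137 / 384 * Real.pi ^ 2 * Real.log 2 ^ 2
      - 1697 / 9216 * Real.pi ^ 4 : ℝ) := by
  have h := tetralog_neg_one_one_add_I
  rw [polylog_three_neg_one_sub_I_div_two, polylog_three_neg_four, polylog_three_neg_one_div_four,
    polylog_three_neg_one_add_I_div_two, polylog_three_inv_two, polylog_three_neg_one_add_I,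
    polylog_three_neg_one_sub_I_div_two, polylog_three_one_sub_I_div_two,
    polylog_three_neg_one_sub_I, polylog_three_neg_one_add_I_div_two,
    polylog_three_one_add_I_div_two, polylog_three_I, polylog_three_two_mul_one_add_I,
    polylog_three_one_sub_I_div_four, polylog_three_neg_I, polylog_three_neg_I_div_two,
    polylog_three_two_mul_one_sub_I, polylog_three_one_add_I_div_four, polylog_three_I_div_two,
    polylog_three_neg_one, polylog_three_one_add_I, polylog_three_one_sub_I_div_two,
    polylog_three_one_sub_I, polylog_three_one_add_I_div_two, log_two, log_neg_I] at h
  push_cast at h ⊢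
  linear_combination h + 3 / 8 * Real.log 2 ^ 2 * Real.pi ^ 2 * I_sq

theorem Li_four_relation_neg_one_neg_one :
    2 * Li 4 (-8⁻¹) - 84 * Li 4 2⁻¹ - 108 * Li 4 (-2⁻¹) =
    (5 / 4 * Real.log 2 ^ 4 - Real.pi ^ 2 * Real.log 2 ^ 2 / 2 + Real.pi ^ 4 / 9 : ℝ) := by
  have h := tetralog_neg_one_neg_one
  rw [polylog_three_neg_inv_eight, polylog_three_inv_four, polylog_three_neg_inv_two,
    polylog_three_neg_two, polylog_three_neg_one, polylog_three_inv_two,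
    polylog_three_neg_inv_two, zeta_four] at h
  push_cast at h ⊢
  linear_combination h

theorem Li_ofReal_im (n : ℕ) (x : ℝ) : (Li n x).im = 0 := by
  rw [← conj_eq_iff_im, ← Li_conj, conj_ofReal]

theorem Li_four_re_relation_I_I :
    2 * (Li 4 ((1 + I) / 4)).re - 27 / 4 * (Li 4 (-I / 2)).re + 12 * (Li 4 ((1 + I) / 2)).re
      - 6 * (Li 4 2⁻¹).re =
    5 / 64 * Real.log 2 ^ 4 - 7 / 128 * Real.pi ^ 2 * Real.log 2 ^ 2
      + 349 / 9216 * Real.pi ^ 4 := by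
  have h := congrArg re Li_four_relation_I_I
  simp only [add_re, sub_re, mul_re, div_ofNat_re, div_ofNat_im, re_ofNat, im_ofNat, conj_re,
    conj_im, ofReal_re, ofReal_im, I_re, I_im] at h
  linear_combination h

theorem Li_four_im_relation_I_I :
    2 * (Li 4 ((1 + I) / 4)).im - 27 / 4 * (Li 4 (-I / 2)).im - 36 * (Li 4 ((1 + I) / 2)).im =
    -3 / 32 * Real.pi * Real.log 2 ^ 3 + 27 / 128 * Real.pi ^ 3 * Real.log 2 - 20 * beta 4 := by
  have him : (Li 4 2⁻¹).im = 0 := by simpa using Li_ofReal_im 4 2⁻¹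
  have h := congrArg im Li_four_relation_I_I
  simp only [add_im, sub_im, mul_im, div_ofNat_re, div_ofNat_im, re_ofNat, im_ofNat, conj_re,
    conj_im, ofReal_re, ofReal_im, I_re, I_im] at h
  linear_combination h + 6 * him

theorem Li_four_re_relation_I_neg_one :
    (Li 4 ((1 - I) / 8)).re - 12 * (Li 4 ((1 + I) / 4)).re + 37 / 4 * (Li 4 (-I / 2)).re
      + 12 * (Li 4 ((1 + I) / 2)).re + 6 * (Li 4 2⁻¹).re =
    91 / 384 * Real.log 2 ^ 4 - 113 / 768 * Real.pi ^ 2 * Real.log 2 ^ 2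
      + 1265 / 18432 * Real.pi ^ 4 := by
  have h := congrArg re Li_four_relation_I_neg_one
  simp only [add_re, sub_re, mul_re, div_ofNat_re, div_ofNat_im, re_ofNat, im_ofNat, conj_re,
    conj_im, ofReal_re, ofReal_im, I_re, I_im] at h
  linear_combination h

theorem Li_four_im_relation_I_neg_one :
    -(Li 4 ((1 - I) / 8)).im + 6 * (Li 4 ((1 + I) / 4)).im + 11 * (Li 4 (-I / 2)).im
      - 8 * (Li 4 ((1 + I) / 2)).im =
    -29 / 192 * Real.pi * Real.log 2 ^ 3 + 47 / 256 * Real.pi ^ 3 * Real.log 2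
      - 12 * beta 4 := by
  have him : (Li 4 2⁻¹).im = 0 := by simpa using Li_ofReal_im 4 2⁻¹
  have h := congrArg im Li_four_relation_I_neg_one
  simp only [add_im, sub_im, mul_im, div_ofNat_re, div_ofNat_im, re_ofNat, im_ofNat, conj_re,
    conj_im, ofReal_re, ofReal_im, I_re, I_im] at h
  linear_combination h - 6 * him

theorem Li_four_re_relation_neg_one_one_add_I :
    6 * (Li 4 ((1 + I) / 4)).re - 81 / 4 * (Li 4 (-I / 2)).re - 44 * (Li 4 ((1 + I) / 2)).re
      + 7 * (Li 4 2⁻¹).re =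
    -115 / 192 * Real.log 2 ^ 4 + 137 / 384 * Real.pi ^ 2 * Real.log 2 ^ 2
      - 1697 / 9216 * Real.pi ^ 4 := by
  have h := congrArg re Li_four_relation_neg_one_one_add_I
  simp only [add_re, sub_re, mul_re, div_ofNat_re, div_ofNat_im, re_ofNat, im_ofNat, conj_re,
    ofReal_re] at h
  linear_combination h

theorem Li_four_re_relation_neg_one_neg_one :
    2 * (Li 4 (-8⁻¹)).re - 84 * (Li 4 2⁻¹).re - 108 * (Li 4 (-2⁻¹)).re =
    5 / 4 * Real.log 2 ^ 4 - Real.pi ^ 2 * Real.log 2 ^ 2 / 2 + Real.pi ^ 4 / 9 := by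
  have h := congrArg re Li_four_relation_neg_one_neg_one
  simp only [sub_re, mul_re, re_ofNat, im_ofNat, ofReal_re] at h
  linear_combination h

theorem Li_four_re_of_conj_eq_neg {z w : ℂ} (hz : normSq z < 1) (h : z ^ 2 = w)
    (hc : conj z = -z) : (Li 4 z).re = (Li 4 w).re / 16 := by
  rw [Li_four_of_sq_eq hz h, ← hc, Li_conj, add_conj]
  simp
  ring

theorem A_four : A 4 = (Li 4 2⁻¹).re := by rw [A, one_div]

theorem B_four : B 4 = 8 * (Li 4 ((1 + I) / 2)).re := by
  rw [B, show (2 : ℂ) ^ (((4 : ℕ) : ℤ) - 1) = (8 : ℝ) by norm_num, re_ofReal_mul]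

theorem F_four : F 4 = 8 * (Li 4 ((1 + I) / 2)).im := by
  rw [F, show (2 : ℂ) ^ (((4 : ℕ) : ℤ) - 1) = (8 : ℝ) by norm_num, im_ofReal_mul]

theorem two_thirds_zpow : (2 / 3 : ℂ) ^ (((4 : ℕ) : ℤ) - 1) = (8 / 27 : ℝ) := by norm_num

theorem two_fifths_zpow : (2 / 5 : ℂ) ^ (((4 : ℕ) : ℤ) - 1) = (8 / 125 : ℝ) := by norm_num

theorem C_four : C 4 = 1 / 54 * (Li 4 (-8⁻¹)).re - (Li 4 (-2⁻¹)).re := by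
  have h8 : ((√8 : ℝ) : ℂ) ^ 2 = 8 := by exact_mod_cast Real.sq_sqrt (by norm_num : (0 : ℝ) ≤ 8)
  have h2 : ((√2 : ℝ) : ℂ) ^ 2 = 2 := by exact_mod_cast Real.sq_sqrt zero_le_two
  rw [C, two_thirds_zpow, sub_re, re_ofReal_mul, show (2 : ℂ) ^ 4 = (16 : ℝ) by norm_num,
    re_ofReal_mul, Li_four_re_of_conj_eq_neg (z := I / (√8 : ℝ)) (w := -8⁻¹),
    Li_four_re_of_conj_eq_neg (z := -I / (√2 : ℝ)) (w := -2⁻¹)]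
  · ring
  · simp; norm_num
  · rw [div_pow, neg_sq, I_sq, h2]; norm_num
  · simp [neg_div]
  · simp; norm_num
  · rw [div_pow, I_sq, h8]; norm_num
  · simp [neg_div]

theorem D_four : D 4 = 8 / 27 * (Li 4 ((1 + I) / 4)).re - (Li 4 (-I / 2)).re := by
  rw [D, two_thirds_zpow, sub_re, re_ofReal_mul]

theorem G_four : G 4 = 8 / 27 * (Li 4 ((1 + I) / 4)).im - (Li 4 (-I / 2)).im := by
  rw [G, two_thirds_zpow, sub_im, im_ofReal_mul]

theorem E_four : E 4 = 8 / 125 * (Li 4 ((1 - I) / 8)).re - 2 * (Li 4 (-I / 2)).re := by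
  rw [E, two_fifths_zpow, sub_re, re_ofReal_mul]; congr 1; simp

theorem H_four : H 4 = 8 / 125 * (Li 4 ((1 - I) / 8)).im - 2 * (Li 4 (-I / 2)).im := by
  rw [H, two_fifths_zpow, sub_im, im_ofReal_mul]; congr 1; simp

theorem L_four : L ((4 : ℕ) : ℤ) = Real.log 2 ^ 4 / 24 := by
  rw [L, if_neg (by norm_num), Int.toNat_natCast]
  norm_num [Nat.factorial]

theorem L_three : L (((4 : ℕ) : ℤ) - 1) = -Real.log 2 ^ 3 / 6 := by
  rw [show ((4 : ℕ) : ℤ) - 1 = (3 : ℕ) by norm_num, L, if_neg (by norm_num), Int.toNat_natCast]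
  norm_num [Nat.factorial]
  ring

theorem L_two : L (((4 : ℕ) : ℤ) - 2) = Real.log 2 ^ 2 / 2 := by
  rw [show ((4 : ℕ) : ℤ) - 2 = (2 : ℕ) by norm_num, L, if_neg (by norm_num), Int.toNat_natCast]
  norm_num [Nat.factorial]

theorem ladder_B : Bbar 4 - 5 / 2 * Abar 4 = 343 / 128 * zeta 4 := by
  rw [Bbar, Abar, B_four, A_four, L_four, L_two, zeta_two, zeta_four]
  linear_combination (3 * Li_four_re_relation_I_I -
    Li_four_re_relation_neg_one_one_add_I) / 10

theorem ladder_C : Cbar 4 - 7 / 9 * Abar 4 = 5 / 54 * zeta 4 := by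
  rw [Cbar, Abar, C_four, A_four, L_four, L_two, zeta_two, zeta_four]
  linear_combination Li_four_re_relation_neg_one_neg_one / 108

theorem ladder_D : Dbar 4 - 1 / 3 * Abar 4 = -(313 / 3456) * zeta 4 := by
  rw [Dbar, Abar, D_four, A_four, L_four, L_two, zeta_two, zeta_four]
  linear_combination 11 / 135 * Li_four_re_relation_I_I +
    Li_four_re_relation_neg_one_one_add_I / 45

theorem ladder_E : Ebar 4 - 6 / 25 * Abar 4 = -(1547 / 16000) * zeta 4 := by
  rw [Ebar, Abar, E_four, A_four, L_four, L_two, zeta_two, zeta_four]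
  linear_combination 8 / 125 * Li_four_re_relation_I_neg_one +
    114 / 625 * Li_four_re_relation_I_I +
    42 / 625 * Li_four_re_relation_neg_one_one_add_I

theorem ladder_G :
    Gbar 4 - 2 / 3 * Fbar 4 - beta 3 * Real.log 2 = -(80 / 27) * beta 4 := by
  rw [Gbar, Fbar, G_four, F_four, L_three, beta_three]
  linear_combination 4 / 27 * Li_four_im_relation_I_I

theorem ladder_H :
    Hbar 4 - 4 / 5 * Fbar 4 - 23 / 25 * beta 3 * Real.log 2 = -(384 / 125) * beta 4 := by
  rw [Hbar, Fbar, H_four, F_four, L_three, beta_three]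
  linear_combination -(8 / 125) * Li_four_im_relation_I_neg_one +
    24 / 125 * Li_four_im_relation_I_I

/-! ### BBP-type formulas -/

theorem S_add {n : ℕ} (hn : 2 ≤ n) (p : ℕ) (a b : Fin 8 → ℤ) :
    S n p (a + b) = S n p a + S n p b := by
  rw [S, S, S, ← (summable_S n p hn a).tsum_add (summable_S n p hn b)]
  simp only [Pi.add_apply, Int.cast_add, add_div]

theorem S_smul (n p : ℕ) (k : ℤ) (a : Fin 8 → ℤ) : S n p (k • a) = k * S n p a := by
  rw [S, S, ← tsum_mul_left]
  simp only [Pi.smul_apply, smul_eq_mul, Int.cast_mul, mul_div_assoc]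

theorem ofNat_eight_mul_add (q : ℕ) (i : Fin 8) : Fin.ofNat 8 (8 * q + i) = i := by
  ext
  simp [Fin.ofNat, Nat.add_mod]

theorem norm_lt_one_of_pow_mul_eq_one {z : ℂ} {m p : ℕ} (hp : p ≠ 0) (hz : z ^ m * 16 ^ p = 1) :
    ‖z‖ < 1 := by
  by_contra! h
  have hnorm : ‖z‖ ^ m * 16 ^ p = 1 := by simpa using congrArg norm hz
  nlinarith [one_le_pow₀ h (n := m), one_lt_pow₀ (by norm_num : (1 : ℝ) < 16) hp]

theorem re_pow_mul_add_mul_two_pow {z : ℂ} {m p : ℕ} (hz : z ^ m * 16 ^ p = 1) (q s : ℕ) :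
    (z ^ (m * q + s)).re * 2 ^ (4 * p * q) = (z ^ s).re := by
  have h : z ^ (m * q + s) * ((2 ^ (4 * p * q) : ℝ) : ℂ) = z ^ s := by
    rw [ofReal_pow, ofReal_ofNat, pow_add, pow_mul, pow_mul, pow_mul, mul_right_comm, ← mul_pow]
    norm_num [hz]
  rw [← h, re_mul_ofReal]

theorem hasSum_re_Li (n : ℕ) {z : ℂ} (hz : ‖z‖ < 1) :
    HasSum (fun k : ℕ => (z ^ (k + 1)).re / ((k + 1 : ℕ) : ℝ) ^ n) (Li n z).re := by
  refine (hasSum_re (summable_Li n hz).hasSum).congr_fun fun k => ?_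
  rw [← ofReal_natCast, ← ofReal_pow, div_ofReal_re]

theorem S_eq_re_Li (n : ℕ) {p : ℕ} (hp : p ≠ 0) {a : Fin 8 → ℤ} {z : ℂ} (hz : z ^ 8 * 16 ^ p = 1)
    (ha : ∀ i : Fin 8, (a i : ℝ) = (z ^ (i + 1 : ℕ)).re * 2 ^ ((p * (i + 1) + p) / 2)) :
    S n p a = (Li n z).re := by
  rw [← (hasSum_re_Li n (norm_lt_one_of_pow_mul_eq_one hp hz)).tsum_eq, S]
  refine tsum_congr fun j => ?_
  obtain ⟨q, i, rfl⟩ : ∃ q, ∃ i : Fin 8, j = 8 * q + i :=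
    ⟨j / 8, ⟨j % 8, Nat.mod_lt _ (by norm_num)⟩, (Nat.div_add_mod j 8).symm⟩
  rw [ofNat_eight_mul_add, ha, ← re_pow_mul_add_mul_two_pow hz q, ← div_div,
    show (p * (8 * q + i + 1) + p) / 2 = 4 * p * q + (p * (i + 1) + p) / 2 by
      rw [← Nat.mul_add_div two_pos]; ring_nf, pow_add 2, mul_assoc,
    mul_div_cancel_right₀ _ (by positivity), add_assoc]

theorem S_even_eq_re_Li (n : ℕ) {p : ℕ} (hp : p ≠ 0) {b : Fin 4 → ℤ} {w : ℂ}
    (hw : w ^ 4 * 16 ^ p = 1)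
    (hb : ∀ i : Fin 4, (b i : ℝ) = (w ^ (i + 1 : ℕ)).re * 2 ^ ((p * (2 * (i + 1)) + p) / 2)) :
    S n p ![0, b 0, 0, b 1, 0, b 2, 0, b 3] = (Li n w).re / 2 ^ n := by
  have hodd : Function.Injective fun m : ℕ => 2 * m + 1 :=
    (add_left_injective 1).comp (mul_right_injective₀ two_ne_zero)
  have hsum := (hasSum_re_Li n (norm_lt_one_of_pow_mul_eq_one hp hw)).div_const (2 ^ n)
  refine HasSum.tsum_eq ((hodd.hasSum_iff ?_).1 (hsum.congr_fun fun m => ?_))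
  · intro j hj
    obtain ⟨m, rfl⟩ : Even j := by
      rw [← Nat.not_odd_iff_even]
      exact fun ⟨m, hm⟩ => hj ⟨m, hm.symm⟩
    obtain ⟨q, s, hs, rfl⟩ : ∃ q s, s < 4 ∧ m = 4 * q + s :=
      ⟨m / 4, m % 4, Nat.mod_lt _ (by norm_num), (Nat.div_add_mod m 4).symm⟩
    rw [show 4 * q + s + (4 * q + s) = 8 * q + (⟨2 * s, by lia⟩ : Fin 8) by
      simp only; ring, ofNat_eight_mul_add]
    interval_cases s <;> simp
  · obtain ⟨q, i, rfl⟩ : ∃ q, ∃ i : Fin 4, m = 4 * q + i :=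
      ⟨m / 4, ⟨m % 4, Nat.mod_lt _ (by norm_num)⟩, (Nat.div_add_mod m 4).symm⟩
    have hcoeff : ![0, b 0, 0, b 1, 0, b 2, 0, b 3] (Fin.ofNat 8 (2 * (4 * q + i) + 1)) = b i := by
      rw [show 2 * (4 * q + i) + 1 = 8 * q + (⟨2 * i + 1, by lia⟩ : Fin 8) by
        simp only; ring, ofNat_eight_mul_add]
      fin_cases i <;> rfl
    simp only [Function.comp_apply]
    rw [hcoeff, hb, ← re_pow_mul_add_mul_two_pow hw q,
      show (p * (2 * (4 * q + i) + 1 + 1) + p) / 2 = 4 * p * q + (p * (2 * (i + 1)) + p) / 2 by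
        rw [← Nat.mul_add_div two_pos]; ring_nf, pow_add 2, mul_assoc, ← div_div _ (2 ^ _ * 2 ^ _),
      mul_div_cancel_right₀ _ (by positivity), add_assoc, div_div, ← mul_pow]
    congr 2
    push_cast
    ring

theorem S_one_eq_re_Li {n : ℕ} (hn : 2 ≤ n) (u a b c : ℤ) :
    S n 1 ![u, a - b, -u, a + b - c - u, -u, a - b, u, a + b + c + u] =
      u * (Li n ((1 + I) / 2)).re +
        (a * (Li n 2⁻¹).re + b * (Li n (-2⁻¹)).re + c * (Li n (I / 2)).re) / 2 ^ n := by
  have hsq : ((1 + I) / 2) ^ 2 = I / 2 := by linear_combination I_sq / 4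
  have hu : S n 1 ![1, 0, -1, -1, -1, 0, 1, 1] = (Li n ((1 + I) / 2)).re := by
    refine S_eq_re_Li n one_ne_zero ?_ fun i => ?_
    · rw [pow_mul _ 2 4, hsq, div_pow, I_pow_four]; norm_num
    · fin_cases i <;> simp [pow_succ] <;> norm_num
  have ha : S n 1 ![0, 1, 0, 1, 0, 1, 0, 1] = (Li n 2⁻¹).re / 2 ^ n := by
    refine S_even_eq_re_Li n one_ne_zero (b := ![1, 1, 1, 1]) (by norm_num) fun i => ?_
    fin_cases i <;> norm_num
  have hb : S n 1 ![0, -1, 0, 1, 0, -1, 0, 1] = (Li n (-2⁻¹)).re / 2 ^ n := by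
    refine S_even_eq_re_Li n one_ne_zero (b := ![-1, 1, -1, 1]) (by norm_num) fun i => ?_
    fin_cases i <;> norm_num
  have hc : S n 1 ![0, 0, 0, -1, 0, 0, 0, 1] = (Li n (I / 2)).re / 2 ^ n := by
    refine S_even_eq_re_Li n one_ne_zero (b := ![0, -1, 0, 1]) ?_ fun i => ?_
    · rw [div_pow, I_pow_four]; norm_num
    · fin_cases i <;> simp [pow_succ] <;> norm_num
  calc S n 1 ![u, a - b, -u, a + b - c - u, -u, a - b, u, a + b + c + u]
      = S n 1 (u • ![1, 0, -1, -1, -1, 0, 1, 1] + a • ![0, 1, 0, 1, 0, 1, 0, 1] +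
          b • ![0, -1, 0, 1, 0, -1, 0, 1] + c • ![0, 0, 0, -1, 0, 0, 0, 1]) := by
        congr 1; ext i; fin_cases i <;> simp <;> ring
    _ = _ := by
        simp only [S_add hn, S_smul, hu, ha, hb, hc]; ring

theorem two_mul_S_three_eq_re_Li {n : ℕ} (hn : 2 ≤ n) (u b : ℤ) :
    2 * S n 3 ![u, -b, -u, b - u, -u, -b, u, b + u] =
      u * (Li n ((1 + I) / 4)).re + b * (Li n (-8⁻¹)).re / 2 ^ n := by
  have hsq : ((1 + I) / 4) ^ 2 = I / 8 := by linear_combination I_sq / 16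
  have hu : S n 3 ![2, 0, -2, -2, -2, 0, 2, 2] = (Li n ((1 + I) / 4)).re := by
    refine S_eq_re_Li n three_ne_zero ?_ fun i => ?_
    · rw [pow_mul _ 2 4, hsq, div_pow, I_pow_four]; norm_num
    · fin_cases i <;> simp [pow_succ] <;> norm_num
  have hb : S n 3 ![0, -2, 0, 2, 0, -2, 0, 2] = (Li n (-8⁻¹)).re / 2 ^ n := by
    refine S_even_eq_re_Li n three_ne_zero (b := ![-2, 2, -2, 2]) (by norm_num) fun i => ?_
    fin_cases i <;> norm_num
  calc 2 * S n 3 ![u, -b, -u, b - u, -u, -b, u, b + u]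
      = S n 3 ((2 : ℤ) • ![u, -b, -u, b - u, -u, -b, u, b + u]) := by rw [S_smul, Int.cast_ofNat]
    _ = S n 3 (u • ![2, 0, -2, -2, -2, 0, 2, 2] + b • ![0, -2, 0, 2, 0, -2, 0, 2]) := by
        congr 1; ext i; fin_cases i <;> simp <;> ring
    _ = _ := by
        rw [S_add hn, S_smul, S_smul, hu, hb, mul_div_assoc]

theorem re_Li_four_relation_B : 8 * (Li 4 ((1 + I) / 2)).re - 5 / 2 * (Li 4 2⁻¹).re =
    343 / 11520 * Real.pi ^ 4 - 5 / 96 * Real.pi ^ 2 * Real.log 2 ^ 2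
      + 1 / 12 * Real.log 2 ^ 4 := by
  have h := ladder_B
  simp only [Abar, Bbar, A_four, B_four, zeta_two, zeta_four, L_two, L_four] at h
  linear_combination h

theorem re_Li_four_relation_C :
    1 / 54 * (Li 4 (-8⁻¹)).re - (Li 4 (-2⁻¹)).re - 7 / 9 * (Li 4 2⁻¹).re =
      1 / 972 * Real.pi ^ 4 - 1 / 216 * Real.pi ^ 2 * Real.log 2 ^ 2
        + 5 / 432 * Real.log 2 ^ 4 := by
  have h := ladder_C
  simp only [Abar, Cbar, A_four, C_four, zeta_two, zeta_four, L_two, L_four] at h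
  linear_combination h

theorem re_Li_four_relation_D :
    8 / 27 * (Li 4 ((1 + I) / 4)).re - (Li 4 (I / 2)).re - 1 / 3 * (Li 4 2⁻¹).re =
      -313 / 311040 * Real.pi ^ 4 + 1 / 288 * Real.pi ^ 2 * Real.log 2 ^ 2
        - 1 / 144 * Real.log 2 ^ 4 := by
  have hI : (Li 4 (-I / 2)).re = (Li 4 (I / 2)).re := by
    rw [show -I / 2 = conj (I / 2) by simp [map_ofNat], Li_conj, conj_re]
  have h := ladder_D
  simp only [Abar, Dbar, A_four, D_four, zeta_two, zeta_four, L_two, L_four, hI] at h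
  linear_combination h

theorem bbp_pi_pow_four : 41 / 9216 * Real.pi ^ 4 =
    3 * S 4 1 ![1, -19, -1, -2, -1, -19, 1, -108] + 2 * S 4 3 ![3, -1, -3, -2, -3, -1, 3, 4] := by
  have h1 : S 4 1 ![1, -19, -1, -2, -1, -19, 1, -108] = _ :=
    (congrArg (S 4 1) (by norm_num)).trans (S_one_eq_re_Li (by norm_num) 1 (-37) (-18) (-54))
  have h3 : 2 * S 4 3 ![3, -1, -3, -2, -3, -1, 3, 4] = _ :=
    (congrArg (2 * S 4 3 ·) (by norm_num)).trans (two_mul_S_three_eq_re_Li (by norm_num) 3 1)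
  rw [h1, h3]
  push_cast
  linear_combination -3 / 8 * re_Li_four_relation_B - 27 / 8 * re_Li_four_relation_C
    - 81 / 8 * re_Li_four_relation_D

theorem bbp_pi_sq_mul_log_two_sq : 123 / 128 * (Real.pi ^ 2 * Real.log 2 ^ 2) =
    3 * S 4 1 ![121, -3775, -121, -3194, -121, -3775, 121, -30780] +
      2 * S 4 3 ![773, -367, -773, -406, -773, -367, 773, 1140] := by
  have h1 : S 4 1 ![121, -3775, -121, -3194, -121, -3775, 121, -30780] = _ :=
    (congrArg (S 4 1) (by norm_num)).trans
      (S_one_eq_re_Li (by norm_num) 121 (-10381) (-6606) (-13914))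
  have h3 : 2 * S 4 3 ![773, -367, -773, -406, -773, -367, 773, 1140] = _ :=
    (congrArg (2 * S 4 3 ·) (by norm_num)).trans (two_mul_S_three_eq_re_Li (by norm_num) 773 367)
  rw [h1, h3]
  push_cast
  linear_combination -363 / 8 * re_Li_four_relation_B - 9909 / 8 * re_Li_four_relation_C
    - 20871 / 8 * re_Li_four_relation_D

theorem bbp_log_two_pow_four : 615 / 256 * Real.log 2 ^ 4 =
    3 * S 4 1 ![73, -2617, -73, -5066, -73, -2617, 73, -27564] +
      S 4 3 ![1258, -761, -1258, -497, -1258, -761, 1258, 2019] := by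
  have h1 : S 4 1 ![73, -2617, -73, -5066, -73, -2617, 73, -27564] = _ :=
    (congrArg (S 4 1) (by norm_num)).trans
      (S_one_eq_re_Li (by norm_num) 73 (-9466) (-6849) (-11322))
  have h3 : 2 * S 4 3 ![1258, -761, -1258, -497, -1258, -761, 1258, 2019] = _ :=
    (congrArg (2 * S 4 3 ·) (by norm_num)).trans (two_mul_S_three_eq_re_Li (by norm_num) 1258 761)
  rw [h1]
  push_cast at h3 ⊢
  linear_combination -219 / 8 * re_Li_four_relation_B - 20547 / 16 * re_Li_four_relation_C
    - 16983 / 8 * re_Li_four_relation_D - h3 / 2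

end Relations

/-! ### Total correctness of register machine programs -/

/-- Total correctness with resource bounds: started in a state with property `P` and with all
registers below `W`, the program `p` halts in a state with property `Q` after at most `N`
instructions, and all registers stay below `W`. In the cost model of `Runs` every instruction then
takes time at most `(1 + W.size) ^ 2`. -/
def Hoare {r : ℕ} (W : ℕ) (P : (Fin r → ℕ) → Prop) (p : Prog r) (N : ℕ)
    (Q : (Fin r → ℕ) → Prop) : Prop :=
  ∀ σ : Fin r → ℕ, (∀ i, σ i < W) → P σ → ∃ (τ : Fin r → ℕ) (t s : ℕ), Runs p σ τ t s ∧
    (∀ i, τ i < W) ∧ Q τ ∧ t ≤ N * (1 + W.size) ^ 2 ∧ s ≤ r * W.size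

/-- Assignments, the instructions without control flow. -/
inductive Cmd (r : ℕ)
  | const (x : Fin r) (n : ℕ)
  | arith (o : Op) (x y z : Fin r)

namespace Cmd

variable {r : ℕ}

/-- The assignment as a program. -/
def prog : Cmd r → Prog r
  | const x n => .const x n
  | arith o x y z => .arith o x y z

/-- The register that is assigned to. -/
def target : Cmd r → Fin r
  | const x _ => x
  | arith _ x _ _ => x

/-- The value that is assigned. -/
def val (σ : Fin r → ℕ) : Cmd r → ℕ
  | const _ n => n
  | arith o _ y z => o.eval (σ y) (σ z)

/-- A sequence of assignments as a program; it is nonempty because `Prog` has no empty program. -/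
def block : Cmd r → List (Cmd r) → Prog r
  | a, [] => a.prog
  | a, b :: l => .seq a.prog (block b l)

/-- The weakest precondition, for the postcondition `Q`, of a sequence of assignments of values
less than `W`. -/
def wp (W : ℕ) (Q : (Fin r → ℕ) → Prop) : List (Cmd r) → (Fin r → ℕ) → Prop
  | [], σ => Q σ
  | a :: l, σ => a.val σ < W ∧ wp W Q l (Function.update σ a.target (a.val σ))

end Cmd

theorem bits_le_mul_size {r W : ℕ} {σ : Fin r → ℕ} (h : ∀ i, σ i < W) : bits σ ≤ r * W.size := by
  calc bits σ ≤ ∑ _i : Fin r, W.size := Finset.sum_le_sum fun i _ => Nat.size_le_size (h i).le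
    _ = r * W.size := by rw [Finset.sum_const, Finset.card_univ, Fintype.card_fin, smul_eq_mul]

namespace Hoare

variable {r W N N' : ℕ} {P Q R : (Fin r → ℕ) → Prop} {p q : Prog r}

theorem seq (h : Hoare W P p N R) (h' : Hoare W R q N' Q) : Hoare W P (.seq p q) (N + N') Q := by
  intro σ hσ hP
  obtain ⟨τ, t, s, hrun, hτ, hR, ht, hs⟩ := h σ hσ hP
  obtain ⟨ρ, t', s', hrun', hρ, hQ, ht', hs'⟩ := h' τ hτ hR
  exact ⟨ρ, _, _, hrun.seq hrun', hρ, hQ, by linarith, max_le hs hs'⟩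

theorem conseq {P' Q' : (Fin r → ℕ) → Prop} (h : Hoare W P p N Q) (hP : ∀ σ, P' σ → P σ)
    (hN : N ≤ N') (hQ : ∀ σ, Q σ → Q' σ) : Hoare W P' p N' Q' := by
  intro σ hσ hP'
  obtain ⟨τ, t, s, hrun, hτ, hR, ht, hs⟩ := h σ hσ (hP σ hP')
  exact ⟨τ, t, s, hrun, hτ, hQ τ hR, ht.trans (Nat.mul_le_mul_right _ hN), hs⟩

theorem while_of_variant {x : Fin r} (I : (Fin r → ℕ) → Prop) (μ : (Fin r → ℕ) → ℕ) {n : ℕ}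
    (h : ∀ k, Hoare W (fun σ => I σ ∧ σ x ≠ 0 ∧ μ σ = k) p N (fun τ => I τ ∧ μ τ < k)) :
    Hoare W (fun σ => I σ ∧ μ σ ≤ n) (.while x p) (1 + n * (N + 1)) (fun τ => I τ ∧ τ x = 0) := by
  have hone : 1 ≤ (1 + W.size) ^ 2 := Nat.one_le_pow _ _ (by lia)
  induction n with
  | zero =>
    rintro σ hσ ⟨hI, hμ⟩
    by_cases hx : σ x = 0
    · exact ⟨σ, _, _, .while_zero hx, hσ, ⟨hI, hx⟩, by lia, bits_le_mul_size hσ⟩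
    · obtain ⟨τ, -, -, -, -, ⟨-, hlt⟩, -⟩ := h _ σ hσ ⟨hI, hx, rfl⟩
      lia
  | succ n ih =>
    rintro σ hσ ⟨hI, hμ⟩
    by_cases hx : σ x = 0
    · exact ⟨σ, _, _, .while_zero hx, hσ, ⟨hI, hx⟩, Nat.mul_pos (by lia) hone,
        bits_le_mul_size hσ⟩
    · obtain ⟨τ, t, s, hrun, hτ, ⟨hI', hlt⟩, ht, hs⟩ := h _ σ hσ ⟨hI, hx, rfl⟩
      obtain ⟨ρ, t', s', hrun', hρ, hQ, ht', hs'⟩ := ih τ hτ ⟨hI', by lia⟩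
      refine ⟨ρ, _, _, .while_ne hx hrun hrun', hρ, hQ, ?_, max_le hs hs'⟩
      calc 1 + t + t' ≤ (1 + W.size) ^ 2 + N * (1 + W.size) ^ 2
          + (1 + n * (N + 1)) * (1 + W.size) ^ 2 := by gcongr
        _ = _ := by ring

theorem cmd (a : Cmd r)
    (h : ∀ σ, (∀ i, σ i < W) → P σ → a.val σ < W ∧ Q (Function.update σ a.target (a.val σ))) :
    Hoare W P a.prog 1 Q := by
  intro σ hσ hP
  obtain ⟨hval, hQ⟩ := h σ hσ hP
  have hτ : ∀ i, Function.update σ a.target (a.val σ) i < W := fun i => by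
    by_cases hi : i = a.target
    · rwa [hi, Function.update_self]
    · rw [Function.update_of_ne hi]
      exact hσ i
  have hsize : ∀ {n}, n < W → 1 + n.size ≤ 1 + W.size := fun hn =>
    Nat.add_le_add_left (Nat.size_le_size hn.le) 1
  have hspace := max_le (bits_le_mul_size hσ) (bits_le_mul_size hτ)
  cases a with
  | const x n =>
    have hn := hsize (show n < W from hval)
    exact ⟨_, _, _, .const x n σ, hτ, hQ, by nlinarith only [hn], hspace⟩
  | arith o x y z =>
    refine ⟨_, _, _, .arith o x y z σ, hτ, hQ, ?_, hspace⟩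
    rw [one_mul, sq]
    exact Nat.mul_le_mul (hsize (hσ y)) (hsize (hσ z))

theorem block (a : Cmd r) (l : List (Cmd r))
    (h : ∀ σ, (∀ i, σ i < W) → P σ → Cmd.wp W Q (a :: l) σ) :
    Hoare W P (Cmd.block a l) (l.length + 1) Q := by
  induction l generalizing a P with
  | nil => exact cmd a h
  | cons b l ih =>
    rw [add_comm]
    exact (cmd (Q := Cmd.wp W Q (b :: l)) a h).seq (ih b fun _ _ h => h)

end Hoare

theorem scStar_of_hoare {b : ℕ} [NeZero b] {x : ℝ}
    (h : ∀ c, ∃ (r : ℕ) (p : Prog (r + 1)) (K k : ℕ), ∀ d, 1 ≤ d → ∃ W N : ℕ, d < W ∧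
      W.size ≤ K * Nat.log 2 (d + 1) ^ k ∧ N ≤ K * (d * Nat.log 2 (d + 1) ^ k) ∧
      Hoare W (fun σ => σ = Function.update (0 : Fin (r + 1) → ℕ) 0 d) p N
        (fun τ => AcceptableDigit b x d (Nat.log 2 (d + 1) ^ c) (τ 0))) :
    SCStar b x := by
  intro c
  obtain ⟨r, p, K, k, h⟩ := h c
  refine ⟨r, p, K * (1 + K) ^ 2 + (r + 1) * K, 3 * k, fun d hd => ?_⟩
  obtain ⟨W, N, hdW, hW, hN, hp⟩ := h d hd
  have hinit : ∀ i, (Function.update 0 0 d : Fin (r + 1) → ℕ) i < W := fun i => by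
    rcases eq_or_ne i 0 with rfl | hi
    · rwa [Function.update_self]
    · rw [Function.update_of_ne hi]
      exact d.zero_le.trans_lt hdW
  obtain ⟨τ, t, s, hrun, -, hdigit, ht, hs⟩ := hp _ hinit rfl
  have hlog : 1 ≤ Nat.log 2 (d + 1) := Nat.log_pos one_lt_two (by lia)
  set Y := Nat.log 2 (d + 1) ^ k with hY
  have hY1 : 1 ≤ Y := Nat.one_le_pow _ _ hlog
  rw [show Nat.log 2 (d + 1) ^ (3 * k) = Y ^ 3 by rw [hY, ← pow_mul, mul_comm]]
  refine ⟨τ, t, s, hrun, ?_, ?_, hdigit⟩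
  · calc t ≤ K * (d * Y) * (Y + K * Y) ^ 2 := ht.trans (by gcongr)
      _ = K * (1 + K) ^ 2 * (d * Y ^ 3) := by ring
      _ ≤ _ := by gcongr; exact Nat.le_add_right _ _
  · calc s ≤ (r + 1) * (K * Y ^ 3) :=
          hs.trans (by gcongr; exact hW.trans (by gcongr; exact Nat.le_self_pow (by simp) _))
      _ ≤ _ := by rw [← mul_assoc]; gcongr; exact Nat.le_add_left _ _

/-! ### Modular exponentiation on the register machine -/

namespace Reg

/-- At the start the position `d` of the digit, at the end the digit. -/
abbrev inout : Fin 16 := 0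
abbrev aux : Fin 16 := 1
/-- The number `⌊log₂ (d + 1)⌋`. -/
abbrev log : Fin 16 := 2
/-- The number `X` of bytes of the fixed-point arithmetic. -/
abbrev precision : Fin 16 := 3
/-- The modulus `V = 256 ^ X` of the fixed-point arithmetic. -/
abbrev modulus : Fin 16 := 4
/-- The number `E + 1`, where `16 ^ E` is the factor by which the series are scaled. -/
abbrev scale : Fin 16 := 5
/-- The sum of the integral parts of the scaled terms modulo `V`. -/
abbrev sum : Fin 16 := 6
abbrev index : Fin 16 := 7
/-- The truncated difference of `E + 1` and the exponent of `16` in the denominator of the term. -/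
abbrev remaining : Fin 16 := 8
abbrev divisor : Fin 16 := 9
/-- The modulus of the modular exponentiation, which is `V` times the divisor of the term. -/
abbrev powModulus : Fin 16 := 10
abbrev power : Fin 16 := 11
abbrev base : Fin 16 := 12
abbrev exponent : Fin 16 := 13
abbrev tmp : Fin 16 := 14
abbrev tmp' : Fin 16 := 15

end Reg

/-- One step of exponentiation by repeated squaring, for the lowest binary digit of the exponent. -/
def powModStep : Prog 16 :=
  Cmd.block (.const Reg.tmp 2) [
    .arith .mod Reg.tmp' Reg.exponent Reg.tmp,
    .arith .div Reg.exponent Reg.exponent Reg.tmp,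
    .arith .mul Reg.tmp Reg.tmp' Reg.base,
    .arith .mul Reg.base Reg.base Reg.base,
    .arith .mod Reg.base Reg.base Reg.powModulus,
    .const Reg.aux 1,
    .arith .sub Reg.tmp' Reg.aux Reg.tmp',
    .arith .add Reg.tmp Reg.tmp Reg.tmp',
    .arith .mul Reg.power Reg.power Reg.tmp,
    .arith .mod Reg.power Reg.power Reg.powModulus]

/-- Exponentiation of `16` by repeated squaring. -/
def powMod : Prog 16 :=
  .seq
    (Cmd.block (.const Reg.power 1) [
      .const Reg.base 16,
      .arith .mod Reg.base Reg.base Reg.powModulus])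
    (.while Reg.exponent powModStep)

/-- The contents of the registers that are left unchanged by `powMod`. -/
def Frame (V E s n M m : ℕ) (σ : Fin 16 → ℕ) : Prop :=
  σ Reg.modulus = V ∧ σ Reg.scale = E ∧ σ Reg.sum = s ∧ σ Reg.index = n ∧ σ Reg.divisor = M ∧
    σ Reg.powModulus = m

theorem pow_mod_two_lt {m b : ℕ} (hm : 1 < m) (hb : b < m) (e : ℕ) :
    e % 2 * b + (1 - e % 2) < m := by
  rcases Nat.mod_two_eq_zero_or_one e with h | h <;> rw [h] <;> lia

theorem mul_pow_mod_eq (m b s e : ℕ) :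
    (s * (e % 2 * b + (1 - e % 2)) % m) * (b * b % m) ^ (e / 2) % m = s * b ^ e % m := by
  have h : s * b ^ e = s * (e % 2 * b + (1 - e % 2)) * (b * b) ^ (e / 2) := by
    conv_lhs => rw [← Nat.div_add_mod e 2, pow_add, pow_mul]
    rcases Nat.mod_two_eq_zero_or_one e with h | h <;> rw [h] <;> ring
  rw [h]
  exact (Nat.mod_modEq _ m).mul ((Nat.mod_modEq _ m).pow _)

theorem size_eq_log_add_one {n : ℕ} (hn : n ≠ 0) : n.size = Nat.log 2 n + 1 :=
  le_antisymm (Nat.size_le.2 (Nat.lt_pow_succ_log_self one_lt_two n))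
    (Nat.lt_size.2 (Nat.pow_log_le_self 2 hn))

theorem size_div_two (n : ℕ) : (n / 2).size = n.size - 1 := by
  rcases eq_or_ne (n / 2) 0 with h | h
  · have : n.size ≤ 1 := Nat.size_le.2 (by lia)
    rw [h, Nat.size_zero]
    lia
  · rw [size_eq_log_add_one h, size_eq_log_add_one (by lia), Nat.log_div_base]
    have : 0 < Nat.log 2 n := Nat.log_pos one_lt_two (by lia)
    lia

theorem hoare_powModStep {W V E s n M m a b e : ℕ} (hm : 1 < m) (hW : m * m < W) (ha : a < m)
    (hb : b < m) :
    Hoare W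
      (fun σ => Frame V E s n M m σ ∧ σ Reg.power = a ∧ σ Reg.base = b ∧ σ Reg.exponent = e)
      powModStep 11
      (fun τ => Frame V E s n M m τ ∧ τ Reg.power = a * (e % 2 * b + (1 - e % 2)) % m ∧
        τ Reg.base = b * b % m ∧ τ Reg.exponent = e / 2) := by
  refine Hoare.block _ _ ?_
  rintro σ hσ ⟨⟨hV, hE, hs, hn, hM, hm'⟩, rfl, rfl, rfl⟩
  have hfac := pow_mod_two_lt hm hb (σ Reg.exponent)
  have hbb := (Nat.mul_le_mul hb.le hb.le).trans_lt hW
  have hab := (Nat.mul_le_mul ha.le hfac.le).trans_lt hW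
  have hmW := (Nat.le_mul_self m).trans_lt hW
  have he := hσ Reg.exponent
  have hmod₁ := Nat.mod_lt (σ Reg.base * σ Reg.base) (by lia : m > 0)
  have hmod₂ := Nat.mod_lt (σ Reg.power * (σ Reg.exponent % 2 * σ Reg.base +
    (1 - σ Reg.exponent % 2))) (by lia : m > 0)
  simp +decide only [Cmd.wp, Cmd.val, Cmd.target, Op.eval, Function.update_apply, Frame,
    reduceIte, hV, hE, hs, hn, hM, hm', and_self, and_true]
  generalize σ Reg.exponent % 2 * σ Reg.base = x at *
  refine ⟨by lia, by lia, by lia, by lia, hbb, by lia, by lia, by lia, by lia, hab, by lia⟩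

theorem hoare_powMod {W V E s n M m e : ℕ} (hm : 1 < m) (hW : m * m < W) (hW' : 16 < W) :
    Hoare W (fun σ => Frame V E s n M m σ ∧ σ Reg.exponent = e) powMod (4 + W.size * 12)
      (fun τ => Frame V E s n M m τ ∧ τ Reg.power = 16 ^ e % m) := by
  have hloop := Hoare.while_of_variant (W := W) (x := Reg.exponent) (n := W.size) (p := powModStep)
    (fun σ => Frame V E s n M m σ ∧ σ Reg.power < m ∧ σ Reg.base < m ∧
      σ Reg.power * σ Reg.base ^ σ Reg.exponent % m = 16 ^ e % m)
    (fun σ => (σ Reg.exponent).size) (N := 11) (fun k => by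
      rintro σ hσ ⟨⟨hF, hp, hb, hinv⟩, he, rfl⟩
      refine (hoare_powModStep hm hW hp hb).conseq (fun _ h => h) le_rfl ?_ σ hσ
        ⟨hF, rfl, rfl, rfl⟩
      rintro τ ⟨hF', hp', hb', he'⟩
      have hsize := Nat.size_pos.2 (Nat.pos_of_ne_zero he)
      refine ⟨⟨hF', hp' ▸ Nat.mod_lt _ (by lia), hb' ▸ Nat.mod_lt _ (by lia), ?_⟩, ?_⟩
      · rw [hp', hb', he', mul_pow_mod_eq, hinv]
      · rw [he', size_div_two]
        lia)
  refine ((Hoare.block _ _ ?_).seq hloop).conseq (fun _ h => h)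
    (le_of_eq (by simp only [List.length]; ring)) ?_
  · rintro σ hσ ⟨⟨hV, hE, hs, hn, hM, hm'⟩, he⟩
    have hmod := Nat.mod_lt 16 (by lia : m > 0)
    have hsize : e.size ≤ W.size := Nat.size_le_size (he ▸ (hσ Reg.exponent).le)
    have hmW := (Nat.le_mul_self m).trans_lt hW
    simp +decide only [Cmd.wp, Cmd.val, Cmd.target, Op.eval, Function.update_apply, Frame,
      reduceIte, hV, hE, hs, hn, hM, hm', he, and_self, and_true, true_and, one_mul, ← Nat.pow_mod]
    exact ⟨by lia, hW', by lia, ⟨hm, hmod⟩, hsize⟩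
  · rintro τ ⟨⟨hF, hp, -, hinv⟩, he⟩
    rw [he, pow_zero, mul_one, Nat.mod_eq_of_lt hp] at hinv
    exact ⟨hF, hinv⟩

/-! ### Summation of a series on the register machine -/

/-- The series `num / den * ∑ₙ 16 ^ (-w n) / (8 n + r) ^ 4`, such as the part of `S_{4,w}` where the
index has a given residue modulo `8`. -/
structure BBPSeries where
  w : ℕ
  r : ℕ
  num : ℤ
  den : ℕ
  w_pos : 1 ≤ w
  r_pos : 1 ≤ r
  den_pos : 1 ≤ den

namespace BBPSeries

/-- The divisor of the `n`-th term, without the power of `16`. -/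
def divisor (i : BBPSeries) (n : ℕ) : ℕ := i.den * (8 * n + i.r) ^ 4

/-- The number `⌊16 ^ (E - w n) / divisor n⌋ mod V`, in the form in which it can be computed without
intermediate results of more than polylogarithmic length. -/
def quot (i : BBPSeries) (V E n : ℕ) : ℕ :=
  16 ^ (E - i.w * n) % (i.divisor n * V) / i.divisor n

/-- The scaled sum modulo `V` after the `n`-th term has been added. Subtractions modulo `V` are
replaced by additions of multiples of `V - quot V E n`. -/
def next (i : BBPSeries) (V E n s : ℕ) : ℕ :=
  (s + i.num.toNat * i.quot V E n + (-i.num).toNat * (V - i.quot V E n)) % V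

/-- Prepares the registers for the modular exponentiation. -/
def setup (i : BBPSeries) : Prog 16 :=
  Cmd.block (.const Reg.tmp 1) [
    .arith .sub Reg.exponent Reg.remaining Reg.tmp,
    .const Reg.tmp 8,
    .arith .mul Reg.divisor Reg.tmp Reg.index,
    .const Reg.tmp i.r,
    .arith .add Reg.divisor Reg.divisor Reg.tmp,
    .arith .mul Reg.divisor Reg.divisor Reg.divisor,
    .arith .mul Reg.divisor Reg.divisor Reg.divisor,
    .const Reg.tmp i.den,
    .arith .mul Reg.divisor Reg.tmp Reg.divisor,
    .arith .mul Reg.powModulus Reg.divisor Reg.modulus]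

/-- Adds a term to the sum and proceeds to the next one. -/
def update (i : BBPSeries) : Prog 16 :=
  Cmd.block (.arith .div Reg.power Reg.power Reg.divisor) [
    .const Reg.tmp i.num.toNat,
    .arith .mul Reg.tmp Reg.tmp Reg.power,
    .arith .sub Reg.power Reg.modulus Reg.power,
    .const Reg.tmp' (-i.num).toNat,
    .arith .mul Reg.tmp' Reg.tmp' Reg.power,
    .arith .add Reg.sum Reg.sum Reg.tmp,
    .arith .add Reg.sum Reg.sum Reg.tmp',
    .arith .mod Reg.sum Reg.sum Reg.modulus,
    .const Reg.tmp 1,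
    .arith .add Reg.index Reg.index Reg.tmp,
    .const Reg.tmp i.w,
    .arith .mul Reg.tmp Reg.tmp Reg.index,
    .arith .sub Reg.remaining Reg.scale Reg.tmp]

/-- Computes and adds a term of the series. -/
def addTerm (i : BBPSeries) : Prog 16 := .seq i.setup (.seq powMod i.update)

/-- Adds all the terms with `w n ≤ E` of the series. -/
def addSeries (i : BBPSeries) : Prog 16 :=
  .seq (Cmd.block (.const Reg.index 0) [.arith .add Reg.remaining Reg.scale Reg.index])
    (.while Reg.remaining i.addTerm)

/-- The parameters of the series are bounded by `C`. -/
def Bounded (C : ℕ) (i : BBPSeries) : Prop :=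
  i.w ≤ C ∧ i.r ≤ C ∧ i.num.natAbs ≤ C ∧ i.den ≤ C

/-- A bound for the register contents in the summation of a series with parameters
bounded by `C`: the largest intermediate results are the squares in the modular exponentiation. -/
def registerBound (C V E : ℕ) : ℕ := (C * (8 * (E + 1) + C) ^ 4 * V) ^ 2

/-- The state of the registers before the `n`-th term is added to the sum `s`. -/
def Ready (i : BBPSeries) (V E n s : ℕ) (σ : Fin 16 → ℕ) : Prop :=
  σ Reg.modulus = V ∧ σ Reg.scale = E + 1 ∧ σ Reg.sum = s ∧ σ Reg.index = n ∧
    σ Reg.remaining = E + 1 - i.w * n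

variable (i : BBPSeries) {W V E n s C : ℕ}

theorem divisor_pos (n : ℕ) : 0 < i.divisor n :=
  Nat.mul_pos i.den_pos (Nat.pow_pos (Nat.add_pos_right _ i.r_pos))

theorem quot_lt (hV : 1 ≤ V) (E n : ℕ) : i.quot V E n < V := by
  rw [quot, Nat.div_lt_iff_lt_mul (i.divisor_pos n), mul_comm V]
  exact Nat.mod_lt _ (Nat.mul_pos (i.divisor_pos n) hV)

theorem le_of_w_mul_le {n E : ℕ} (h : i.w * n ≤ E) : n ≤ E :=
  (Nat.le_mul_of_pos_left n i.w_pos).trans h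

theorem divisor_mul_sq_le_registerBound (hi : i.Bounded C) (hn : n ≤ E) :
    i.divisor n * V * (i.divisor n * V) ≤ registerBound C V E := by
  obtain ⟨-, hr, -, hden⟩ := hi
  rw [registerBound, ← sq, divisor]
  gcongr
  lia

theorem le_registerBound (hC : 16 ≤ C) (hV : 1 ≤ V) :
    V * (1 + 2 * C) ≤ registerBound C V E ∧ C * (E + 1) ≤ registerBound C V E := by
  set Y := 8 * (E + 1) + C with hY
  have hbound : Y ^ 2 * V ≤ registerBound C V E := by
    calc Y ^ 2 * V ≤ C * Y ^ 4 * V := by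
          gcongr
          exact (Nat.pow_le_pow_right (by lia) (by simp)).trans
            (Nat.le_mul_of_pos_left _ (by lia))
      _ ≤ (C * Y ^ 4 * V) ^ 2 := Nat.le_self_pow two_ne_zero _
  constructor
  · refine le_trans ?_ hbound
    rw [mul_comm]
    gcongr
    nlinarith
  · refine le_trans ?_ (hbound.trans' (Nat.le_mul_of_pos_right _ hV))
    nlinarith

theorem hoare_setup (hV : 1 ≤ V) (hW : i.divisor n * V < W) (hW' : 8 < W) :
    Hoare W (i.Ready V E n s) i.setup 11
      (fun τ => Frame V (E + 1) s n (i.divisor n) (i.divisor n * V) τ ∧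
        τ Reg.exponent = E - i.w * n) := by
  refine Hoare.block _ _ ?_
  rintro σ hσ ⟨hmod, hscale, hsum, hn, hrem⟩
  have hremW := hrem ▸ hσ Reg.remaining
  simp +decide only [Cmd.wp, Cmd.val, Cmd.target, Op.eval, Function.update_apply, Frame,
    reduceIte, hmod, hscale, hsum, hn, hrem, true_and]
  have hsq : (8 * n + i.r) * (8 * n + i.r) = (8 * n + i.r) ^ 2 := by ring
  have hsq_sq : (8 * n + i.r) ^ 2 * (8 * n + i.r) ^ 2 = (8 * n + i.r) ^ 4 := by ring
  have hle : 8 * n + i.r ≤ (8 * n + i.r) ^ 4 := Nat.le_self_pow (by simp) _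
  have hsq_le : (8 * n + i.r) ^ 2 ≤ (8 * n + i.r) ^ 4 :=
    Nat.pow_le_pow_right (Nat.add_pos_right _ i.r_pos) (by simp)
  have hpow : (8 * n + i.r) ^ 4 ≤ i.divisor n := Nat.le_mul_of_pos_left _ i.den_pos
  have hden : i.den ≤ i.divisor n :=
    Nat.le_mul_of_pos_right _ (Nat.pow_pos (Nat.add_pos_right _ i.r_pos))
  have hdiv : i.divisor n ≤ i.divisor n * V := Nat.le_mul_of_pos_right _ hV
  rw [hsq, hsq_sq, ← divisor]
  refine ⟨by lia, by lia, hW', by lia, by lia, by lia, by lia, by lia, by lia, by lia, hW, ?_⟩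
  lia

theorem hoare_update (hV : 1 ≤ V) (hs : s < V) (hn : i.w * n ≤ E) (hi : i.Bounded C) (hC : 1 ≤ C)
    (hW : V * (1 + 2 * C) < W) (hW' : C * (E + 1) < W) :
    Hoare W
      (fun σ => Frame V (E + 1) s n (i.divisor n) (i.divisor n * V) σ ∧
        σ Reg.power = 16 ^ (E - i.w * n) % (i.divisor n * V))
      i.update 14 (i.Ready V E (n + 1) (i.next V E n s)) := by
  refine Hoare.block _ _ ?_
  rintro σ hσ ⟨⟨hmod, hscale, hsum, hidx, hdiv, -⟩, hpow⟩
  obtain ⟨hw, -, hnum, -⟩ := hi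
  have hEW := hscale ▸ hσ Reg.scale
  have hq := i.quot_lt hV E n
  have hquot : 16 ^ (E - i.w * n) % (i.divisor n * V) / i.divisor n = i.quot V E n := rfl
  simp +decide only [Cmd.wp, Cmd.val, Cmd.target, Op.eval, Function.update_apply, Ready, next,
    reduceIte, hmod, hscale, hsum, hidx, hdiv, hpow, hquot, and_true]
  generalize i.quot V E n = q at *
  have hadd : i.num.toNat * q ≤ C * V := Nat.mul_le_mul (by lia) hq.le
  have hsub : (-i.num).toNat * (V - q) ≤ C * V := Nat.mul_le_mul (by lia) (Nat.sub_le _ _)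
  have hCV : C ≤ C * V := Nat.le_mul_of_pos_right _ hV
  have hnext := Nat.mod_lt (s + i.num.toNat * q + (-i.num).toNat * (V - q)) hV
  have hnE := i.le_of_w_mul_le hn
  have hwn : i.w * (n + 1) ≤ C * (E + 1) := Nat.mul_le_mul hw (Nat.succ_le_succ hnE)
  refine ⟨?_, ?_, ?_, ?_, ?_, ?_, ?_, ?_, ?_, ?_, ?_, ?_, ?_, ?_⟩ <;> lia

theorem hoare_addTerm (hV : 2 ≤ V) (hs : s < V) (hn : i.w * n ≤ E) (hi : i.Bounded C) (hC : 16 ≤ C)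
    (hW : registerBound C V E < W) :
    Hoare W (i.Ready V E n s) i.addTerm (29 + W.size * 12)
      (i.Ready V E (n + 1) (i.next V E n s)) := by
  obtain ⟨hVW, hEW⟩ := le_registerBound (V := V) (E := E) hC (by lia)
  have hsq := (i.divisor_mul_sq_le_registerBound (V := V) hi (i.le_of_w_mul_le hn)).trans_lt hW
  have hone : 1 * 2 ≤ i.divisor n * V := Nat.mul_le_mul (i.divisor_pos n) hV
  have hlt := (Nat.le_mul_self (i.divisor n * V)).trans_lt hsq
  have h16 : 16 < W := by nlinarith
  exact ((i.hoare_setup (by lia) hlt (by lia)).seq ((hoare_powMod hone hsq h16).seq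
    (i.hoare_update (by lia) hs hn hi (by lia) (by lia) (by lia)))).conseq (fun _ h => h) (by lia)
    (fun _ h => h)

theorem hoare_addSeries (hV : 2 ≤ V) (hi : i.Bounded C) (hC : 16 ≤ C)
    (hW : registerBound C V E < W) {A : ℕ → ℕ → Prop}
    (hA : ∀ n s, A n s → i.w * n ≤ E → A (n + 1) (i.next V E n s)) :
    Hoare W
      (fun σ => σ Reg.modulus = V ∧ σ Reg.scale = E + 1 ∧ σ Reg.sum < V ∧ A 0 (σ Reg.sum))
      i.addSeries (3 + (E + 1) * (30 + W.size * 12))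
      (fun τ => τ Reg.modulus = V ∧ τ Reg.scale = E + 1 ∧ τ Reg.sum < V ∧
        ∃ n ≤ E + 1, E < i.w * n ∧ A n (τ Reg.sum)) := by
  have hloop := Hoare.while_of_variant (W := W) (x := Reg.remaining) (N := 29 + W.size * 12)
    (n := E + 1) (p := i.addTerm)
    (fun σ => ∃ n ≤ E + 1, ∃ s < V, i.Ready V E n s σ ∧ A n s) (fun σ => σ Reg.remaining)
    (fun k => by
      rintro σ hσ ⟨⟨n, -, s, hs, hσn, hAs⟩, hne, rfl⟩
      have hrem := hσn.2.2.2.2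
      have hn : i.w * n ≤ E := by lia
      refine (i.hoare_addTerm hV hs hn hi hC hW).conseq (fun _ h => h) le_rfl ?_ σ hσ hσn
      intro τ hτ
      refine ⟨⟨n + 1, Nat.succ_le_succ (i.le_of_w_mul_le hn), _, Nat.mod_lt _ (by lia), hτ,
        hA _ _ hAs hn⟩, ?_⟩
      have hw := i.w_pos
      rw [hτ.2.2.2.2, hrem, mul_add]
      lia)
  refine ((Hoare.block _ _ ?_).seq hloop).conseq (fun _ h => h)
    (le_of_eq (by simp only [List.length]; ring)) ?_
  · rintro σ hσ ⟨hmod, hscale, hsum, hAσ⟩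
    have hE := hscale ▸ hσ Reg.scale
    simp +decide only [Cmd.wp, Cmd.val, Cmd.target, Op.eval, Function.update_apply, Ready,
      reduceIte, hmod, hscale, true_and, add_zero]
    exact ⟨by lia, hE, ⟨0, by lia, σ Reg.sum, hsum, ⟨rfl, rfl, by lia⟩, hAσ⟩, le_rfl⟩
  · rintro τ ⟨⟨n, hn, s, hs, ⟨hmod, hscale, rfl, -, hrem⟩, hAτ⟩, h0⟩
    exact ⟨hmod, hscale, hs, n, hn, by lia, hAτ⟩

end BBPSeries

/-! ### The error of the computation -/

/-- The natural number `s` approximates the real number `y` modulo `V`, with error at most `e`. -/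
def NearMod (V s : ℕ) (y e : ℝ) : Prop := ∃ t : ℤ, t ≡ s [ZMOD V] ∧ |t - y| ≤ e

theorem NearMod.mono {V s : ℕ} {y y' e e' : ℝ} (h : NearMod V s y e) (hy : |y - y'| ≤ e' - e) :
    NearMod V s y' e' := by
  obtain ⟨t, hts, hty⟩ := h
  exact ⟨t, hts, (abs_sub_le (t : ℝ) y y').trans (by linarith)⟩

namespace BBPSeries

/-- The `n`-th term of the series, without the factor `num`. -/
noncomputable def term (i : BBPSeries) (n : ℕ) : ℝ := 1 / (16 ^ (i.w * n) * i.divisor n)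

/-- The sum of the series. -/
noncomputable def value (i : BBPSeries) : ℝ := i.num * ∑' n, i.term n

variable (i : BBPSeries) {V E n s : ℕ} {y e : ℝ}

theorem one_le_divisor (n : ℕ) : (1 : ℝ) ≤ i.divisor n := by
  exact_mod_cast Nat.one_le_iff_ne_zero.2 (i.divisor_pos n).ne'

theorem floor_pow_mul_term (hn : i.w * n ≤ E) :
    ⌊16 ^ E * i.term n⌋ = (16 ^ (E - i.w * n) / i.divisor n : ℕ) := by
  have hdiv : (i.divisor n : ℝ) ≠ 0 := by linarith [i.one_le_divisor n]
  have hterm : 16 ^ E * i.term n = ((16 ^ (E - i.w * n) : ℕ) : ℝ) / i.divisor n := by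
    obtain ⟨j, rfl⟩ := Nat.exists_eq_add_of_le hn
    rw [term, Nat.add_sub_cancel_left, pow_add]
    push_cast
    field_simp
  rw [hterm, ← Int.natCast_floor_eq_floor (by positivity), Nat.floor_div_eq_div]

theorem floor_pow_mul_term_modEq (hn : i.w * n ≤ E) :
    ⌊16 ^ E * i.term n⌋ ≡ i.quot V E n [ZMOD V] := by
  rw [i.floor_pow_mul_term hn, quot, Nat.mod_mul_right_div_self]
  exact (Int.natCast_modEq_iff.2 (Nat.mod_modEq _ _)).symm

theorem modEq_next (hV : 1 ≤ V) :
    s + i.num * i.quot V E n ≡ (i.next V E n s : ℕ) [ZMOD V] := by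
  have hq := (i.quot_lt hV E n).le
  have hnum := Int.toNat_sub_toNat_neg i.num
  rw [next, Int.natCast_mod]
  refine Int.ModEq.symm ((Int.mod_modEq _ _).trans ?_)
  push_cast [Int.natCast_sub hq]
  rw [Int.modEq_iff_dvd]
  exact ⟨-(-i.num).toNat, by linear_combination -(i.quot V E n : ℤ) * hnum⟩

theorem nearMod_next (hV : 1 ≤ V) (hn : i.w * n ≤ E) (h : NearMod V s y e) :
    NearMod V (i.next V E n s) (y + i.num * (16 ^ E * i.term n)) (e + i.num.natAbs) := by
  obtain ⟨t, hts, hty⟩ := h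
  refine ⟨t + i.num * ⌊16 ^ E * i.term n⌋, ?_, ?_⟩
  · exact (hts.add ((i.floor_pow_mul_term_modEq hn).mul_left _)).trans (i.modEq_next hV)
  · have hfloor : |(⌊16 ^ E * i.term n⌋ : ℝ) - 16 ^ E * i.term n| ≤ 1 := by
      rw [abs_le]
      constructor <;> linarith [Int.floor_le (16 ^ E * i.term n),
        Int.lt_floor_add_one (16 ^ E * i.term n)]
    push_cast
    rw [add_sub_add_comm, ← mul_sub, Nat.cast_natAbs, Int.cast_abs]
    refine (abs_add_le _ _).trans (add_le_add hty ?_)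
    rw [abs_mul]
    exact mul_le_of_le_one_right (abs_nonneg _) hfloor

theorem term_nonneg (n : ℕ) : 0 ≤ i.term n := by
  rw [term]
  positivity

theorem term_add_le (n m : ℕ) : i.term (n + m) ≤ (16 ^ (i.w * m))⁻¹ * (1 / 16) ^ n := by
  have hpow : (16 : ℝ) ^ (i.w * m) * 16 ^ n ≤ 16 ^ (i.w * (n + m)) := by
    rw [← pow_add]
    exact pow_le_pow_right₀ (by norm_num) (by nlinarith [i.w_pos])
  rw [term, one_div_pow, inv_mul_eq_div, div_div, mul_comm _ ((16 : ℝ) ^ (i.w * m))]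
  exact one_div_le_one_div_of_le (by positivity)
    (hpow.trans (le_mul_of_one_le_right (by positivity) (i.one_le_divisor _)))

theorem summable_term : Summable i.term :=
  Summable.of_nonneg_of_le i.term_nonneg (fun n => i.term_add_le n 0)
    ((summable_geometric_of_lt_one (by norm_num) (by norm_num)).mul_left _)

theorem tsum_term_add_le (n : ℕ) : ∑' j, i.term (j + n) ≤ 16 * (16 ^ (i.w * n))⁻¹ := by
  have hgeom := (hasSum_geometric_of_lt_one (r := (1 / 16 : ℝ)) (by norm_num)
    (by norm_num)).mul_left ((16 : ℝ) ^ (i.w * n))⁻¹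
  calc ∑' j, i.term (j + n) ≤ (16 ^ (i.w * n))⁻¹ * (1 - 1 / 16)⁻¹ :=
        hasSum_le (fun j => i.term_add_le j n) ((summable_nat_add_iff n).2 i.summable_term).hasSum
          hgeom
    _ ≤ (16 ^ (i.w * n))⁻¹ * 16 := by gcongr; norm_num
    _ = _ := mul_comm _ _

theorem abs_sum_term_sub_tsum_le (hn : E < i.w * n) :
    |16 ^ E * ∑ j ∈ Finset.range n, i.term j - 16 ^ E * ∑' j, i.term j| ≤ 1 := by
  have htail : 0 ≤ ∑' j, i.term (j + n) := tsum_nonneg fun j => i.term_nonneg _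
  rw [← i.summable_term.sum_add_tsum_nat_add n, abs_sub_comm, mul_add, add_sub_cancel_left,
    abs_of_nonneg (by positivity)]
  calc 16 ^ E * ∑' j, i.term (j + n) ≤ 16 ^ E * (16 * (16 ^ (i.w * n))⁻¹) := by
        gcongr
        exact i.tsum_term_add_le n
    _ = 16 ^ (E + 1) / 16 ^ (i.w * n) := by ring
    _ ≤ 1 := by
        rw [div_le_one (by positivity)]
        exact pow_le_pow_right₀ (by norm_num) hn

theorem hoare_addSeries_nearMod {W C : ℕ} (hV : 2 ≤ V) (hi : i.Bounded C) (hC : 16 ≤ C)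
    (hW : registerBound C V E < W) :
    Hoare W
      (fun σ => σ Reg.modulus = V ∧ σ Reg.scale = E + 1 ∧ σ Reg.sum < V ∧
        NearMod V (σ Reg.sum) y e)
      i.addSeries (3 + (E + 1) * (30 + W.size * 12))
      (fun τ => τ Reg.modulus = V ∧ τ Reg.scale = E + 1 ∧ τ Reg.sum < V ∧
        NearMod V (τ Reg.sum) (y + 16 ^ E * i.value) (e + i.num.natAbs * (E + 2))) := by
  refine (i.hoare_addSeries hV hi hC hW (A := fun n s => NearMod V s
    (y + i.num * (16 ^ E * ∑ j ∈ Finset.range n, i.term j)) (e + i.num.natAbs * n))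
    ?_).conseq ?_ le_rfl ?_
  · intro n s h hn
    convert i.nearMod_next (by lia) hn h using 1
    · rw [Finset.sum_range_succ]
      ring
    · push_cast
      ring
  · rintro σ ⟨hmod, hscale, hsum, h⟩
    exact ⟨hmod, hscale, hsum, by simpa using h⟩
  · rintro τ ⟨hmod, hscale, hsum, n, hn, hnE, h⟩
    refine ⟨hmod, hscale, hsum, h.mono ?_⟩
    have hn' : (n : ℝ) ≤ E + 1 := by exact_mod_cast hn
    rw [value, mul_left_comm _ (i.num : ℝ), add_sub_add_left_eq_sub, ← mul_sub, abs_mul,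
      Nat.cast_natAbs, Int.cast_abs]
    calc _ ≤ |(i.num : ℝ)| * 1 := by
          gcongr
          exact i.abs_sum_term_sub_tsum_le hnE
      _ ≤ |(i.num : ℝ)| * (E + 2 - n) := by
          gcongr
          linarith
      _ = _ := by ring

end BBPSeries

theorem digits_div_pow (b : ℕ) [NeZero b] (t P d : ℕ) :
    (Real.digits (t / (b : ℝ) ^ (P + d)) b d : ℕ) = t % b ^ P * b / b ^ P := by
  have hb : (b : ℝ) ≠ 0 := NeZero.ne _
  have hdiv : (t : ℝ) / (b : ℝ) ^ (P + d) * b ^ (d + 1) = (t * b : ℕ) / (b ^ P : ℕ) := by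
    rw [pow_add, pow_succ]
    push_cast
    field_simp
  rw [Real.digits, hdiv, Nat.floor_div_eq_div, Fin.val_ofNat, ← Nat.mul_mod_mul_right,
    Nat.mod_mul_right_div_self]

theorem acceptableDigit_of_nearMod {x e : ℝ} {d m P s : ℕ} (hx : 1 / 16 ≤ x) (hs : s < 16 ^ P)
    (h : NearMod (16 ^ P) s (16 ^ (P + d) * x) e) (he : e * 16 ^ (m + 1) < 16 ^ P) :
    AcceptableDigit 16 x (d + 1) m (s * 16 / 16 ^ P) := by
  obtain ⟨t, hts, ht⟩ := h
  have ht0 : 0 ≤ t := by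
    have hlarge : (16 : ℝ) ^ P * (1 / 16) ≤ 16 ^ (P + d) * x := by
      rw [pow_add, mul_assoc]
      gcongr
      exact hx.trans (le_mul_of_one_le_left (by linarith) (one_le_pow₀ (by norm_num)))
    have hsmall : e * 16 ≤ e * 16 ^ (m + 1) := by
      gcongr
      · exact (abs_nonneg _).trans ht
      · exact le_self_pow₀ (by norm_num) (by lia)
    have hpos : (0 : ℝ) ≤ t := by linarith [(abs_le.1 ht).1]
    exact_mod_cast hpos
  lift t to ℕ using ht0
  have hmod : t % 16 ^ P = s := Nat.mod_eq_of_modEq (Int.natCast_modEq_iff.1 hts) hs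
  refine ⟨t / (16 : ℕ) ^ (P + d), by positivity, ?_, ?_⟩
  · have hscale : (0 : ℝ) < 16 ^ (P + d) := by positivity
    have hdiff : (t : ℝ) / (16 : ℕ) ^ (P + d) - x = (t - 16 ^ (P + d) * x) / 16 ^ (P + d) := by
      push_cast
      field_simp
    rw [hdiff, abs_div, abs_of_pos hscale, div_lt_div_iff₀ hscale (by positivity), one_mul]
    push_cast at ht ⊢
    calc _ ≤ e * 16 ^ (d + 1 + m) := by gcongr
      _ = e * 16 ^ (m + 1) * 16 ^ d := by ring
      _ < 16 ^ P * 16 ^ d := by gcongr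
      _ = _ := (pow_add _ _ _).symm
  · rw [Nat.add_sub_cancel, digits_div_pow, hmod]

/-! ### The digit-extraction program -/

/-- Adds the series of a list to the sum and computes the leading hexadecimal digit of the quotient
of the sum by the modulus. -/
def sumProg : List BBPSeries → Prog 16
  | [] => Cmd.block (.const Reg.tmp 16) [
      .arith .mul Reg.inout Reg.sum Reg.tmp,
      .arith .div Reg.inout Reg.inout Reg.modulus]
  | i :: l => .seq i.addSeries (sumProg l)

/-- Halves `aux` and counts the halvings in `log`. -/
def logStep : Prog 16 :=
  Cmd.block (.const Reg.tmp 1) [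
    .arith .add Reg.log Reg.log Reg.tmp,
    .const Reg.tmp' 2,
    .arith .div Reg.aux Reg.aux Reg.tmp']

/-- Computes `⌊log₂ (d + 1)⌋`, where `d` is the input. -/
def logProg : Prog 16 :=
  .seq
    (Cmd.block (.const Reg.tmp 1) [
      .arith .add Reg.aux Reg.inout Reg.tmp,
      .const Reg.tmp' 2,
      .arith .div Reg.aux Reg.aux Reg.tmp',
      .const Reg.log 0])
    (.while Reg.aux logStep)

/-- Computes the `c`-th power of `⌊log₂ (d + 1)⌋`. -/
def logPowProg (c : ℕ) : Prog 16 :=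
  Cmd.block (.const Reg.precision 1)
    (List.replicate c (.arith .mul Reg.precision Reg.precision Reg.log))

/-- Multiplies the modulus by `256` and decreases the counter `precision`. -/
def modulusStep : Prog 16 :=
  Cmd.block (.const Reg.tmp 256) [
    .arith .mul Reg.modulus Reg.modulus Reg.tmp,
    .const Reg.tmp 1,
    .arith .sub Reg.precision Reg.precision Reg.tmp]

/-- Computes the parameters of the fixed-point arithmetic from the logarithm and its power. -/
def parameterProg (k : ℕ) : Prog 16 :=
  .seq
    (Cmd.block (.arith .add Reg.precision Reg.precision Reg.log) [
      .const Reg.tmp k,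
      .arith .add Reg.precision Reg.precision Reg.tmp,
      .arith .add Reg.scale Reg.precision Reg.precision,
      .arith .add Reg.scale Reg.scale Reg.inout,
      .const Reg.modulus 1,
      .const Reg.sum 0])
    (.while Reg.precision modulusStep)

/-- Initialization of the fixed-point arithmetic with `⌊log₂ (d + 1)⌋ ^ c + ⌊log₂ (d + 1)⌋ + k`
bytes, where `d` is the input. -/
def initProg (c k : ℕ) : Prog 16 := .seq logProg (.seq (logPowProg c) (parameterProg k))

section Sum

open BBPSeries

theorem hoare_sumProg {W V E C : ℕ} {l : List BBPSeries} (hV : 2 ≤ V) (hl : ∀ i ∈ l, i.Bounded C)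
    (hC : 16 ≤ C) (hW : registerBound C V E < W) (y e : ℝ) :
    Hoare W
      (fun σ => σ Reg.modulus = V ∧ σ Reg.scale = E + 1 ∧ σ Reg.sum < V ∧
        NearMod V (σ Reg.sum) y e)
      (sumProg l) (3 + l.length * (3 + (E + 1) * (30 + W.size * 12)))
      (fun τ => ∃ s < V, τ Reg.inout = s * 16 / V ∧
        NearMod V s (y + 16 ^ E * (l.map value).sum)
          (e + (l.map fun i => i.num.natAbs).sum * (E + 2))) := by
  induction l generalizing y e with
  | nil =>
    have hVW := (le_registerBound (E := E) hC (by lia : 1 ≤ V)).1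
    refine (Hoare.block _ _ ?_).conseq (fun _ h => h) (by simp) (fun _ h => h)
    rintro σ - ⟨hmod, -, hsum, h⟩
    simp +decide only [Cmd.wp, Cmd.val, Cmd.target, Op.eval, Function.update_apply, reduceIte, hmod]
    have hdigit := Nat.div_le_self (σ Reg.sum * 16) V
    exact ⟨by nlinarith, by nlinarith, by nlinarith, σ Reg.sum, hsum, rfl, by simpa using h⟩
  | cons i l ih =>
    rw [List.forall_mem_cons] at hl
    refine ((i.hoare_addSeries_nearMod hV hl.1 hC hW).seq (ih hl.2 _ _)).conseq (fun _ h => h)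
      (by rw [List.length_cons]; exact le_of_eq (by ring)) ?_
    rintro τ ⟨s, hs, hinout, h⟩
    refine ⟨s, hs, hinout, ?_⟩
    convert h using 1 <;> simp only [List.map_cons, List.sum_cons, Nat.cast_add] <;> ring

end Sum

theorem hoare_logStep {W d l a : ℕ} (hW : l + 2 < W) :
    Hoare W (fun σ => σ Reg.inout = d ∧ σ Reg.log = l ∧ σ Reg.aux = a) logStep 4
      (fun τ => τ Reg.inout = d ∧ τ Reg.log = l + 1 ∧ τ Reg.aux = a / 2) := by
  refine Hoare.block _ _ ?_
  rintro σ hσ ⟨hinout, hlog, rfl⟩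
  have haux := hσ Reg.aux
  simp +decide only [Cmd.wp, Cmd.val, Cmd.target, Op.eval, Function.update_apply, reduceIte,
    hinout, hlog, and_self, and_true]
  exact ⟨by lia, by lia, by lia, by lia⟩

theorem hoare_logProg {W d : ℕ} (hW : d + 2 < W) :
    Hoare W (fun σ => σ Reg.inout = d) logProg (6 + Nat.log 2 (d + 1) * 5)
      (fun τ => τ Reg.inout = d ∧ τ Reg.log = Nat.log 2 (d + 1)) := by
  have hsize : ((d + 1) / 2).size = Nat.log 2 (d + 1) := by
    rw [size_div_two, size_eq_log_add_one d.succ_ne_zero, Nat.add_sub_cancel]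
  have hlog : Nat.log 2 (d + 1) < d + 1 := Nat.log_lt_self 2 d.succ_ne_zero
  have hloop := Hoare.while_of_variant (W := W) (x := Reg.aux) (N := 4) (n := Nat.log 2 (d + 1))
    (p := logStep)
    (fun σ => σ Reg.inout = d ∧ σ Reg.log + (σ Reg.aux).size = Nat.log 2 (d + 1))
    (fun σ => (σ Reg.aux).size) (fun k => by
      rintro σ hσ ⟨⟨hinout, hl⟩, hne, rfl⟩
      have hpos := Nat.size_pos.2 (Nat.pos_of_ne_zero hne)
      refine (hoare_logStep (by lia)).conseq (fun _ h => h) le_rfl ?_ σ hσ ⟨hinout, rfl, rfl⟩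
      rintro τ ⟨hinout', hlog', haux'⟩
      rw [haux', size_div_two, hlog']
      exact ⟨⟨hinout', by lia⟩, by lia⟩)
  refine ((Hoare.block _ _ ?_).seq hloop).conseq (fun _ h => h)
    (le_of_eq (by simp only [List.length]; ring)) ?_
  · rintro σ - hinout
    simp +decide only [Cmd.wp, Cmd.val, Cmd.target, Op.eval, Function.update_apply, reduceIte,
      hinout, hsize, zero_add, le_refl, and_true]
    exact ⟨by lia, by lia, by lia, by lia, by lia⟩
  · rintro τ ⟨⟨hinout, hl⟩, haux⟩
    rw [haux, Nat.size_zero] at hl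
    exact ⟨hinout, hl⟩

theorem wp_replicate_mul_log {W d l X c : ℕ} {Q : (Fin 16 → ℕ) → Prop} {σ : Fin 16 → ℕ}
    (hl : 1 ≤ l) (hW : X * l ^ c < W)
    (hσ : σ Reg.inout = d ∧ σ Reg.log = l ∧ σ Reg.precision = X)
    (hQ : ∀ τ : Fin 16 → ℕ,
      τ Reg.inout = d ∧ τ Reg.log = l ∧ τ Reg.precision = X * l ^ c → Q τ) :
    Cmd.wp W Q (List.replicate c (.arith .mul Reg.precision Reg.precision Reg.log)) σ := by
  induction c generalizing X σ with
  | zero => exact hQ σ (by simpa only [pow_zero, mul_one] using hσ)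
  | succ c ih =>
    obtain ⟨hinout, hlog, hprec⟩ := hσ
    rw [pow_succ', ← mul_assoc] at hW hQ
    rw [List.replicate_succ]
    refine ⟨?_, ih hW ?_ hQ⟩ <;>
      simp +decide only [Cmd.val, Cmd.target, Op.eval, Function.update_apply, reduceIte, hinout,
        hlog, hprec, and_self]
    exact (Nat.le_mul_of_pos_right _ (Nat.pow_pos hl)).trans_lt hW

theorem hoare_logPowProg {W d l c : ℕ} (hl : 1 ≤ l) (hW : l ^ c < W) :
    Hoare W (fun σ => σ Reg.inout = d ∧ σ Reg.log = l) (logPowProg c) (c + 1)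
      (fun τ => τ Reg.inout = d ∧ τ Reg.log = l ∧ τ Reg.precision = l ^ c) := by
  refine (Hoare.block _ _ ?_).conseq (fun _ h => h) (by rw [List.length_replicate]) (fun _ h => h)
  rintro σ - ⟨hinout, hlog⟩
  refine ⟨(Nat.one_le_pow _ _ hl).trans_lt hW, wp_replicate_mul_log (X := 1) hl
    (by rwa [one_mul]) ?_ fun τ hτ => by rwa [one_mul] at hτ⟩
  simp +decide only [Cmd.val, Cmd.target, Function.update_apply, reduceIte, hinout, hlog, and_self]

theorem hoare_modulusStep {W V E X s : ℕ} (hV : 1 ≤ V) (hW : V * 256 < W) :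
    Hoare W
      (fun σ => σ Reg.modulus = V ∧ σ Reg.scale = E ∧ σ Reg.sum = s ∧ σ Reg.precision = X)
      modulusStep 4
      (fun τ => τ Reg.modulus = V * 256 ∧ τ Reg.scale = E ∧ τ Reg.sum = s ∧
        τ Reg.precision = X - 1) := by
  refine Hoare.block _ _ ?_
  rintro σ hσ ⟨hmod, hscale, hsum, rfl⟩
  have hprec := hσ Reg.precision
  simp +decide only [Cmd.wp, Cmd.val, Cmd.target, Op.eval, Function.update_apply, reduceIte,
    hmod, hscale, hsum, and_self, and_true]
  exact ⟨by lia, hW, by lia, by lia⟩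

theorem hoare_parameterProg {W d l Y k X : ℕ} (hX : X = Y + l + k) (hW : 256 ^ X < W)
    (hW' : 2 * X + d < W) :
    Hoare W (fun σ => σ Reg.inout = d ∧ σ Reg.log = l ∧ σ Reg.precision = Y) (parameterProg k)
      (8 + X * 5)
      (fun τ => τ Reg.modulus = 256 ^ X ∧ τ Reg.scale = 2 * X + d ∧ τ Reg.sum = 0) := by
  have hloop := Hoare.while_of_variant (W := W) (x := Reg.precision) (N := 4) (n := X)
    (p := modulusStep)
    (fun σ => 1 ≤ σ Reg.modulus ∧ σ Reg.modulus * 256 ^ σ Reg.precision = 256 ^ X ∧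
      σ Reg.scale = 2 * X + d ∧ σ Reg.sum = 0)
    (fun σ => σ Reg.precision) (fun n => by
      rintro σ hσ ⟨⟨hone, hmod, hscale, hsum⟩, hne, rfl⟩
      obtain ⟨j, hj⟩ := Nat.exists_eq_add_one_of_ne_zero hne
      rw [hj, pow_succ', ← mul_assoc] at hmod
      have hle := hmod ▸ Nat.le_mul_of_pos_right (σ Reg.modulus * 256) (Nat.pow_pos (n := j)
        (by lia : 0 < 256))
      refine (hoare_modulusStep hone (hle.trans_lt hW)).conseq (fun _ h => h) le_rfl ?_ σ hσ
        ⟨rfl, hscale, hsum, rfl⟩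
      rintro τ ⟨hmod', hscale', hsum', hprec'⟩
      rw [hmod', hprec', hj, Nat.add_sub_cancel]
      exact ⟨⟨by lia, hmod, hscale', hsum'⟩, by lia⟩)
  refine ((Hoare.block _ _ ?_).seq hloop).conseq (fun _ h => h)
    (le_of_eq (by simp only [List.length]; ring)) ?_
  · rintro σ - ⟨hinout, hlog, hprec⟩
    have hpos : 1 ≤ 256 ^ X := Nat.one_le_pow _ _ (by lia)
    simp +decide only [Cmd.wp, Cmd.val, Cmd.target, Op.eval, Function.update_apply, reduceIte,
      hinout, hlog, hprec, ← hX, one_mul, and_true, true_and, le_refl]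
    exact ⟨by lia, by lia, by lia, by lia, by lia, by lia, by lia, by lia⟩
  · rintro τ ⟨⟨-, hmod, hscale, hsum⟩, hprec⟩
    rw [hprec, pow_zero, mul_one] at hmod
    exact ⟨hmod, hscale, hsum⟩

theorem hoare_initProg {W c k d X : ℕ} (hd : 1 ≤ d)
    (hX : X = Nat.log 2 (d + 1) ^ c + Nat.log 2 (d + 1) + k) (hW : 256 ^ X < W)
    (hW' : 2 * X + d < W) :
    Hoare W (fun σ => σ Reg.inout = d) (initProg c k) (15 + c + 10 * X)
      (fun τ => τ Reg.modulus = 256 ^ X ∧ τ Reg.scale = 2 * X + d ∧ τ Reg.sum = 0) := by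
  have hlog : 1 ≤ Nat.log 2 (d + 1) := Nat.log_pos one_lt_two (by lia)
  have hpow : 1 ≤ Nat.log 2 (d + 1) ^ c := Nat.one_le_pow _ _ hlog
  exact ((hoare_logProg (by lia)).seq ((hoare_logPowProg hlog (by lia)).seq
    (hoare_parameterProg hX hW hW'))).conseq (fun _ h => h) (by lia) (fun _ h => h)

/-! ### Hexadecimal digits of linear combinations of series -/

open BBPSeries

theorem exists_bounded (l : List BBPSeries) : ∃ C, 16 ≤ C ∧ ∀ i ∈ l, i.Bounded C := by
  refine ⟨16 + (l.map fun i => i.w + i.r + i.num.natAbs + i.den).sum, by lia, fun i hi => ?_⟩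
  have hle := List.single_le_sum (fun _ _ => Nat.zero_le _) _
    (List.mem_map_of_mem (f := fun i : BBPSeries => i.w + i.r + i.num.natAbs + i.den) hi)
  exact ⟨by lia, by lia, by lia, by lia⟩

theorem registerBound_lt_two_pow {C E X : ℕ} (hC : 32 + C ≤ X) (hE : E + 1 ≤ 3 * 2 ^ X) :
    registerBound C (256 ^ X) E < 2 ^ (35 * X) := by
  have hX : X < 2 ^ X := Nat.lt_two_pow_self
  have hlinear : 8 * (E + 1) + C ≤ 2 ^ (2 * X) := by
    rw [two_mul X, pow_add]
    nlinarith
  calc registerBound C (256 ^ X) E ≤ (2 ^ X * (2 ^ (2 * X)) ^ 4 * 2 ^ (8 * X)) ^ 2 := by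
        rw [registerBound, pow_mul 2 8]
        gcongr
        · lia
        · norm_num
    _ = 2 ^ (34 * X) := by ring
    _ < 2 ^ (35 * X) := Nat.pow_lt_pow_right (by lia) (by lia)

theorem error_mul_pow_lt {D E X m : ℕ} (hD : 4 * D ≤ X) (hE : E + 1 ≤ 3 * 2 ^ X)
    (hm : m + 1 ≤ X) : D * (E + 2) * 16 ^ (m + 1) < 16 ^ (2 * X) := by
  have hX : X < 2 ^ X := Nat.lt_two_pow_self
  have herr : D * (E + 2) < 16 ^ X := by
    calc D * (E + 2) ≤ D * (4 * 2 ^ X) := Nat.mul_le_mul_left _ (by lia)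
      _ = 4 * D * 2 ^ X := by ring
      _ < 2 ^ X * 2 ^ X := Nat.mul_lt_mul_of_pos_right (by lia) (by positivity)
      _ = 4 ^ X := by rw [← mul_pow]; norm_num
      _ ≤ 16 ^ X := Nat.pow_le_pow_left (by lia) _
  calc D * (E + 2) * 16 ^ (m + 1) < 16 ^ X * 16 ^ X :=
        Nat.mul_lt_mul_of_lt_of_le herr (Nat.pow_le_pow_right (by lia) hm) (by positivity)
    _ = 16 ^ (2 * X) := by rw [two_mul, pow_add]

/-- Computes a hexadecimal digit of the sum of the series in the list `l`. -/
def digitProg (c k : ℕ) (l : List BBPSeries) : Prog 16 := .seq (initProg c k) (sumProg l)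

theorem hoare_digitProg {C D c k d X : ℕ} {l : List BBPSeries} (hl : ∀ i ∈ l, i.Bounded C)
    (hC : 16 ≤ C) (hD : (l.map fun i => i.num.natAbs).sum = D) (hk : 32 + C + 4 * D ≤ k)
    (hx : 1 / 16 ≤ (l.map value).sum) (hd : 1 ≤ d)
    (hX : X = Nat.log 2 (d + 1) ^ c + Nat.log 2 (d + 1) + k) :
    Hoare (2 ^ (35 * X)) (fun σ => σ Reg.inout = d) (digitProg c k l)
      (15 + c + 10 * X + (3 + l.length * (3 + (2 * X + d) * (30 + (35 * X + 1) * 12))))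
      (fun τ => AcceptableDigit 16 (l.map value).sum d (Nat.log 2 (d + 1) ^ c) (τ Reg.inout)) := by
  obtain ⟨d, rfl⟩ := Nat.exists_eq_add_of_le' hd
  obtain ⟨E, hE⟩ : ∃ E, E = 2 * X + d := ⟨_, rfl⟩
  have hV : 256 ^ X = 16 ^ (2 * X) := by rw [pow_mul]; norm_num
  have hdX : d + 2 < 2 ^ X := (Nat.lt_pow_succ_log_self one_lt_two _).trans_le
    (Nat.pow_le_pow_right two_pos (by lia))
  have hX2 : X < 2 ^ X := Nat.lt_two_pow_self
  have hW := registerBound_lt_two_pow (C := C) (E := E) (X := X) (by lia) (by lia)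
  have hV1 : 256 ^ 1 ≤ 256 ^ X := Nat.pow_le_pow_right (by lia) (by lia)
  obtain ⟨hVW, hEW⟩ := le_registerBound (V := 256 ^ X) (E := E) hC (by lia)
  have herr := error_mul_pow_lt (D := D) (E := E) (X := X) (m := Nat.log 2 (d + 1 + 1) ^ c)
    (by lia) (by lia) (by lia)
  refine ((hoare_initProg hd hX (by nlinarith) (by nlinarith)).seq ((hoare_sumProg
    (by lia : 2 ≤ 256 ^ X) hl hC hW 0 0).conseq ?_ le_rfl fun _ h => h)).conseq (fun _ h => h) ?_ ?_
  · rintro σ ⟨hmod, hscale, hsum⟩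
    exact ⟨hmod, by lia, by lia, 0, by rw [hsum]; rfl, by simp⟩
  · rw [Nat.size_pow, hE, add_assoc (2 * X)]
  · rintro τ ⟨s, hs, hτ, hnear⟩
    rw [hV] at hs hτ hnear
    rw [zero_add, zero_add, hD, hE] at hnear
    rw [hτ]
    exact acceptableDigit_of_nearMod hx hs hnear (by rw [← hE]; exact_mod_cast herr)

theorem digitProg_time_le {X d c n : ℕ} (hX : 1 ≤ X) (hd : 1 ≤ d) :
    15 + c + 10 * X + (3 + n * (3 + (2 * X + d) * (30 + (35 * X + 1) * 12))) ≤
      (28 + c + 1389 * n) * (d * X ^ 2) := by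
  have hone : X ≤ d * X ^ 2 := by nlinarith
  have hfactor : 2 * X + d ≤ 3 * (d * X) := by nlinarith
  have hseries : 3 + (2 * X + d) * (30 + (35 * X + 1) * 12) ≤ 1389 * (d * X ^ 2) :=
    calc 3 + (2 * X + d) * (30 + (35 * X + 1) * 12)
        ≤ 3 * (d * X ^ 2) + 3 * (d * X) * (462 * X) := by gcongr <;> lia
      _ = 1389 * (d * X ^ 2) := by ring
  calc 15 + c + 10 * X + (3 + n * (3 + (2 * X + d) * (30 + (35 * X + 1) * 12)))
      ≤ (28 + c) * (d * X ^ 2) + n * (1389 * (d * X ^ 2)) := by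
        rw [← add_assoc]
        gcongr
        nlinarith
    _ = _ := by ring

theorem pow_add_add_le {ℓ : ℕ} (hℓ : 1 ≤ ℓ) (c k : ℕ) : ℓ ^ c + ℓ + k ≤ (2 + k) * ℓ ^ (c + 1) := by
  have hpow : ℓ ^ c ≤ ℓ ^ (c + 1) := Nat.pow_le_pow_right hℓ (by lia)
  have hself : ℓ ≤ ℓ ^ (c + 1) := Nat.le_self_pow (by lia) _
  nlinarith

theorem scStar_of_sum {x : ℝ} (l : List BBPSeries) (hx : 1 / 16 ≤ x) (h : (l.map value).sum = x) :
    SCStar 16 x := by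
  subst h
  refine scStar_of_hoare fun c => ?_
  obtain ⟨C, hC, hl⟩ := exists_bounded l
  set k := 32 + C + 4 * (l.map fun i => i.num.natAbs).sum with hk
  set T := 28 + c + 1389 * l.length
  refine ⟨15, digitProg c k l, (36 + T) * (2 + k) ^ 2, (c + 1) * 2, fun d hd => ?_⟩
  obtain ⟨X, hX⟩ : ∃ X, X = Nat.log 2 (d + 1) ^ c + Nat.log 2 (d + 1) + k := ⟨_, rfl⟩
  have hX1 : 1 ≤ X := by lia
  have hbound : X ^ 2 ≤ (2 + k) ^ 2 * Nat.log 2 (d + 1) ^ ((c + 1) * 2) := by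
    rw [pow_mul, ← mul_pow, hX]
    gcongr
    exact pow_add_add_le (Nat.log_pos one_lt_two (by lia)) c k
  have hdX : d + 1 < 2 ^ (35 * X) := (Nat.lt_pow_succ_log_self one_lt_two _).trans_le
    (Nat.pow_le_pow_right two_pos (by lia))
  refine ⟨2 ^ (35 * X), _, by lia, ?_, (digitProg_time_le hX1 hd).trans ?_,
    (hoare_digitProg hl hC rfl hk.ge hx hd hX).conseq ?_ le_rfl fun _ h => h⟩
  · calc (2 ^ (35 * X)).size ≤ 36 * X ^ 2 := by
          rw [Nat.size_pow]
          nlinarith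
      _ ≤ (36 + T) * ((2 + k) ^ 2 * Nat.log 2 (d + 1) ^ ((c + 1) * 2)) := by
          gcongr
          lia
      _ = _ := (mul_assoc _ _ _).symm
  · calc T * (d * X ^ 2)
        ≤ (36 + T) * (d * ((2 + k) ^ 2 * Nat.log 2 (d + 1) ^ ((c + 1) * 2))) := by
          gcongr
          lia
      _ = _ := by ring
  · rintro _ rfl
    exact Function.update_self ..

/-- The series `S_{4,p}(a) / q`, split according to the residue of the index modulo `8`. -/
def residueSeries (p q : ℕ) (hp : 1 ≤ p) (hq : 1 ≤ q) (a : Fin 8 → ℤ) : List BBPSeries :=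
  List.ofFn fun j : Fin 8 =>
    { w := p
      r := j + 1
      num := a j
      den := q * 2 ^ (p * (j + 2) / 2)
      w_pos := hp
      r_pos := Nat.le_add_left _ _
      den_pos := Nat.mul_pos hq (Nat.two_pow_pos _) }

theorem sum_residueSeries {p q : ℕ} (hp : 1 ≤ p) (hq : 1 ≤ q) (a : Fin 8 → ℤ) :
    ((residueSeries p q hp hq a).map value).sum = S 4 p a / q := by
  rw [S, Nat.sumByResidueClasses (summable_S 4 p (by norm_num) a) 8, residueSeries, List.map_ofFn,
    List.sum_ofFn, Finset.sum_div]
  refine Finset.sum_congr rfl fun (j : Fin 8) _ => ?_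
  have hj : (ZMod.val (n := 8) j : ℕ) = j := rfl
  rw [Function.comp_apply, value, ← tsum_mul_left, ← tsum_div_const]
  refine tsum_congr fun m => ?_
  have hexp : (p * (8 * m + j + 1) + p) / 2 = 4 * (p * m) + p * (j + 2) / 2 := by
    rw [← Nat.mul_add_div two_pos]
    ring_nf
  rw [hj, add_comm (j : ℕ) (8 * m), hexp, ofNat_eight_mul_add, pow_add, pow_mul, term, divisor,
    add_assoc (8 * m)]
  push_cast
  field_simp
  norm_num

theorem scStar_of_S {x : ℝ} {p p' q : ℕ} {a b : Fin 8 → ℤ} (hp : 1 ≤ p) (hp' : 1 ≤ p')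
    (hq : 1 ≤ q) (hx : 1 / 16 ≤ x) (h : q * x = S 4 p a + S 4 p' b) : SCStar 16 x := by
  refine scStar_of_sum (residueSeries p q hp hq a ++ residueSeries p' q hp' hq b) hx ?_
  rw [List.map_append, List.sum_append, sum_residueSeries, sum_residueSeries, ← add_div, ← h,
    mul_div_cancel_left₀ _ (by positivity)]

theorem scStar_pi_pow_four : SCStar 16 (Real.pi ^ 4) := by
  have hx : 1 ≤ Real.pi ^ 4 := one_le_pow₀ (by linarith [Real.pi_gt_three])
  refine scStar_of_S (p := 1) (p' := 3) (q := 41) le_rfl (by lia) (by lia) (by linarith) ?_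
    (a := (27648 : ℤ) • ![1, -19, -1, -2, -1, -19, 1, -108])
    (b := (18432 : ℤ) • ![3, -1, -3, -2, -3, -1, 3, 4])
  rw [S_smul, S_smul]
  linear_combination 9216 * bbp_pi_pow_four

theorem half_le_log_two : 1 / 2 ≤ Real.log 2 := by linarith [Real.log_two_gt_d9]

theorem scStar_pi_sq_mul_log_two_sq : SCStar 16 (Real.pi ^ 2 * Real.log 2 ^ 2) := by
  have hpi : 1 ≤ Real.pi ^ 2 := one_le_pow₀ (by linarith [Real.pi_gt_three])
  have hlog := pow_le_pow_left₀ (by norm_num) half_le_log_two 2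
  refine scStar_of_S (p := 1) (p' := 3) (q := 123) le_rfl (by lia) (by lia) (by nlinarith) ?_
    (a := (384 : ℤ) • ![121, -3775, -121, -3194, -121, -3775, 121, -30780])
    (b := (256 : ℤ) • ![773, -367, -773, -406, -773, -367, 773, 1140])
  rw [S_smul, S_smul]
  linear_combination 128 * bbp_pi_sq_mul_log_two_sq

theorem scStar_log_two_pow_four : SCStar 16 (Real.log 2 ^ 4) := by
  have hlog := pow_le_pow_left₀ (by norm_num) half_le_log_two 4
  refine scStar_of_S (p := 1) (p' := 3) (q := 615) le_rfl (by lia) (by lia) (by linarith) ?_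
    (a := (768 : ℤ) • ![73, -2617, -73, -5066, -73, -2617, 73, -27564])
    (b := (256 : ℤ) • ![1258, -761, -1258, -497, -1258, -761, 1258, 2019])
  rw [S_smul, S_smul]
  linear_combination 256 * bbp_log_two_pow_four

end Ladder

theorem mainTheorem5 :
    -- the six ladder relations of order 4
    (Bbar 4 - 5 / 2 * Abar 4 = 343 / 128 * zeta 4 ∧
      Cbar 4 - 7 / 9 * Abar 4 = 5 / 54 * zeta 4 ∧
      Dbar 4 - 1 / 3 * Abar 4 = -(313 / 3456) * zeta 4 ∧
      Ebar 4 - 6 / 25 * Abar 4 = -(1547 / 16000) * zeta 4 ∧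
      Gbar 4 - 2 / 3 * Fbar 4 - beta 3 * Real.log 2 = -(80 / 27) * beta 4 ∧
      Hbar 4 - 4 / 5 * Fbar 4 - 23 / 25 * beta 3 * Real.log 2 = -(384 / 125) * beta 4) ∧
    -- the series for `log⁴ 2` and `π⁴`
    (615 / 256 * Real.log 2 ^ 4 =
        3 * S 4 1 ![73, -2617, -73, -5066, -73, -2617, 73, -27564]
          + S 4 3 ![1258, -761, -1258, -497, -1258, -761, 1258, 2019] ∧
      41 / 9216 * Real.pi ^ 4 =
        3 * S 4 1 ![1, -19, -1, -2, -1, -19, 1, -108]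
          + 2 * S 4 3 ![3, -1, -3, -2, -3, -1, 3, 4]) ∧
    -- membership in SC*, for hexadecimal digits
    (SCStar 16 (Real.pi ^ 4) ∧
      SCStar 16 (Real.pi ^ 2 * Real.log 2 ^ 2) ∧
      SCStar 16 (Real.log 2 ^ 4)) :=
  ⟨⟨ladder_B, ladder_C, ladder_D, ladder_E, ladder_G, ladder_H⟩,
    ⟨bbp_log_two_pow_four, bbp_pi_pow_four⟩,
    ⟨scStar_pi_pow_four, scStar_pi_sq_mul_log_two_sq, scStar_log_two_pow_four⟩⟩
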